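/- Let $\Omega$ be a bounded Lipschitz domain in $\mathbb{R}^d$, $d\ge 2$, with surface measure $\sigma$ on $\partial\Omega$ and outward unit normal $n$. Let $\kappa_*\ge 0$ be an integer, $\tau_*>0$, and let $\mathbf A\in C^{\kappa_*+1}(\overline\Omega;\mathbb{R}^d)$ have magnetic field $\mathbf B=\nabla\times\mathbf A=(\partial_iA_j-\partial_jA_i)_{i,j}\in C^{\kappa_*+1}(\overline\Omega)$ of finite type: $$\sum_{|\alpha|\le\kappa_*}|\partial^\alpha\mathbf B(x)|\ge\tau_*\qquad\text{for all }x\in\overline\Omega .$$ For $\beta>1$ and $x\in\overline\Omega$ put $$\widetilde m(x,\beta\mathbf B)=\sum_{|\alpha|\le\kappa_*}\beta^{\frac1{|\alpha|+2}}|\partial^\alpha\mathbf B(x)|^{\frac1{|\alpha|+2}} .$$ For $x,y\in\overline\Omega$ let $d_\beta(x,y)$ be the infimum of $\int_0^1\widetilde m(\gamma(t),\beta\mathbf B)\,|\gamma'(t)|\,dt$ over all piecewise $C^1$ curves $\gamma:[0,1]\to\overline\Omega$ with $\gamma(0)=x$ and $\gamma(1)=y$. For $t>0$ let $$W_\beta(t)=\{x\in\partial\Omega:\widetilde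 m(x,\beta\mathbf B)<t\},\qquad d_{\beta,t}(x)=\inf\{d_\beta(x,y):y\in W_\beta(t)\},$$ with $\inf\emptyset=+\infty$, $e^{+\infty}=+\infty$ and $\infty\cdot 0=0$. Extend $\mathbf B$ to a $C^{\kappa_*+1}$ field on $\mathbb{R}^d$ (still denoted $\mathbf B$) with $\|\mathbf B\|_{C^{\kappa_*+1}(\mathbb{R}^d)}\le K\|\mathbf B\|_{C^{\kappa_*+1}(\overline\Omega)}$, and define $m(x,\beta\mathbf B)$ by $$\frac1{m(x,\beta\mathbf B)}=\sup\Big\{r>0:\ \sup_{|y-x|<r}|\beta\mathbf B(y)|\le\frac1{r^2}\Big\}.$$ Let $D=-i\nabla$ and let $u\in H^1(\Omega;\mathbb{C})$ be a weak solution, for some $\lambda>0$, of the Steklov problem $$(D+\beta\mathbf A)^2u=0\ \text{ in }\Omega,\qquad n\cdot(\nabla+i\beta\mathbf A)u=\lambda u\ \text{ on }\partial\Omega,$$ that is, $\int_\Omega(D+\beta\mathbf A)u\cdot\overline{(D+\beta\mathbf A)v}\,dx=\lambda\int_{\partial\Omega}u\,\overline v\,d\sigma$ for all $v\in H^1(\Omega;\mathbb{C})$,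 where boundary values are traces. Then there are constants $\varepsilon>0$, $\beta_0>1$ and $C>0$, depending only on $\Omega$, $(\kappa_*,\tau_*)$, an upper bound for $\|\mathbf B\|_{C^{\kappa_*+1}(\overline\Omega)}$ and the extension constant $K$ (and not on $\beta$, $\lambda$, $u$ or otherwise on $\mathbf A$), such that for every $\beta>\beta_0$ $$\int_{\partial\Omega}e^{2\varepsilon d_{\beta,C\lambda}}|u|^2\,d\sigma\le C\int_{\partial\Omega}|u|^2\,d\sigma,$$ $$\int_\Omega e^{2\varepsilon d_{\beta,C\lambda}(x)}\,m(x,\beta\mathbf B)^2|u(x)|^2\,dx\le C\lambda\int_{\partial\Omega}|u|^2\,d\sigma,$$ $$\int_\Omega e^{2\varepsilon d_{\beta,C\lambda}(x)}\,|(D+\beta\mathbf A)u(x)|^2\,dx\le C\lambda\int_{\partial\Omega}|u|^2\,d\sigma .$$ -/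

import Mathlib

open MeasureTheory Set Filter Topology
open scoped ENNReal NNReal ContDiff InnerProductSpace

noncomputable section

namespace MagneticSteklov

/-- Euclidean space `ℝ^d`. -/
abbrev E (d : ℕ) : Type := EuclideanSpace ℝ (Fin d)

/-- The `i`-th standard basis vector of `ℝ^d`. -/
def e {d : ℕ} (i : Fin d) : E d := EuclideanSpace.single i (1 : ℝ)

/-! ### Bounded Lipschitz domains and the surface measure -/

/-- A bounded Lipschitz domain: bounded, open, connected (and non-empty), and near each boundary
point equal, in a ball, to the region above the graph of a Lipschitz function in a rotated
coordinate system. The vertical direction is the unit vector `ν`, the horizontal variables form the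
hyperplane `νᗮ`. -/
structure IsBoundedLipschitzDomain {d : ℕ} (Ω : Set (E d)) : Prop where
  isOpen : IsOpen Ω
  isConnected : IsConnected Ω
  isBounded : Bornology.IsBounded Ω
  lipschitz_boundary : ∀ x₀ ∈ frontier Ω, ∃ r : ℝ, 0 < r ∧ ∃ ν : E d, ‖ν‖ = 1 ∧
    ∃ (L : ℝ≥0) (h : (ℝ ∙ ν)ᗮ → ℝ), LipschitzWith L h ∧
      Ω ∩ Metric.ball x₀ r =
        {y | h ((ℝ ∙ ν)ᗮ.orthogonalProjectionOnto y) < ⟪ν, y⟫_ℝ} ∩ Metric.ball x₀ r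

/-- The surface measure on `∂Ω`: the `(d-1)`-dimensional Hausdorff measure, normalized so that it
agrees with Lebesgue measure on hyperplanes, restricted to `∂Ω`. -/
def surfaceMeasure {d : ℕ} (Ω : Set (E d)) : Measure (E d) :=
  (μHE[d - 1] : Measure (E d)).restrict (frontier Ω)

/-! ### Derivatives on the closed domain -/

/-- The partial derivative `∂^α f (x)` relative to the set `s`, for a multi-index `α`: the iterated
derivative of order `|α|` applied to `α 0` copies of `e 0`, `α 1` copies of `e 1`, and so on. -/
def partialWithin {d : ℕ} {F : Type*} [NormedAddCommGroup F] [NormedSpace ℝ F]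
    (s : Set (E d)) (α : Fin d → ℕ) (f : E d → F) (x : E d) : F :=
  iteratedFDerivWithin ℝ (∑ i, α i) f s x fun j =>
    ((List.finRange d).flatMap fun i => List.replicate (α i) (e i)).getD j 0

/-- The norm of `C^n(s)`, as an extended non-negative number. -/
def CkNorm {d : ℕ} {F : Type*} [NormedAddCommGroup F] [NormedSpace ℝ F]
    (n : ℕ) (s : Set (E d)) (f : E d → F) : ℝ≥0∞ :=
  ⨆ (k : ℕ) (_ : k ≤ n) (x : E d) (_ : x ∈ s), ‖iteratedFDerivWithin ℝ k f s x‖ₑ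

/-- The magnetic field `B = ∇ × A` on the closure of `Ω`: the antisymmetric matrix
`∂_i A_j - ∂_j A_i`, with the Euclidean (Frobenius) norm. -/
def magField {d : ℕ} (Ω : Set (E d)) (A : E d → E d) (x : E d) :
    EuclideanSpace ℝ (Fin d × Fin d) :=
  WithLp.toLp 2 fun p =>
    fderivWithin ℝ A (closure Ω) x (e p.1) p.2 - fderivWithin ℝ A (closure Ω) x (e p.2) p.1

/-- The finite-type condition on the closure of `Ω`:
`∑_{|α| ≤ κ} |∂^α B(x)| ≥ τ` for every `x` in the closure. -/
def IsFiniteType {d : ℕ} (Ω : Set (E d)) (A : E d → E d) (κ : ℕ) (τ : ℝ) : Prop :=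
  ∀ x ∈ closure Ω, τ ≤ ∑ k ∈ Finset.range (κ + 1), ∑ α ∈ Finset.piAntidiag Finset.univ k,
    ‖partialWithin (closure Ω) α (magField Ω A) x‖

/-! ### The functions `m̃` and `m` -/

/-- `m̃(x, βB) = ∑_{|α| ≤ κ} β^{1/(|α|+2)} |∂^α B(x)|^{1/(|α|+2)}`. -/
def mTilde {d : ℕ} (Ω : Set (E d)) (A : E d → E d) (κ : ℕ) (β : ℝ) (x : E d) : ℝ :=
  ∑ k ∈ Finset.range (κ + 1), ∑ α ∈ Finset.piAntidiag Finset.univ k,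
    β ^ (1 / ((k : ℝ) + 2)) *
      ‖partialWithin (closure Ω) α (magField Ω A) x‖ ^ (1 / ((k : ℝ) + 2))

/-- `m(x, F)`, given by `1 / m(x, F) = sup {r > 0 : sup_{B(x, r)} |F| ≤ 1 / r²}`. -/
def mFun {d : ℕ} {V : Type*} [NormedAddCommGroup V] (F : E d → V) (x : E d) : ℝ≥0∞ :=
  (⨆ (r : ℝ) (_ : 0 < r) (_ : ∀ y ∈ Metric.ball x r, ‖F y‖ ≤ 1 / r ^ 2), ENNReal.ofReal r)⁻¹

/-- `B'` is an extension of `B = ∇ × A` from the closure of `Ω` to a `C^n` field on `ℝ^d`, with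
`‖B'‖_{C^n(ℝ^d)} ≤ K ‖B‖_{C^n(closure Ω)}`. -/
structure IsFieldExtension {d : ℕ} (Ω : Set (E d)) (A : E d → E d) (n : ℕ) (K : ℝ≥0)
    (B' : E d → EuclideanSpace ℝ (Fin d × Fin d)) : Prop where
  contDiff : ContDiff ℝ n B'
  eqOn : EqOn B' (magField Ω A) (closure Ω)
  norm_le : CkNorm n univ B' ≤ K * CkNorm n (closure Ω) (magField Ω A)

/-! ### The Agmon distance -/

/-- Piecewise `C^1` curves on `[0, 1]`. -/
def IsPiecewiseC1 {d : ℕ} (γ : ℝ → E d) : Prop :=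
  ∃ (n : ℕ) (t : Fin (n + 1) → ℝ), Monotone t ∧ t 0 = 0 ∧ t (Fin.last n) = 1 ∧
    ∀ i : Fin n, ContDiffOn ℝ 1 γ (Icc (t i.castSucc) (t i.succ))

/-- The Agmon distance `d_β(x, y)`: the infimum of `∫_0^1 m̃(γ(t), βB) |γ'(t)| dt` over the curves
`γ` from `x` to `y` in the closure of `Ω`. -/
def agmonDist {d : ℕ} (Ω : Set (E d)) (A : E d → E d) (κ : ℕ) (β : ℝ) (x y : E d) : ℝ≥0∞ :=
  ⨅ (γ : ℝ → E d) (_ : IsPiecewiseC1 γ) (_ : MapsTo γ (Icc 0 1) (closure Ω))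
    (_ : γ 0 = x) (_ : γ 1 = y),
    ∫⁻ t in Icc (0 : ℝ) 1, ENNReal.ofReal (mTilde Ω A κ β (γ t)) * ‖deriv γ t‖ₑ

/-- The magnetic well `W_β(t) = {x ∈ ∂Ω : m̃(x, βB) < t}`. -/
def well {d : ℕ} (Ω : Set (E d)) (A : E d → E d) (κ : ℕ) (β t : ℝ) : Set (E d) :=
  {x | x ∈ frontier Ω ∧ mTilde Ω A κ β x < t}

/-- `d_{β,t}(x)`, the Agmon distance from `x` to the well `W_β(t)`; it is `∞` if the well is
empty. -/
def wellDist {d : ℕ} (Ω : Set (E d)) (A : E d → E d) (κ : ℕ) (β t : ℝ) (x : E d) : ℝ≥0∞ :=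
  ⨅ y ∈ well Ω A κ β t, agmonDist Ω A κ β x y

/-- The weight `exp(2 ε d_{β,t}(x))`, with `exp ∞ = ∞`. -/
def expWeight {d : ℕ} (Ω : Set (E d)) (A : E d → E d) (κ : ℕ) (β ε t : ℝ) (x : E d) : ℝ≥0∞ :=
  EReal.exp (((2 * ε : ℝ) : EReal) * (wellDist Ω A κ β t x : EReal))

/-! ### Sobolev functions, traces and weak solutions -/

/-- `u ∈ H^1(Ω; ℂ)` with weak gradient `G`. -/
structure MemH1 {d : ℕ} (Ω : Set (E d)) (u : E d → ℂ) (G : E d → EuclideanSpace ℂ (Fin d)) :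
    Prop where
  memLp : MemLp u 2 (volume.restrict Ω)
  memLp_grad : MemLp G 2 (volume.restrict Ω)
  weak_grad : ∀ φ : E d → ℝ, ContDiff ℝ ∞ φ → HasCompactSupport φ → tsupport φ ⊆ Ω →
    ∀ j : Fin d, ∫ x in Ω, u x * (fderiv ℝ φ x (e j) : ℂ) = -∫ x in Ω, G x j * (φ x : ℂ)

/-- The classical gradient of a complex-valued function. -/
def grad {d : ℕ} (φ : E d → ℂ) (x : E d) : EuclideanSpace ℂ (Fin d) :=
  WithLp.toLp 2 fun j => fderiv ℝ φ x (e j)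

/-- `f ∈ L²(∂Ω)` is the trace of the `H^1` function `u` with weak gradient `G`: the trace operator
is the continuous extension to `H^1(Ω)` of the restriction `φ ↦ φ|_{∂Ω}` of functions `φ` that are
smooth up to the boundary. -/
def HasTrace {d : ℕ} (Ω : Set (E d)) (u : E d → ℂ) (G : E d → EuclideanSpace ℂ (Fin d))
    (f : E d → ℂ) : Prop :=
  MemLp f 2 (surfaceMeasure Ω) ∧
  ∃ φ : ℕ → E d → ℂ, (∀ n, ContDiff ℝ ∞ (φ n)) ∧
    Tendsto (fun n => eLpNorm (φ n - u) 2 (volume.restrict Ω)) atTop (𝓝 0) ∧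
    Tendsto (fun n => eLpNorm (grad (φ n) - G) 2 (volume.restrict Ω)) atTop (𝓝 0) ∧
    Tendsto (fun n => eLpNorm (φ n - f) 2 (surfaceMeasure Ω)) atTop (𝓝 0)

/-- `(D + βA) u = -i ∇u + β u A`, where `G` is the weak gradient of `u`. -/
def magGrad {d : ℕ} (A : E d → E d) (β : ℝ) (u : E d → ℂ) (G : E d → EuclideanSpace ℂ (Fin d))
    (x : E d) : EuclideanSpace ℂ (Fin d) :=
  WithLp.toLp 2 fun j => -Complex.I * G x j + (β : ℂ) * (A x j : ℂ) * u x

/-- `u ∈ H^1(Ω; ℂ)`, with weak gradient `G` and trace `f`, is a weak solution of the Steklov problem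
`(D + βA)² u = 0` in `Ω`, `n · (∇ + iβA) u = lam u` on `∂Ω`:
`∫_Ω (D + βA)u · conj((D + βA)v) = lam ∫_{∂Ω} u conj(v)` for all `v ∈ H^1(Ω; ℂ)`.
The complex inner product is conjugate-linear in its first argument. -/
structure IsSteklovSolution {d : ℕ} (Ω : Set (E d)) (A : E d → E d) (β lam : ℝ)
    (u : E d → ℂ) (G : E d → EuclideanSpace ℂ (Fin d)) (f : E d → ℂ) : Prop where
  memH1 : MemH1 Ω u G
  hasTrace : HasTrace Ω u G f
  weak_eq : ∀ (v : E d → ℂ) (H : E d → EuclideanSpace ℂ (Fin d)) (g : E d → ℂ),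
    MemH1 Ω v H → HasTrace Ω v H g →
    ∫ x in Ω, ⟪magGrad A β v H x, magGrad A β u G x⟫_ℂ =
      (lam : ℂ) * ∫ x, f x * (starRingEnd ℂ) (g x) ∂(surfaceMeasure Ω)

end MagneticSteklov

end

/-! The proof is an Agmon estimate. Let n be `fieldScale`, the sum of ‖D^k(βB)‖^{1/(k+2)} over k ≤
κ. It dominates m̃ and, for large β, m on Ω, up to constants; rescaled to length 1/n, the field βB
has bounded derivatives up to order κ+1, and those of order at most κ are not all small. Two
inequalities carry everything, for every v in H¹ with a trace: ∫_Ω n²|v|² ≤ C ∫_Ω |(D+βA)v|²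
(uncertainty) and ∫_∂Ω n|v|² ≤ C ∫_Ω |(D+βA)v|² (trace).

Given these, testing the weak equation with ψ²u, ψ real, yields ∫_Ω |(D+βA)(ψu)|² = λ ∫_∂Ω |ψu|² +
∫_Ω |u|²|∇ψ|² (`IsSteklovSolution.weighted_energy`). Take ψ = exp(εD), with D smooth, |∇D| ≲ n, and
D at bounded distance from the truncated Agmon distance to the well (`exists_smoothing`). For small
ε the uncertainty inequality bounds the gradient term by half of the left side. At a boundary point
outside the well, m̃ and hence n exceeds a large multiple of λ, so the trace inequality absorbs the
boundary term there; on the well the distance vanishes and ψ is bounded. What remains is a multiple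
of ∫_∂Ω |u|². Truncation keeps all integrals finite, which absorption requires; the constants do not
depend on the truncation height, so monotone convergence removes it.

The uncertainty inequality is gauge invariant: only B is bounded, never A. Parallel transport along
a segment changes a function by at most the integral of |(D+βA)u|, and transport around a small
square multiplies it by exp(iΦ), with Φ the flux of βB. If one component of βB keeps its sign and
has size n² on a ball of radius of order 1/n, squares of side of order 1/n have flux bounded above
and below, so |u| is controlled by the transport along the four sides
(`lintegral_sq_le_of_field_large`). Such a ball exists near every point (`exists_ball_field_large`):
some derivative of order k ≤ κ has size n^{k+2}, and Taylor expansion lowers the order one step at a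
time at nearby points. Transport moves the mass near any point into that ball, and averaging over
all points makes the estimate global (`lintegral_scale_sq_le_of_local`). The trace inequality comes
from transport inwards over a distance of order 1/n.

Large β makes n large: then 1/n is below the geometric lengths of Ω, and n^{κ+3} dominates the
derivatives of order κ+1, which makes n slowly varying (`exists_fieldScale_large`,
`exists_isSlowScale`). The Lipschitz boundary enters through a uniform interior cone, which supplies
short paths in the closure and volume bounds, and through local graphs for the boundary integrals.
-/

noncomputable section

namespace MagneticSteklov

section

variable {d : ℕ}

/-! ### The uniform cone property -/

/-- Around every point of `s` there is a cone of fixed aperture and height whose translates to all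
nearby points of `closure Ω` lie in `Ω`. -/
structure UniformConeOn (Ω s : Set (E d)) (δ θ : ℝ) : Prop where
  pos : 0 < δ
  aperture_pos : 0 < θ
  aperture_le : θ ≤ 1
  cone : ∀ x₀ ∈ s, ∃ ν : E d, ‖ν‖ = 1 ∧ ∀ x ∈ closure Ω, dist x x₀ < δ →
    ∀ t, 0 < t → t ≤ δ → Metric.ball (x + t • ν) (θ * t) ⊆ Ω

lemma UniformConeOn.mono {Ω s : Set (E d)} {δ θ δ' θ' : ℝ} (h : UniformConeOn Ω s δ θ)
    (hδ : 0 < δ') (hδ' : δ' ≤ δ) (hθ : 0 < θ') (hθ' : θ' ≤ θ) : UniformConeOn Ω s δ' θ' where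
  pos := hδ
  aperture_pos := hθ
  aperture_le := hθ'.trans h.aperture_le
  cone x₀ hx₀ := by
    obtain ⟨ν, hν, H⟩ := h.cone x₀ hx₀
    refine ⟨ν, hν, fun x hx hxx t ht htδ => ?_⟩
    exact (Metric.ball_subset_ball (by gcongr)).trans
      (H x hx (hxx.trans_le hδ') t ht (htδ.trans hδ'))

lemma graph_le_of_mem_closure {Ω : Set (E d)} {x₀ ν : E d} {r : ℝ} {h : (ℝ ∙ ν)ᗮ → ℝ}
    (hh : Continuous h)
    (hΩ : Ω ∩ Metric.ball x₀ r =
        {y | h ((ℝ ∙ ν)ᗮ.orthogonalProjectionOnto y) < ⟪ν, y⟫_ℝ} ∩ Metric.ball x₀ r)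
    {x : E d} (hx : x ∈ closure Ω) (hxr : x ∈ Metric.ball x₀ r) :
    h ((ℝ ∙ ν)ᗮ.orthogonalProjectionOnto x) ≤ ⟪ν, x⟫_ℝ := by
  have h1 : x ∈ closure (Ω ∩ Metric.ball x₀ r) := by
    have := Metric.isOpen_ball.inter_closure (s := Metric.ball x₀ r) (t := Ω) ⟨hxr, hx⟩
    rwa [inter_comm] at this
  rw [hΩ] at h1
  have h2 : IsClosed {y : E d | h ((ℝ ∙ ν)ᗮ.orthogonalProjectionOnto y) ≤ ⟪ν, y⟫_ℝ} :=
    isClosed_le (by fun_prop) (by fun_prop)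
  exact closure_minimal (fun y hy => show _ ≤ _ from le_of_lt (mem_ofPred.1 hy.1)) h2 h1

/-- Moving by t along ν raises the height by t and leaves the horizontal projection fixed. A further
displacement w costs at most ‖w‖ in height and moves the graph by at most L‖w‖, and (L+1)‖w‖ < t. -/
lemma cone_above_graph {ν : E d} (hν : ‖ν‖ = 1) {L : ℝ≥0} {h : (ℝ ∙ ν)ᗮ → ℝ}
    (hh : LipschitzWith L h) {x y : E d}
    (hx : h ((ℝ ∙ ν)ᗮ.orthogonalProjectionOnto x) ≤ ⟪ν, x⟫_ℝ) {t : ℝ} (ht : 0 < t)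
    (hy : y ∈ Metric.ball (x + t • ν) ((L + 1 : ℝ)⁻¹ * t)) :
    h ((ℝ ∙ ν)ᗮ.orthogonalProjectionOnto y) < ⟪ν, y⟫_ℝ := by
  set w := y - (x + t • ν) with hw
  have hwn : ‖w‖ < (L + 1 : ℝ)⁻¹ * t := by simpa [dist_eq_norm, hw] using hy
  have hyw : y = x + t • ν + w := by rw [hw]; abel
  have hL : (0 : ℝ) < L + 1 := by positivity
  have hPν : (ℝ ∙ ν)ᗮ.orthogonalProjectionOnto ν = 0 := by
    rw [Submodule.orthogonalProjectionOnto_eq_zero_iff, Submodule.orthogonal_orthogonal]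
    exact Submodule.mem_span_singleton_self ν
  have hP : (ℝ ∙ ν)ᗮ.orthogonalProjectionOnto y =
      (ℝ ∙ ν)ᗮ.orthogonalProjectionOnto x + (ℝ ∙ ν)ᗮ.orthogonalProjectionOnto w := by
    rw [hyw, map_add, map_add, map_smul, hPν]; simp
  have h1 : |h ((ℝ ∙ ν)ᗮ.orthogonalProjectionOnto y) - h ((ℝ ∙ ν)ᗮ.orthogonalProjectionOnto x)|
      ≤ L * ‖w‖ := by
    have := hh.dist_le_mul ((ℝ ∙ ν)ᗮ.orthogonalProjectionOnto y)
      ((ℝ ∙ ν)ᗮ.orthogonalProjectionOnto x)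
    rw [Real.dist_eq, hP, dist_eq_norm, add_sub_cancel_left] at this
    rw [hP]
    refine this.trans ?_
    gcongr
    exact (ℝ ∙ ν)ᗮ.norm_orthogonalProjectionOnto_apply_le w
  have h2 : ⟪ν, y⟫_ℝ = ⟪ν, x⟫_ℝ + t + ⟪ν, w⟫_ℝ := by
    rw [hyw, inner_add_right, inner_add_right, inner_smul_right, real_inner_self_eq_norm_sq, hν]
    ring
  have h3 : -‖w‖ ≤ ⟪ν, w⟫_ℝ := by
    have := abs_real_inner_le_norm ν w
    rw [hν, one_mul] at this
    exact (abs_le.1 this).1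
  have h4 : (L + 1) * ‖w‖ < t := by
    calc (L + 1) * ‖w‖ < (L + 1) * ((L + 1 : ℝ)⁻¹ * t) := by gcongr
      _ = t := by field_simp
  have := (abs_le.1 h1).2
  linarith

lemma exists_uniformConeOn_nhd {Ω : Set (E d)} (hd : 2 ≤ d) (hΩ : IsBoundedLipschitzDomain Ω)
    {z : E d} (hz : z ∈ closure Ω) :
    ∃ δ θ : ℝ, UniformConeOn Ω (Metric.ball z δ) δ θ := by
  by_cases hzΩ : z ∈ Ω
  · obtain ⟨r, hr, hrΩ⟩ := Metric.isOpen_iff.1 hΩ.isOpen z hzΩ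
    refine ⟨r / 4, 1, by positivity, one_pos, le_rfl, fun x₀ hx₀ => ?_⟩
    -- At an interior point every direction serves; a basis vector is at hand because d ≥ 2.
    refine ⟨e ⟨0, by omega⟩, by simp [e], fun x _ hxx t ht htr y hy => hrΩ ?_⟩
    rw [Metric.mem_ball] at *
    have h1 : dist (x + t • (e ⟨0, by omega⟩ : E d)) x ≤ t := by
      simp [e, norm_smul, abs_of_pos ht]
    have := dist_triangle4 y (x + t • (e ⟨0, by omega⟩ : E d)) x x₀
    have := dist_triangle y x₀ z
    linarith
  · have hzf : z ∈ frontier Ω := by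
      rw [hΩ.isOpen.frontier_eq]; exact ⟨hz, hzΩ⟩
    obtain ⟨r, hr, ν, hν, L, h, hh, hgr⟩ := hΩ.lipschitz_boundary z hzf
    have hL1 : ((L + 1 : ℝ)⁻¹) ≤ 1 := inv_le_one_of_one_le₀ (by simp)
    refine ⟨r / 4, (L + 1 : ℝ)⁻¹, by positivity, by positivity, hL1, fun x₀ hx₀ => ?_⟩
    refine ⟨ν, hν, fun x hx hxx t ht htr y hy => ?_⟩
    have hxz : x ∈ Metric.ball z r := by
      rw [Metric.mem_ball] at *
      have := dist_triangle x x₀ z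
      linarith
    have h1 := cone_above_graph hν hh (graph_le_of_mem_closure hh.continuous hgr hx hxz) ht hy
    have hyz : y ∈ Metric.ball z r := by
      rw [Metric.mem_ball] at *
      have h1 : dist (x + t • ν) x ≤ t := by
        simp [norm_smul, abs_of_pos ht, hν]
      have := dist_triangle4 y (x + t • ν) x x₀
      have := dist_triangle y x₀ z
      have : (L + 1 : ℝ)⁻¹ * t ≤ 1 * t := by gcongr
      linarith
    have : y ∈ Ω ∩ Metric.ball z r := by rw [hgr]; exact ⟨h1, hyz⟩
    exact this.1

lemma IsBoundedLipschitzDomain.isCompact_closure {Ω : Set (E d)}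
    (hΩ : IsBoundedLipschitzDomain Ω) : IsCompact (closure Ω) :=
  hΩ.isBounded.isCompact_closure

/-- Compactness of the closure. Only δ and θ have to be uniform, the axis may change with the base
point, so a union of two sets is handled by taking minima. -/
theorem exists_uniformConeOn {Ω : Set (E d)} (hd : 2 ≤ d) (hΩ : IsBoundedLipschitzDomain Ω) :
    ∃ δ θ : ℝ, UniformConeOn Ω (closure Ω) δ θ := by
  refine hΩ.isCompact_closure.induction_on
    (p := fun s => ∃ δ θ : ℝ, UniformConeOn Ω s δ θ) ?_ ?_ ?_ ?_
  · exact ⟨1, 1, one_pos, one_pos, le_rfl, by simp⟩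
  · rintro s t hst ⟨δ, θ, h⟩
    exact ⟨δ, θ, h.pos, h.aperture_pos, h.aperture_le, fun x hx => h.cone x (hst hx)⟩
  · rintro s t ⟨δ, θ, h⟩ ⟨δ', θ', h'⟩
    have h1 := h.mono (lt_min h.pos h'.pos) (min_le_left _ _)
      (lt_min h.aperture_pos h'.aperture_pos) (min_le_left _ _)
    have h2 := h'.mono (lt_min h.pos h'.pos) (min_le_right _ _)
      (lt_min h.aperture_pos h'.aperture_pos) (min_le_right _ _)
    refine ⟨_, _, h1.pos, h1.aperture_pos, h1.aperture_le, fun x hx => ?_⟩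
    exact hx.elim (h1.cone x) (h2.cone x)
  · intro x hx
    obtain ⟨δ, θ, h⟩ := exists_uniformConeOn_nhd hd hΩ hx
    exact ⟨_, mem_nhdsWithin_of_mem_nhds (Metric.ball_mem_nhds x h.pos), δ, θ, h⟩

lemma segment_add_subset_closure {Ω : Set (E d)} {δ θ : ℝ} {x ν : E d}
    (hx : x ∈ closure Ω) (hθ : 0 < θ)
    (H : ∀ t, 0 < t → t ≤ δ → Metric.ball (x + t • ν) (θ * t) ⊆ Ω) {t : ℝ} (ht : 0 ≤ t)
    (htδ : t ≤ δ) : segment ℝ x (x + t • ν) ⊆ closure Ω := by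
  rw [segment_eq_image']
  rintro _ ⟨a, ⟨ha0, ha1⟩, rfl⟩
  simp only [add_sub_cancel_left, smul_smul]
  rcases (mul_nonneg ha0 ht).eq_or_lt with h | h
  · rw [← h]; simpa using hx
  · have hat : a * t ≤ δ := by nlinarith
    exact subset_closure (H (a * t) h hat (Metric.mem_ball_self (by positivity)))

/-- The closure contains a convex cone with non-empty interior whose closure contains its vertex x.
This makes derivatives relative to the closure well determined, boundary points included. -/
theorem UniformConeOn.uniqueDiffOn {Ω : Set (E d)} {δ θ : ℝ}
    (h : UniformConeOn Ω (closure Ω) δ θ) : UniqueDiffOn ℝ (closure Ω) := by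
  intro x hx
  obtain ⟨ν, hν, H⟩ := h.cone x hx
  have hδ := h.pos
  have hθ := h.aperture_pos
  specialize H x hx (by simpa using h.pos)
  let S : Set (E d) := {y | ∃ t, 0 < t ∧ t ≤ δ ∧ ‖y - (x + t • ν)‖ < θ * t}
  have hS : S ⊆ closure Ω := by
    rintro y ⟨t, ht, htδ, hy⟩
    exact subset_closure (H t ht htδ (by simpa [dist_eq_norm] using hy))
  have hconv : Convex ℝ S := by
    rintro y ⟨t, ht, htδ, hy⟩ z ⟨t', ht', htδ', hz⟩ a b ha hb hab
    refine ⟨a * t + b * t', ?_, ?_, ?_⟩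
    · rcases ha.eq_or_lt with rfl | ha
      · have : b = 1 := by linarith
        simpa [this] using ht'
      · positivity
    · calc a * t + b * t' ≤ a * δ + b * δ := by gcongr
        _ = δ := by rw [← add_mul, hab, one_mul]
    · have e1 : a • y + b • z - (x + (a * t + b * t') • ν) =
          a • (y - (x + t • ν)) + b • (z - (x + t' • ν)) := by
        have : x = (a + b) • x := by rw [hab, one_smul]
        conv_lhs => rw [this]
        module
      rw [e1]
      refine (norm_add_le _ _).trans_lt ?_
      rw [norm_smul, norm_smul, Real.norm_of_nonneg ha, Real.norm_of_nonneg hb]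
      rcases ha.eq_or_lt with rfl | ha
      · have : b = 1 := by linarith
        simpa [this] using hz
      · have : b * ‖z - (x + t' • ν)‖ ≤ b * (θ * t') := by gcongr
        have : a * ‖y - (x + t • ν)‖ < a * (θ * t) := by gcongr
        linarith
  have hball : Metric.ball (x + δ • ν) (θ * δ) ⊆ S := fun y hy =>
    ⟨δ, hδ, le_rfl, by simpa [dist_eq_norm] using hy⟩
  have hint : (interior S).Nonempty :=
    ⟨x + δ • ν, interior_mono hball
      (by rw [Metric.isOpen_ball.interior_eq]; exact Metric.mem_ball_self (by positivity))⟩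
  have hxS : x ∈ closure S := by
    have ht : Tendsto (fun t : ℝ => x + t • ν) (𝓝[>] 0) (𝓝 x) := by
      have : Tendsto (fun t : ℝ => x + t • ν) (𝓝 0) (𝓝 (x + (0 : ℝ) • ν)) :=
        Continuous.tendsto (by fun_prop) 0
      simpa using this.mono_left nhdsWithin_le_nhds
    refine mem_closure_of_tendsto ht ?_
    filter_upwards [Ioc_mem_nhdsGT hδ] with t ht
    exact ⟨t, ht.1, ht.2, by simpa using mul_pos hθ ht.1⟩
  exact (uniqueDiffWithinAt_convex hconv hint hxS).mono hS

/-- Nearby points of `closure Ω` are joined inside `closure Ω` by three segments whose lengths are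
comparable to their distance. -/
theorem UniformConeOn.exists_path {Ω : Set (E d)} {δ θ : ℝ}
    (h : UniformConeOn Ω (closure Ω) δ θ) {x y : E d} (hx : x ∈ closure Ω) (hy : y ∈ closure Ω)
    (hxy : 2 * dist x y ≤ θ * δ) :
    ∃ x' y' : E d, segment ℝ x x' ⊆ closure Ω ∧ segment ℝ x' y' ⊆ closure Ω ∧
      segment ℝ y' y ⊆ closure Ω ∧ dist x x' = 2 / θ * dist x y ∧ dist x' y' = dist x y ∧
      dist y' y = 2 / θ * dist x y := by
  obtain ⟨ν, hν, H⟩ := h.cone x hx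
  have hδ := h.pos
  have hθ := h.aperture_pos
  rcases eq_or_ne x y with rfl | hne
  · exact ⟨x, x, by simpa, by simpa, by simpa, by simp⟩
  have hpos : 0 < dist x y := dist_pos.2 hne
  -- At this height the cone of x has a cross-section ball of radius θt = 2 dist x y, which contains
  -- y + tν. Both points are pushed inwards by tν, and the middle segment lies in that ball.
  set t := 2 / θ * dist x y with ht
  have ht0 : 0 < t := by positivity
  have htθ : θ * t = 2 * dist x y := by rw [ht]; field_simp
  have htδ : t ≤ δ := by
    by_contra hcon
    push Not at hcon
    have : θ * δ < θ * t := by gcongr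
    linarith
  have hyx : dist y x < δ := by
    rw [dist_comm]
    have : θ * δ ≤ 1 * δ := by gcongr; exact h.aperture_le
    linarith
  have hball := H x hx (by simpa using hδ) t ht0 htδ
  refine ⟨x + t • ν, y + t • ν, segment_add_subset_closure hx hθ (H x hx (by simpa using hδ))
    ht0.le htδ, ?_, ?_, by simp [norm_smul, hν, abs_of_pos ht0], by simp,
    by simp [norm_smul, hν, abs_of_pos ht0]⟩
  · refine ((convex_ball (x + t • ν) (θ * t)).segment_subset (Metric.mem_ball_self (by positivity))
      ?_).trans (hball.trans subset_closure)
    rw [Metric.mem_ball, dist_add_right, dist_comm, htθ]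
    linarith
  · rw [segment_symm]
    exact segment_add_subset_closure hy hθ (H y hy hyx) ht0.le htδ

/-- The cone at x contains the ball of radius θr/2 about the point at height r/2, and this ball
stays within distance r of x. -/
theorem UniformConeOn.volume_inter_ball_ge {Ω : Set (E d)} {δ θ : ℝ}
    (h : UniformConeOn Ω (closure Ω) δ θ) {x : E d} (hx : x ∈ closure Ω) {r : ℝ} (hr : 0 < r)
    (hrδ : r ≤ δ) :
    ENNReal.ofReal ((θ / 2 * r) ^ d) * volume (Metric.ball (0 : E d) 1) ≤
      volume (Ω ∩ Metric.ball x r) := by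
  obtain ⟨ν, hν, H⟩ := h.cone x hx
  have hθ := h.aperture_pos
  have hsub : Metric.ball (x + (r / 2) • ν) (θ * (r / 2)) ⊆ Ω ∩ Metric.ball x r := by
    refine subset_inter (H x hx (by simpa using h.pos) _ (by positivity) (by linarith)) ?_
    refine Metric.ball_subset_ball' ?_
    rw [dist_self_add_left, norm_smul, hν, Real.norm_of_nonneg (by positivity)]
    have : θ * (r / 2) ≤ 1 * (r / 2) := by gcongr; exact h.aperture_le
    linarith
  refine le_trans (le_of_eq ?_) (measure_mono hsub)
  rw [Measure.addHaar_ball_of_pos _ (x + (r / 2) • ν) (by positivity)]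
  simp only [finrank_euclideanSpace, Fintype.card_fin]
  ring_nf

end

section

variable {d : ℕ} {V : Type*} [NormedAddCommGroup V] [NormedSpace ℝ V]

/-! ### The scale attached to the derivatives of a field -/

/-- `∑_{k ≤ κ} ‖D^k F(x)‖^{1/(k+2)}`, the derivatives being taken relative to `s`. -/
def derivScale (κ : ℕ) (s : Set (E d)) (F : E d → V) (x : E d) : ℝ :=
  ∑ k ∈ Finset.range (κ + 1), ‖iteratedFDerivWithin ℝ k F s x‖ ^ (1 / ((k : ℝ) + 2))

variable {κ : ℕ} {s : Set (E d)} {F : E d → V}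

lemma derivScale_nonneg (x : E d) : 0 ≤ derivScale κ s F x :=
  Finset.sum_nonneg fun _ _ => by positivity

lemma rpow_one_div_pow {a : ℝ} (ha : 0 ≤ a) (k : ℕ) : (a ^ (1 / ((k : ℝ) + 2))) ^ (k + 2) = a := by
  rw [← Real.rpow_natCast, ← Real.rpow_mul ha]
  have : (1 / ((k : ℝ) + 2)) * ((k + 2 : ℕ) : ℝ) = 1 := by push_cast; field_simp
  rw [this, Real.rpow_one]

lemma norm_iteratedFDerivWithin_le_derivScale_pow {k : ℕ} (hk : k ≤ κ) (x : E d) :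
    ‖iteratedFDerivWithin ℝ k F s x‖ ≤ derivScale κ s F x ^ (k + 2) := by
  conv_lhs => rw [← rpow_one_div_pow (norm_nonneg (iteratedFDerivWithin ℝ k F s x)) k]
  gcongr
  exact Finset.single_le_sum (f := fun k : ℕ => ‖iteratedFDerivWithin ℝ k F s x‖ ^ (1 / ((k : ℝ) + 2)))
    (fun _ _ => by positivity) (Finset.mem_range.2 (by omega))

/-- Pigeonhole: one of the κ+1 summands is at least the average. -/
lemma exists_derivScale_pow_le (x : E d) :
    ∃ k ≤ κ, (derivScale κ s F x / (κ + 1)) ^ (k + 2) ≤ ‖iteratedFDerivWithin ℝ k F s x‖ := by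
  obtain ⟨k, hk, hle⟩ := Finset.exists_le_of_sum_le (s := Finset.range (κ + 1)) (by simp)
    (f := fun _ => derivScale κ s F x / (κ + 1))
    (g := fun k : ℕ => ‖iteratedFDerivWithin ℝ k F s x‖ ^ (1 / ((k : ℝ) + 2)))
    (by
      rw [Finset.sum_const, Finset.card_range, nsmul_eq_mul]
      push_cast
      rw [mul_div_cancel₀ _ (by positivity)]
      rfl)
  refine ⟨k, by simpa [Nat.lt_succ_iff] using hk, ?_⟩
  conv_rhs => rw [← rpow_one_div_pow (norm_nonneg (iteratedFDerivWithin ℝ k F s x)) k]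
  have := derivScale_nonneg (κ := κ) (s := s) (F := F) x
  gcongr

lemma derivScale_le {y : E d} {μ c : ℝ} (hμ : 0 ≤ μ) (hc : 1 ≤ c)
    (h : ∀ k ≤ κ, ‖iteratedFDerivWithin ℝ k F s y‖ ≤ c * μ ^ (k + 2)) :
    derivScale κ s F y ≤ (κ + 1) * c * μ := by
  have : ∀ k ∈ Finset.range (κ + 1),
      ‖iteratedFDerivWithin ℝ k F s y‖ ^ (1 / ((k : ℝ) + 2)) ≤ c * μ := by
    intro k hk
    rw [← pow_le_pow_iff_left₀ (n := k + 2) (by positivity) (by positivity) (by omega),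
      rpow_one_div_pow (norm_nonneg _), mul_pow]
    refine (h k (by simpa [Nat.lt_succ_iff] using hk)).trans ?_
    gcongr
    exact le_self_pow₀ hc (by omega)
  refine (Finset.sum_le_sum this).trans (le_of_eq ?_)
  rw [Finset.sum_const, Finset.card_range, nsmul_eq_mul]
  push_cast
  ring

lemma continuousOn_derivScale (hF : ContDiffOn ℝ (κ + 1 : ℕ) F s) (hs : UniqueDiffOn ℝ s) :
    ContinuousOn (derivScale κ s F) s := by
  unfold derivScale
  refine continuousOn_finsetSum _ fun k hk => ?_
  have hk' : k < κ + 1 := by simpa using hk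
  refine ContinuousOn.rpow_const ?_ fun x _ => Or.inr (by positivity)
  exact (hF.continuousOn_iteratedFDerivWithin (by exact_mod_cast hk'.le) hs).norm

lemma norm_iteratedFDerivWithin_sub_le (hF : ContDiffOn ℝ (κ + 1 : ℕ) F s) (hs : UniqueDiffOn ℝ s)
    {x y : E d} (hxy : segment ℝ x y ⊆ s) {k : ℕ} (hk : k ≤ κ) {R : ℝ}
    (hR : ∀ z ∈ segment ℝ x y, ‖iteratedFDerivWithin ℝ (k + 1) F s z‖ ≤ R) :
    ‖iteratedFDerivWithin ℝ k F s y - iteratedFDerivWithin ℝ k F s x‖ ≤ R * ‖y - x‖ := by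
  have hdiff := hF.differentiableOn_iteratedFDerivWithin (m := k)
    (by exact_mod_cast Nat.lt_succ_of_le hk) hs
  refine Convex.norm_image_sub_le_of_norm_hasFDerivWithin_le
    (f' := fun z => fderivWithin ℝ (iteratedFDerivWithin ℝ k F s) s z)
    (s := segment ℝ x y) (fun z hz => ?_) (fun z hz => ?_) (convex_segment x y)
    (left_mem_segment ℝ x y) (right_mem_segment ℝ x y)
  · exact ((hdiff z (hxy hz)).hasFDerivWithinAt).mono hxy
  · rw [norm_fderivWithin_iteratedFDerivWithin]
    exact hR z hz

/-- Along a segment shorter than `1 / μ` the bounds `‖D^k F‖ ≲ μ^{k+2}` propagate. -/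
lemma norm_iteratedFDerivWithin_le_of_segment (hF : ContDiffOn ℝ (κ + 1 : ℕ) F s)
    (hs : UniqueDiffOn ℝ s) {x y : E d} (hxy : segment ℝ x y ⊆ s) {μ : ℝ} (hμ : 0 ≤ μ)
    (hlen : ‖y - x‖ * μ ≤ 1)
    (hx : ∀ k ≤ κ, ‖iteratedFDerivWithin ℝ k F s x‖ ≤ μ ^ (k + 2))
    (htop : ∀ z ∈ s, ‖iteratedFDerivWithin ℝ (κ + 1) F s z‖ ≤ μ ^ (κ + 3)) {k : ℕ}
    (hk : k ≤ κ + 1) {z : E d} (hz : z ∈ segment ℝ x y) :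
    ‖iteratedFDerivWithin ℝ k F s z‖ ≤ (κ + 2) * μ ^ (k + 2) := by
  -- Induction downwards from the top order, j counting the orders already descended. Integrating
  -- the bound of order m+1 along a segment of length at most 1/μ adds (j+1)μ^{m+2} to the bound at
  -- x, so the constant grows by one per order.
  have key : ∀ j : ℕ, j ≤ κ + 1 → ∀ z ∈ segment ℝ x y,
      ‖iteratedFDerivWithin ℝ (κ + 1 - j) F s z‖ ≤ (j + 1) * μ ^ (κ + 1 - j + 2) := by
    intro j
    induction j with
    | zero => intro _ z hz; simpa using htop z (hxy hz)
    | succ j ih =>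
      intro hj z hz
      obtain ⟨m, hm⟩ : ∃ m, κ + 1 - (j + 1) = m := ⟨_, rfl⟩
      have hm' : κ + 1 - j = m + 1 := by omega
      have ih' := ih (by omega)
      rw [hm'] at ih'
      rw [hm]
      have hsub : segment ℝ x z ⊆ segment ℝ x y :=
        (convex_segment x y).segment_subset (left_mem_segment ℝ x y) hz
      have h1 := norm_iteratedFDerivWithin_sub_le hF hs (hsub.trans hxy) (k := m) (by omega)
        (fun w hw => ih' w (hsub hw))
      have h2 : ‖z - x‖ ≤ ‖y - x‖ := by
        rw [segment_eq_image'] at hz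
        obtain ⟨a, ⟨ha0, ha1⟩, rfl⟩ := hz
        rw [add_sub_cancel_left, norm_smul, Real.norm_of_nonneg ha0]
        exact mul_le_of_le_one_left (norm_nonneg _) ha1
      have h3 := hx m (by omega)
      calc ‖iteratedFDerivWithin ℝ m F s z‖
          ≤ ‖iteratedFDerivWithin ℝ m F s x‖ +
            ‖iteratedFDerivWithin ℝ m F s z - iteratedFDerivWithin ℝ m F s x‖ := by
            rw [add_comm, ← sub_le_iff_le_add]; exact norm_sub_norm_le _ _
        _ ≤ μ ^ (m + 2) + (j + 1) * μ ^ (m + 1 + 2) * ‖y - x‖ := by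
            refine add_le_add h3 (h1.trans ?_)
            gcongr
        _ = μ ^ (m + 2) + (j + 1) * μ ^ (m + 2) * (‖y - x‖ * μ) := by ring
        _ ≤ μ ^ (m + 2) + (j + 1) * μ ^ (m + 2) * 1 := by gcongr
        _ = ((j + 1 : ℕ) + 1) * μ ^ (m + 2) := by push_cast; ring
  have := key (κ + 1 - k) (by omega) z hz
  rw [show κ + 1 - (κ + 1 - k) = k by omega] at this
  refine this.trans ?_
  refine mul_le_mul_of_nonneg_right ?_ (by positivity)
  rw [Nat.cast_sub hk]
  push_cast
  have : (0 : ℝ) ≤ k := by positivity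
  linarith

/-- The standing assumptions on a field: its derivatives of order `κ + 1` are dominated by its
scale. -/
structure IsScaled (κ : ℕ) (s : Set (E d)) (F : E d → V) : Prop where
  contDiffOn : ContDiffOn ℝ (κ + 1 : ℕ) F s
  uniqueDiffOn : UniqueDiffOn ℝ s
  scale_pos : ∀ x ∈ s, 0 < derivScale κ s F x
  top_le : ∀ x ∈ s, ∀ z ∈ s,
    ‖iteratedFDerivWithin ℝ (κ + 1) F s z‖ ≤ derivScale κ s F x ^ (κ + 3)

lemma IsScaled.norm_iteratedFDerivWithin_le (h : IsScaled κ s F) {x y : E d}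
    (hxy : segment ℝ x y ⊆ s) (hlen : ‖y - x‖ * derivScale κ s F x ≤ 1) {k : ℕ} (hk : k ≤ κ + 1)
    {z : E d} (hz : z ∈ segment ℝ x y) :
    ‖iteratedFDerivWithin ℝ k F s z‖ ≤ (κ + 2) * derivScale κ s F x ^ (k + 2) :=
  norm_iteratedFDerivWithin_le_of_segment h.contDiffOn h.uniqueDiffOn hxy (derivScale_nonneg x) hlen
    (fun _ hk => norm_iteratedFDerivWithin_le_derivScale_pow hk x)
    (h.top_le x (hxy (left_mem_segment ℝ x y))) hk hz

/-- The scale varies slowly along segments. -/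
lemma IsScaled.derivScale_le_of_segment (h : IsScaled κ s F) {x y : E d}
    (hxy : segment ℝ x y ⊆ s) (hlen : ‖y - x‖ * derivScale κ s F x ≤ 1) :
    derivScale κ s F y ≤ (κ + 1) * (κ + 2) * derivScale κ s F x :=
  derivScale_le (derivScale_nonneg x) (by linarith [show (0 : ℝ) ≤ κ by positivity])
    fun _ hk => h.norm_iteratedFDerivWithin_le hxy hlen (by omega) (right_mem_segment ℝ x y)

/-- If a derivative of order `k + 1` is large at `x`, one of order `k` is large near `x`. -/
lemma exists_norm_iteratedFDerivWithin_ge (hF : ContDiffOn ℝ (κ + 1 : ℕ) F s)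
    (hs : UniqueDiffOn ℝ s) {k : ℕ} (hk : k + 1 ≤ κ) {x : E d} {μ R c C : ℝ} (hμ : 0 < μ)
    (hR : 0 < R) (hc : 0 < c) (hC : 0 < C) (hball : Metric.ball x (R / μ) ⊆ s)
    (hbd : ∀ z ∈ Metric.ball x (R / μ), ‖iteratedFDerivWithin ℝ (k + 2) F s z‖ ≤ C * μ ^ (k + 4))
    (hx : c * μ ^ (k + 3) ≤ ‖iteratedFDerivWithin ℝ (k + 1) F s x‖) :
    ∃ y ∈ Metric.ball x (R / 2 / μ),
      min (R / 2) (c / (4 * C)) * c / 8 * μ ^ (k + 2) ≤ ‖iteratedFDerivWithin ℝ k F s y‖ := by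
  -- A step of length at most τ/μ stays in the half ball, and its Taylor remainder, of size Cτ² ≤
  -- cτ/4, is at most half of the linear term, of size cτ/2 (in units of μ^{k+2}).
  set τ := min (R / 2) (c / (4 * C)) with hτ
  have hτ0 : 0 < τ := by positivity
  set g := iteratedFDerivWithin ℝ k F s with hg
  set L := fderivWithin ℝ g s x with hL
  have hLn : ‖L‖ = ‖iteratedFDerivWithin ℝ (k + 1) F s x‖ := norm_fderivWithin_iteratedFDerivWithin
  have hxs : x ∈ s := hball (Metric.mem_ball_self (by positivity))
  have hLpos : 0 < ‖L‖ := by rw [hLn]; exact lt_of_lt_of_le (by positivity) hx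
  -- A direction that realises at least half of the operator norm.
  obtain ⟨v, hv1, hv⟩ := L.exists_lt_apply_of_lt_opNorm (half_lt_self hLpos)
  set y := x + (τ / μ) • v with hy
  have hyx : ‖y - x‖ ≤ τ / μ := by
    rw [hy, add_sub_cancel_left, norm_smul, Real.norm_of_nonneg (by positivity)]
    exact mul_le_of_le_one_right (by positivity) hv1.le
  have hyx' : ‖y - x‖ < R / 2 / μ := by
    rw [hy, add_sub_cancel_left, norm_smul, Real.norm_of_nonneg (by positivity)]
    calc τ / μ * ‖v‖ < τ / μ * 1 := by gcongr
      _ ≤ R / 2 / μ := by rw [mul_one]; gcongr; exact min_le_left _ _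
  have hyb : y ∈ Metric.ball x (R / 2 / μ) := by rwa [Metric.mem_ball, dist_eq_norm]
  have hseg : segment ℝ x y ⊆ Metric.ball x (R / μ) :=
    (convex_ball _ _).segment_subset (Metric.mem_ball_self (by positivity))
      (Metric.ball_subset_ball (by gcongr; linarith) hyb)
  have hdiff := hF.differentiableOn_iteratedFDerivWithin (m := k)
    (by exact_mod_cast (by omega : k < κ + 1)) hs
  have hsegle : ∀ z ∈ segment ℝ x y, ‖z - x‖ ≤ ‖y - x‖ := by
    intro z hz
    rw [segment_eq_image'] at hz
    obtain ⟨a, ⟨ha0, ha1⟩, rfl⟩ := hz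
    rw [add_sub_cancel_left, norm_smul, Real.norm_of_nonneg ha0]
    exact mul_le_of_le_one_left (norm_nonneg _) ha1
  have htaylor : ‖g y - g x - L (y - x)‖ ≤ C * μ ^ (k + 4) * (τ / μ) * ‖y - x‖ := by
    refine Convex.norm_image_sub_le_of_norm_hasFDerivWithin_le'
      (f' := fun z => fderivWithin ℝ g s z) (s := segment ℝ x y) (fun z hz => ?_) (fun z hz => ?_)
      (convex_segment x y) (left_mem_segment ℝ x y) (right_mem_segment ℝ x y)
    · exact ((hdiff z (hball (hseg hz))).hasFDerivWithinAt).mono (hseg.trans hball)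
    · have e1 : ‖fderivWithin ℝ g s z - L‖ =
          ‖iteratedFDerivWithin ℝ (k + 1) F s z - iteratedFDerivWithin ℝ (k + 1) F s x‖ := by
        rw [hL, hg, fderivWithin_iteratedFDerivWithin]
        simp only [Function.comp_apply]
        exact ((dist_eq_norm _ _).symm.trans (LinearIsometryEquiv.dist_map
          (continuousMultilinearCurryLeftEquiv ℝ (fun _ : Fin (k + 1) => E d) V) _ _)).trans
          (dist_eq_norm _ _)
      rw [e1]
      have hsub : segment ℝ x z ⊆ segment ℝ x y :=
        (convex_segment x y).segment_subset (left_mem_segment ℝ x y) hz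
      refine (norm_iteratedFDerivWithin_sub_le hF hs (hsub.trans (hseg.trans hball))
        (k := k + 1) hk (R := C * μ ^ (k + 4)) fun w hw => hbd w (hseg (hsub hw))).trans ?_
      gcongr
      exact (hsegle z hz).trans hyx
  have hLy : L (y - x) = (τ / μ) • L v := by rw [hy, add_sub_cancel_left, map_smul]
  have hLyn : τ / μ * (c * μ ^ (k + 3) / 2) ≤ ‖L (y - x)‖ := by
    rw [hLy, norm_smul, Real.norm_of_nonneg (by positivity)]
    gcongr
    rw [hLn] at hv
    linarith
  have hsum : ‖L (y - x)‖ ≤ ‖g y‖ + ‖g x‖ + ‖g y - g x - L (y - x)‖ := by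
    calc ‖L (y - x)‖ = ‖(g y - g x) - (g y - g x - L (y - x))‖ := by congr 1; abel
      _ ≤ ‖g y - g x‖ + ‖g y - g x - L (y - x)‖ := norm_sub_le _ _
      _ ≤ _ := by gcongr; exact norm_sub_le _ _
  have hCτ : C * τ ≤ c / 4 := by
    have : τ ≤ c / (4 * C) := min_le_right _ _
    calc C * τ ≤ C * (c / (4 * C)) := by gcongr
      _ = c / 4 := by field_simp
  have hrem : C * μ ^ (k + 4) * (τ / μ) * ‖y - x‖ ≤ τ * (c / 4) * μ ^ (k + 2) := by
    calc C * μ ^ (k + 4) * (τ / μ) * ‖y - x‖ ≤ C * μ ^ (k + 4) * (τ / μ) * (τ / μ) := by gcongr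
      _ = τ * (C * τ) * μ ^ (k + 2) := by field_simp; ring
      _ ≤ _ := by gcongr
  have hmain : τ * (c / 4) * μ ^ (k + 2) ≤ ‖g y‖ + ‖g x‖ := by
    have : τ / μ * (c * μ ^ (k + 3) / 2) = τ * (c / 2) * μ ^ (k + 2) := by
      field_simp; ring
    nlinarith
  -- The difference g y - g x is large, so one of the two endpoints carries half of it.
  by_cases hcase : τ * c / 8 * μ ^ (k + 2) ≤ ‖g y‖
  · exact ⟨y, hyb, hcase⟩
  · refine ⟨x, Metric.mem_ball_self (by positivity), ?_⟩
    push Not at hcase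
    nlinarith

/-- If some derivative of order at most `κ` is large at `x`, the field is large somewhere nearby. -/
lemma exists_norm_ge_of_iteratedFDerivWithin (C : ℝ) (hC : 0 < C) (k : ℕ) :
    ∀ R c : ℝ, 0 < R → 0 < c → ∃ c' > 0, ∀ {d : ℕ} {V : Type} [NormedAddCommGroup V]
      [NormedSpace ℝ V] {κ : ℕ} {s : Set (E d)} {F : E d → V} {x : E d} {μ : ℝ},
      k ≤ κ → ContDiffOn ℝ (κ + 1 : ℕ) F s → UniqueDiffOn ℝ s → 0 < μ →
      Metric.ball x (R / μ) ⊆ s →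
      (∀ j ≤ κ + 1, ∀ z ∈ Metric.ball x (R / μ),
        ‖iteratedFDerivWithin ℝ j F s z‖ ≤ C * μ ^ (j + 2)) →
      c * μ ^ (k + 2) ≤ ‖iteratedFDerivWithin ℝ k F s x‖ →
      ∃ y ∈ Metric.ball x (R / μ), c' * μ ^ 2 ≤ ‖F y‖ := by
  induction k with
  | zero =>
    intro R c hR hc
    refine ⟨c, hc, fun {d V _ _ κ s F x μ} _ _ _ hμ _ _ hx => ⟨x, ?_, by simpa using hx⟩⟩
    exact Metric.mem_ball_self (by positivity)
  | succ k ih =>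
    intro R c hR hc
    -- Half of the radius is spent on finding a point where the derivative of order k is large; the
    -- other half is left for the induction hypothesis around that point.
    obtain ⟨c', hc', H⟩ := ih (R / 2) (min (R / 2) (c / (4 * C)) * c / 8) (by positivity)
      (by positivity)
    refine ⟨c', hc', fun {d V _ _ κ s F x μ} hk hF hs hμ hball hbd hx => ?_⟩
    obtain ⟨y, hy, hyc⟩ := exists_norm_iteratedFDerivWithin_ge hF hs hk hμ hR hc hC hball
      (fun z hz => hbd (k + 2) (by omega) z hz) hx
    have hsub : Metric.ball y (R / 2 / μ) ⊆ Metric.ball x (R / μ) := by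
      refine Metric.ball_subset_ball' ?_
      rw [Metric.mem_ball] at hy
      have : R / 2 / μ + R / 2 / μ = R / μ := by ring
      linarith
    obtain ⟨z, hz, hzc⟩ := H (by omega) hF hs hμ (hsub.trans hball)
      (fun j hj w hw => hbd j hj w (hsub hw)) hyc
    exact ⟨z, hsub hz, hzc⟩

/-- The order of the derivative that is large depends on the point, so a constant valid for all
orders up to K is needed: the minimum of finitely many. -/
lemma exists_norm_ge_of_exists_iteratedFDerivWithin (C : ℝ) (hC : 0 < C) (K : ℕ) {R c : ℝ}
    (hR : 0 < R) (hc : 0 < c) : ∃ c' > 0, ∀ k ≤ K, ∀ {d : ℕ} {V : Type} [NormedAddCommGroup V]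
      [NormedSpace ℝ V] {κ : ℕ} {s : Set (E d)} {F : E d → V} {x : E d} {μ : ℝ},
      k ≤ κ → ContDiffOn ℝ (κ + 1 : ℕ) F s → UniqueDiffOn ℝ s → 0 < μ →
      Metric.ball x (R / μ) ⊆ s →
      (∀ j ≤ κ + 1, ∀ z ∈ Metric.ball x (R / μ),
        ‖iteratedFDerivWithin ℝ j F s z‖ ≤ C * μ ^ (j + 2)) →
      c * μ ^ (k + 2) ≤ ‖iteratedFDerivWithin ℝ k F s x‖ →
      ∃ y ∈ Metric.ball x (R / μ), c' * μ ^ 2 ≤ ‖F y‖ := by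
  induction K with
  | zero =>
    obtain ⟨c', hc', H⟩ := exists_norm_ge_of_iteratedFDerivWithin C hC 0 R c hR hc
    refine ⟨c', hc', fun k hk => ?_⟩
    obtain rfl : k = 0 := by omega
    exact H
  | succ K ih =>
    obtain ⟨c₁, hc₁, H₁⟩ := ih
    obtain ⟨c₂, hc₂, H₂⟩ := exists_norm_ge_of_iteratedFDerivWithin C hC (K + 1) R c hR hc
    refine ⟨min c₁ c₂, by positivity, fun k hk {d V _ _ κ s F x μ} hkκ hF hs hμ hb hbd hx => ?_⟩
    rcases Nat.lt_or_ge K k with hlt | hge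
    · obtain rfl : k = K + 1 := by omega
      obtain ⟨y, hy, hyc⟩ := H₂ hkκ hF hs hμ hb hbd hx
      exact ⟨y, hy, le_trans (by gcongr; exact min_le_right _ _) hyc⟩
    · obtain ⟨y, hy, hyc⟩ := H₁ k hge hkκ hF hs hμ hb hbd hx
      exact ⟨y, hy, le_trans (by gcongr; exact min_le_left _ _) hyc⟩

end

section

variable {d : ℕ}

/-! ### Scale functions on a domain -/

/-- A positive continuous function `n` on `closure Ω` that is comparable to itself at points whose
distance is at most `c / n`. -/
structure IsSlowScale (Ω : Set (E d)) (n : E d → ℝ) (c C : ℝ) : Prop where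
  continuousOn : ContinuousOn n (closure Ω)
  pos : ∀ x ∈ closure Ω, 0 < n x
  radius_pos : 0 < c
  one_le : 1 ≤ C
  le_mul : ∀ x ∈ closure Ω, ∀ y ∈ closure Ω, dist x y * n x ≤ c → n y ≤ C * n x
  le_mul' : ∀ x ∈ closure Ω, ∀ y ∈ closure Ω, dist x y * n x ≤ c → n x ≤ C * n y

/-- Each segment can multiply the scale by at most C = (κ+1)(κ+2), provided it is shorter than the
inverse scale at its starting point. By the third segment the scale may have grown by C², hence the
factor C² in the smallness assumption. -/
lemma IsScaled.slow_path {V : Type*} [NormedAddCommGroup V] [NormedSpace ℝ V] {κ : ℕ}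
    {s : Set (E d)} {F : E d → V} (h : IsScaled κ s F) {x x' y' y : E d} {D K : ℝ}
    (hK : 1 ≤ K) (hD : 0 ≤ D)
    (h1 : segment ℝ x x' ⊆ s) (h2 : segment ℝ x' y' ⊆ s) (h3 : segment ℝ y' y ⊆ s)
    (d1 : dist x x' ≤ K * D) (d2 : dist x' y' ≤ D) (d3 : dist y' y ≤ K * D)
    (hsmall : K * D * derivScale κ s F x * ((κ + 1 : ℝ) * (κ + 2)) ^ 2 ≤ 1) :
    derivScale κ s F x' ≤ ((κ + 1 : ℝ) * (κ + 2)) * derivScale κ s F x ∧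
    derivScale κ s F y' ≤ ((κ + 1 : ℝ) * (κ + 2)) ^ 2 * derivScale κ s F x ∧
    derivScale κ s F y ≤ ((κ + 1 : ℝ) * (κ + 2)) ^ 3 * derivScale κ s F x := by
  set C : ℝ := (κ + 1 : ℝ) * (κ + 2) with hC
  have hκ : (0 : ℝ) ≤ κ := by positivity
  have hC1 : 1 ≤ C := by rw [hC]; nlinarith
  have hn := derivScale_nonneg (κ := κ) (s := s) (F := F) x
  have hn' := derivScale_nonneg (κ := κ) (s := s) (F := F) x'
  have hny := derivScale_nonneg (κ := κ) (s := s) (F := F) y'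
  have e0 : K * D * derivScale κ s F x ≤ K * D * derivScale κ s F x * C ^ 2 :=
    le_mul_of_one_le_right (by positivity) (one_le_pow₀ hC1)
  have a1 : derivScale κ s F x' ≤ C * derivScale κ s F x := by
    refine h.derivScale_le_of_segment h1 ?_
    rw [← dist_eq_norm, dist_comm]
    calc dist x x' * derivScale κ s F x ≤ K * D * derivScale κ s F x := by gcongr
      _ ≤ 1 := e0.trans hsmall
  have a2 : derivScale κ s F y' ≤ C ^ 2 * derivScale κ s F x := by
    refine (h.derivScale_le_of_segment h2 ?_).trans ?_
    · rw [← dist_eq_norm, dist_comm]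
      calc dist x' y' * derivScale κ s F x' ≤ D * (C * derivScale κ s F x) := by gcongr
        _ = 1 * D * derivScale κ s F x * C := by ring
        _ ≤ K * D * derivScale κ s F x * C ^ 2 := by
          gcongr
          exact le_self_pow₀ hC1 (by norm_num)
        _ ≤ 1 := hsmall
    · calc C * derivScale κ s F x' ≤ C * (C * derivScale κ s F x) := by gcongr
        _ = _ := by ring
  have a3 : derivScale κ s F y ≤ C ^ 3 * derivScale κ s F x := by
    refine (h.derivScale_le_of_segment h3 ?_).trans ?_
    · rw [← dist_eq_norm, dist_comm]
      calc dist y' y * derivScale κ s F y' ≤ (K * D) * (C ^ 2 * derivScale κ s F x) := by gcongr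
        _ = K * D * derivScale κ s F x * C ^ 2 := by ring
        _ ≤ 1 := hsmall
    · calc C * derivScale κ s F y' ≤ C * (C ^ 2 * derivScale κ s F x) := by gcongr
        _ = _ := by ring
  exact ⟨a1, a2, a3⟩

/-- The comparison along a segment becomes a comparison of nearby points through the three-segment
paths. The assumption 1 ≤ δn keeps the inverse scale below the height of the cones, so that such
paths exist. -/
theorem exists_isSlowScale {Ω : Set (E d)} {δ θ : ℝ} (hU : UniformConeOn Ω (closure Ω) δ θ)
    (κ : ℕ) : ∃ c C : ℝ, 0 < c ∧ 1 ≤ C ∧ ∀ {V : Type} [NormedAddCommGroup V] [NormedSpace ℝ V]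
      {F : E d → V}, IsScaled κ (closure Ω) F → (∀ x ∈ closure Ω, 1 ≤ δ * derivScale κ (closure Ω) F x) →
      IsSlowScale Ω (derivScale κ (closure Ω) F) c C := by
  set C : ℝ := (κ + 1 : ℝ) * (κ + 2) with hC
  have hκ : (0 : ℝ) ≤ κ := by positivity
  have hC1 : 1 ≤ C := by rw [hC]; nlinarith
  have hθ := hU.aperture_pos
  have hθ1 := hU.aperture_le
  have hδ := hU.pos
  -- The reverse inequality comes from running the path backwards from y, whose scale may be C³
  -- times that of x; this and the C² required by `IsScaled.slow_path` give the power C⁵.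
  refine ⟨θ / (2 * C ^ 5), C ^ 3, by positivity, one_le_pow₀ hC1, fun {V _ _ F} h hδn => ?_⟩
  have key : ∀ x ∈ closure Ω, ∀ y ∈ closure Ω,
      dist x y * derivScale κ (closure Ω) F x ≤ θ / (2 * C ^ 5) →
      derivScale κ (closure Ω) F y ≤ C ^ 3 * derivScale κ (closure Ω) F x ∧
      derivScale κ (closure Ω) F x ≤ C ^ 3 * derivScale κ (closure Ω) F y := by
    intro x hx y hy hxy
    have hn := derivScale_nonneg (κ := κ) (s := closure Ω) (F := F) x
    have hn' := derivScale_nonneg (κ := κ) (s := closure Ω) (F := F) y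
    have hsm : 2 / θ * dist x y * derivScale κ (closure Ω) F x * C ^ 5 ≤ 1 := by
      calc 2 / θ * dist x y * derivScale κ (closure Ω) F x * C ^ 5
          = 2 / θ * C ^ 5 * (dist x y * derivScale κ (closure Ω) F x) := by ring
        _ ≤ 2 / θ * C ^ 5 * (θ / (2 * C ^ 5)) := by gcongr
        _ = 1 := by field_simp
    have hK : 1 ≤ 2 / θ := by rw [le_div_iff₀ hθ]; linarith
    have hclose : 2 * dist x y ≤ θ * δ := by
      have h1 : dist x y ≤ dist x y * (δ * derivScale κ (closure Ω) F x) :=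
        le_mul_of_one_le_right dist_nonneg (hδn x hx)
      have h2 : θ / (2 * C ^ 5) ≤ θ / 2 := by
        gcongr
        exact le_mul_of_one_le_right (by norm_num) (one_le_pow₀ hC1)
      nlinarith
    obtain ⟨x', y', s1, s2, s3, d1, d2, d3⟩ := hU.exists_path hx hy hclose
    have hsm2 : 2 / θ * dist x y * derivScale κ (closure Ω) F x * C ^ 2 ≤ 1 := by
      refine le_trans ?_ hsm
      gcongr
      norm_num
    obtain ⟨-, -, a⟩ := h.slow_path hK dist_nonneg s1 s2 s3 d1.le d2.le d3.le hsm2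
    refine ⟨a, ?_⟩
    rw [segment_symm] at s1 s2 s3
    rw [dist_comm] at d1 d2 d3
    refine (h.slow_path hK dist_nonneg s3 s2 s1 d3.le d2.le d1.le ?_).2.2
    calc 2 / θ * dist x y * derivScale κ (closure Ω) F y * C ^ 2
        ≤ 2 / θ * dist x y * (C ^ 3 * derivScale κ (closure Ω) F x) * C ^ 2 := by gcongr
      _ = 2 / θ * dist x y * derivScale κ (closure Ω) F x * C ^ 5 := by ring
      _ ≤ 1 := hsm
  exact ⟨continuousOn_derivScale h.contDiffOn h.uniqueDiffOn, h.scale_pos, by positivity,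
    one_le_pow₀ hC1, fun x hx y hy hxy => (key x hx y hy hxy).1,
    fun x hx y hy hxy => (key x hx y hy hxy).2⟩

lemma exists_coord_ge {ι : Type*} [Fintype ι] [Nonempty ι] (v : EuclideanSpace ℝ ι) :
    ∃ i, ‖v‖ / Fintype.card ι ≤ |v i| := by
  have h : ‖v‖ ≤ ∑ i, |v i| := by
    rw [EuclideanSpace.norm_eq]
    refine Real.sqrt_le_iff.2 ⟨Finset.sum_nonneg fun _ _ => abs_nonneg _, ?_⟩
    simp only [Real.norm_eq_abs]
    exact Finset.sum_sq_le_sq_sum_of_nonneg fun _ _ => abs_nonneg _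
  obtain ⟨i, -, hi⟩ := Finset.exists_le_of_sum_le (s := Finset.univ) Finset.univ_nonempty
    (f := fun _ : ι => ‖v‖ / Fintype.card ι) (g := fun i => |v i|)
    (by rw [Finset.sum_const, Finset.card_univ, nsmul_eq_mul,
          mul_div_cancel₀ _ (by positivity)]; exact h)
  exact ⟨i, hi⟩

lemma segment_subset_of_cone {Ω : Set (E d)} {δ θ : ℝ} {x ν z : E d} (hx : x ∈ closure Ω)
    (H : ∀ t, 0 < t → t ≤ δ → Metric.ball (x + t • ν) (θ * t) ⊆ Ω) {t : ℝ} (ht : 0 < t)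
    (htδ : t ≤ δ) (hz : z ∈ Metric.ball (x + t • ν) (θ * t)) : segment ℝ x z ⊆ closure Ω := by
  rw [segment_eq_image']
  rintro _ ⟨a, ⟨ha0, ha1⟩, rfl⟩
  rcases ha0.eq_or_lt with rfl | ha
  · simpa using hx
  · refine subset_closure (H (a * t) (by positivity) (by nlinarith) ?_)
    rw [Metric.mem_ball, dist_eq_norm] at hz ⊢
    have e1 : x + a • (z - x) - (x + (a * t) • ν) = a • (z - (x + t • ν)) := by module
    rw [e1, norm_smul, Real.norm_of_nonneg ha0]
    calc a * ‖z - (x + t • ν)‖ < a * (θ * t) := by gcongr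
      _ = θ * (a * t) := by ring

/-- Near every point of `closure Ω` there is a ball in `Ω`, of size comparable to the inverse of the
scale, on which one component of the field is as large as the square of the scale. -/
theorem exists_ball_field_large {Ω : Set (E d)} {δ θ : ℝ} (hU : UniformConeOn Ω (closure Ω) δ θ)
    {ι : Type} [Fintype ι] [Nonempty ι] (κ : ℕ) {ρ₀ : ℝ} (hρ₀ : 0 < ρ₀) :
    ∃ τ ρ η : ℝ, 0 < τ ∧ τ ≤ ρ₀ ∧ τ ≤ 1 / 4 ∧ 0 < ρ ∧ ρ ≤ θ * τ / 2 ∧ 0 < η ∧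
      ∀ F : E d → EuclideanSpace ℝ ι, IsScaled κ (closure Ω) F →
      ∀ x₀ ∈ closure Ω, 1 ≤ δ * derivScale κ (closure Ω) F x₀ →
      ∃ ν y : E d, ∃ p : ι, ‖ν‖ = 1 ∧
        (∀ x ∈ closure Ω, dist x x₀ < δ →
          ∀ t, 0 < t → t ≤ δ → Metric.ball (x + t • ν) (θ * t) ⊆ Ω) ∧
        y ∈ Metric.ball (x₀ + (τ / derivScale κ (closure Ω) F x₀) • ν)
          (θ * τ / 2 / derivScale κ (closure Ω) F x₀) ∧
        ((∀ z ∈ Metric.ball y (ρ / derivScale κ (closure Ω) F x₀),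
            η * derivScale κ (closure Ω) F x₀ ^ 2 ≤ F z p) ∨
          (∀ z ∈ Metric.ball y (ρ / derivScale κ (closure Ω) F x₀),
            F z p ≤ -(η * derivScale κ (closure Ω) F x₀ ^ 2))) ∧
        ∀ z ∈ Metric.ball y (ρ / derivScale κ (closure Ω) F x₀),
          |F z p| ≤ (κ + 2) * derivScale κ (closure Ω) F x₀ ^ 2 := by
  have hθ := hU.aperture_pos
  have hθ1 := hU.aperture_le
  have hδ := hU.pos
  have hκ : (0 : ℝ) ≤ κ := by positivity
  -- By pigeonhole, some derivative of order k ≤ κ is at least c μ^{k+2} at x₀, with this c for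
  -- every such k.
  set c : ℝ := ((κ + 1 : ℝ)⁻¹) ^ (κ + 2) with hc
  have hc0 : 0 < c := by positivity
  -- As x₀ may lie on the boundary, one moves to x₁ at height τ/μ in its cone, around which there is
  -- a ball in Ω. The move changes the large derivative by at most τ(κ+2)μ^{k+2} ≤ (c/2)μ^{k+2}, so
  -- half of it survives at x₁.
  set τ : ℝ := min (min ρ₀ (1 / 4)) (c / (2 * (κ + 2))) with hτ
  have hτ0 : 0 < τ := by positivity
  have hτ1 : τ ≤ 1 / 4 := (min_le_left _ _).trans (min_le_right _ _)
  have hτ2 : τ * (κ + 2) ≤ c / 2 := by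
    have : τ ≤ c / (2 * (κ + 2)) := min_le_right _ _
    calc τ * (κ + 2) ≤ c / (2 * (κ + 2)) * (κ + 2) := by gcongr
      _ = c / 2 := by field_simp
  obtain ⟨c', hc', H⟩ := exists_norm_ge_of_exists_iteratedFDerivWithin (κ + 2 : ℝ) (by positivity) κ
    (R := θ * τ / 2) (c := c / 2) (by positivity) (by positivity)
  -- Some component of F y has absolute value at least ‖F y‖ / card ι ≥ 2ημ²; half of this is given
  -- up to the oscillation on the ball of radius ρ/μ.
  set η : ℝ := c' / (2 * Fintype.card ι) with hη
  have hη0 : 0 < η := by positivity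
  -- With the gradient at most (κ+2)μ³, the oscillation over distance ρ/μ is at most ημ², so the
  -- component also keeps its sign.
  set ρ : ℝ := min (θ * τ / 2) (η / (κ + 2)) with hρ
  refine ⟨τ, ρ, η, hτ0, (min_le_left _ _).trans (min_le_left _ _), hτ1, by positivity,
    min_le_left _ _, hη0, fun F hF x₀ hx₀ hδn => ?_⟩
  set μ := derivScale κ (closure Ω) F x₀ with hμ
  have hμ0 : 0 < μ := hF.scale_pos x₀ hx₀
  obtain ⟨ν, hν, hcone⟩ := hU.cone x₀ hx₀
  have hcone₀ := hcone x₀ hx₀ (by simpa using hδ)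
  have htδ : τ / μ ≤ δ := by
    rw [div_le_iff₀ hμ0]; linarith
  have ht0 : 0 < τ / μ := by positivity
  set x₁ := x₀ + (τ / μ) • ν with hx₁
  have hbd : ∀ z ∈ Metric.ball x₁ (θ * (τ / μ)), ∀ w ∈ segment ℝ x₀ z, ∀ j ≤ κ + 1,
      ‖iteratedFDerivWithin ℝ j F (closure Ω) w‖ ≤ (κ + 2) * μ ^ (j + 2) := by
    intro z hz w hw j hj
    refine hF.norm_iteratedFDerivWithin_le (segment_subset_of_cone hx₀ hcone₀ ht0 htδ hz) ?_ hj hw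
    have h1 : ‖z - x₀‖ ≤ 2 * (τ / μ) := by
      rw [Metric.mem_ball, dist_eq_norm] at hz
      calc ‖z - x₀‖ = ‖(z - x₁) + (τ / μ) • ν‖ := by rw [hx₁]; congr 1; abel
        _ ≤ ‖z - x₁‖ + ‖(τ / μ) • ν‖ := norm_add_le _ _
        _ ≤ 1 * (τ / μ) + τ / μ := by
          rw [norm_smul, hν, mul_one, Real.norm_of_nonneg ht0.le]
          gcongr
          exact hz.le.trans (by gcongr)
        _ = _ := by ring
    calc ‖z - x₀‖ * μ ≤ 2 * (τ / μ) * μ := by gcongr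
      _ = 2 * τ := by field_simp
      _ ≤ 1 := by linarith
  have hx₁b : x₁ ∈ Metric.ball x₁ (θ * (τ / μ)) := Metric.mem_ball_self (by positivity)
  have hballΩ : Metric.ball x₁ (θ * (τ / μ)) ⊆ closure Ω :=
    (hcone₀ _ ht0 htδ).trans subset_closure
  have hhalf : Metric.ball x₁ (θ * τ / 2 / μ) ⊆ Metric.ball x₁ (θ * (τ / μ)) := by
    refine Metric.ball_subset_ball ?_
    rw [← mul_div_assoc]
    gcongr
    have : 0 < θ * τ := by positivity
    linarith
  obtain ⟨k, hk, hkx⟩ := exists_derivScale_pow_le (κ := κ) (s := closure Ω) (F := F) x₀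
  have hkx₁ : c / 2 * μ ^ (k + 2) ≤ ‖iteratedFDerivWithin ℝ k F (closure Ω) x₁‖ := by
    have h1 : c * μ ^ (k + 2) ≤ ‖iteratedFDerivWithin ℝ k F (closure Ω) x₀‖ := by
      refine le_trans ?_ hkx
      rw [← hμ, div_eq_mul_inv, mul_pow, mul_comm]
      gcongr
      exact pow_le_pow_of_le_one (by positivity) (inv_le_one_of_one_le₀ (by linarith)) (by omega)
    have h2 := norm_iteratedFDerivWithin_sub_le hF.contDiffOn hF.uniqueDiffOn
      (segment_subset_of_cone hx₀ hcone₀ ht0 htδ hx₁b) hk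
      (fun w hw => hbd x₁ hx₁b w hw (k + 1) (by omega))
    have h3 : ‖x₁ - x₀‖ = τ / μ := by
      rw [hx₁, add_sub_cancel_left, norm_smul, hν, mul_one, Real.norm_of_nonneg ht0.le]
    rw [h3] at h2
    have h4 : (κ + 2) * μ ^ (k + 1 + 2) * (τ / μ) = τ * (κ + 2) * μ ^ (k + 2) := by
      field_simp; ring
    have h5 : τ * (κ + 2) * μ ^ (k + 2) ≤ c / 2 * μ ^ (k + 2) := by gcongr
    have h6 := norm_sub_norm_le (iteratedFDerivWithin ℝ k F (closure Ω) x₀)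
      (iteratedFDerivWithin ℝ k F (closure Ω) x₁)
    rw [norm_sub_rev] at h6
    linarith
  obtain ⟨y, hy, hyc⟩ := H k hk hk hF.contDiffOn hF.uniqueDiffOn hμ0 (hhalf.trans hballΩ)
    (fun j hj z hz => hbd z (hhalf hz) z (right_mem_segment ℝ _ _) j hj) hkx₁
  obtain ⟨p, hp⟩ := exists_coord_ge (F y)
  have hyp : 2 * (η * μ ^ 2) ≤ |F y p| := by
    refine le_trans ?_ hp
    rw [le_div_iff₀ (by positivity)]
    refine le_trans (le_of_eq ?_) hyc
    rw [hη]; field_simp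
  have hysub : Metric.ball y (ρ / μ) ⊆ Metric.ball x₁ (θ * (τ / μ)) := by
    refine Metric.ball_subset_ball' ?_
    rw [Metric.mem_ball] at hy
    have : ρ / μ ≤ θ * τ / 2 / μ := by gcongr; exact min_le_left _ _
    have : θ * τ / 2 / μ + θ * τ / 2 / μ = θ * (τ / μ) := by ring
    linarith
  have hcoord : ∀ (v : EuclideanSpace ℝ ι), |v p| ≤ ‖v‖ := fun v => by
    simpa using PiLp.norm_apply_le v p
  have hvar : ∀ z ∈ Metric.ball y (ρ / μ), |F z p - F y p| ≤ η * μ ^ 2 := by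
    intro z hz
    have hseg : segment ℝ y z ⊆ Metric.ball x₁ (θ * (τ / μ)) :=
      ((convex_ball y (ρ / μ)).segment_subset (Metric.mem_ball_self (by positivity)) hz).trans hysub
    have h1 := norm_iteratedFDerivWithin_sub_le hF.contDiffOn hF.uniqueDiffOn
      (hseg.trans hballΩ) (Nat.zero_le κ)
      (fun w hw => hbd w (hseg hw) w (right_mem_segment ℝ _ _) 1 (by omega))
    have h2 : ‖iteratedFDerivWithin ℝ 0 F (closure Ω) z - iteratedFDerivWithin ℝ 0 F (closure Ω) y‖
        = ‖F z - F y‖ := by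
      rw [iteratedFDerivWithin_zero_eq_comp]
      simp only [Function.comp_apply]
      exact ((dist_eq_norm _ _).symm.trans (LinearIsometryEquiv.dist_map _ _ _)).trans
        (dist_eq_norm _ _)
    rw [h2] at h1
    rw [Metric.mem_ball, dist_eq_norm] at hz
    calc |F z p - F y p| ≤ ‖F z - F y‖ := by simpa using hcoord (F z - F y)
      _ ≤ (κ + 2) * μ ^ 3 * (η / (κ + 2) / μ) := by
        refine h1.trans ?_
        gcongr
        refine hz.le.trans ?_
        gcongr
        exact min_le_right _ _
      _ = η * μ ^ 2 := by field_simp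
  refine ⟨ν, y, p, hν, hcone, hy, ?_, fun z hz => ?_⟩
  · rcases le_abs.1 hyp with h | h
    · left
      intro z hz
      have := (abs_le.1 (hvar z hz)).1
      linarith
    · right
      intro z hz
      have := (abs_le.1 (hvar z hz)).2
      linarith
  · refine (hcoord (F z)).trans ?_
    simpa using hbd z (hysub hz) z (right_mem_segment ℝ _ _) 0 (by omega)

end

section

variable {d : ℕ}

/-! ### The magnetic field and its scale -/

/-- The scale of the field `β B`. -/
def fieldScale (Ω : Set (E d)) (A : E d → E d) (κ : ℕ) (β : ℝ) : E d → ℝ :=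
  derivScale κ (closure Ω) (fun x => β • magField Ω A x)

/-- The number of multi-indices of length at most `κ`. -/
def multiIndexCount (d κ : ℕ) : ℕ :=
  ∑ k ∈ Finset.range (κ + 1), (Finset.piAntidiag (Finset.univ : Finset (Fin d)) k).card

lemma multiIndexCount_pos (d κ : ℕ) : 0 < multiIndexCount d κ := by
  refine Finset.sum_pos' (fun _ _ => Nat.zero_le _) ⟨0, by simp, ?_⟩
  rw [Finset.card_pos]
  exact ⟨0, by simp⟩

lemma norm_partialWithin_le {V : Type*} [NormedAddCommGroup V] [NormedSpace ℝ V]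
    (s : Set (E d)) {k : ℕ} {α : Fin d → ℕ} (hα : α ∈ Finset.piAntidiag Finset.univ k)
    (f : E d → V) (x : E d) :
    ‖partialWithin s α f x‖ ≤ ‖iteratedFDerivWithin ℝ k f s x‖ := by
  have hk : ∑ i, α i = k := by simpa using hα
  subst hk
  refine (ContinuousMultilinearMap.le_opNorm _ _).trans ?_
  refine mul_le_of_le_one_right (norm_nonneg _) (Finset.prod_le_one (fun _ _ => norm_nonneg _) ?_)
  intro j _
  rw [List.getD_eq_getElem?_getD]
  -- Either the position carries a basis vector, or the default 0; both have norm at most 1.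
  cases hj : ((List.finRange d).flatMap fun i => List.replicate (α i) (e i : E d))[(j : ℕ)]? with
  | none => simp
  | some v =>
    have hv := List.mem_of_getElem? hj
    obtain ⟨i, -, hi⟩ := List.mem_flatMap.1 hv
    rw [List.eq_of_mem_replicate hi]
    simp [e]

lemma iteratedFDerivWithin_smul_field {Ω : Set (E d)} {A : E d → E d} {κ : ℕ}
    (hs : UniqueDiffOn ℝ (closure Ω))
    (hB : ContDiffOn ℝ (κ + 1 : ℕ) (magField Ω A) (closure Ω)) (β : ℝ) {k : ℕ} (hk : k ≤ κ + 1)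
    {x : E d} (hx : x ∈ closure Ω) :
    iteratedFDerivWithin ℝ k (fun x => β • magField Ω A x) (closure Ω) x =
      β • iteratedFDerivWithin ℝ k (magField Ω A) (closure Ω) x :=
  iteratedFDerivWithin_const_smul_apply (a := β) ((hB x hx).of_le (by exact_mod_cast hk)) hs hx

/-- This direction of the comparison suffices: it makes the Agmon distance Lipschitz at the scale n,
and it makes n large wherever m̃ is large, that is, on the boundary outside the well. -/
theorem mTilde_le {Ω : Set (E d)} {A : E d → E d} {κ : ℕ}
    (hs : UniqueDiffOn ℝ (closure Ω))
    (hB : ContDiffOn ℝ (κ + 1 : ℕ) (magField Ω A) (closure Ω)) {β : ℝ} (hβ : 0 ≤ β)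
    {x : E d} (hx : x ∈ closure Ω) :
    mTilde Ω A κ β x ≤ multiIndexCount d κ * fieldScale Ω A κ β x := by
  unfold mTilde fieldScale derivScale
  have h1 : ∀ k ∈ Finset.range (κ + 1), ∑ α ∈ Finset.piAntidiag Finset.univ k,
      β ^ (1 / ((k : ℝ) + 2)) *
        ‖partialWithin (closure Ω) α (magField Ω A) x‖ ^ (1 / ((k : ℝ) + 2)) ≤
      multiIndexCount d κ *
        ‖iteratedFDerivWithin ℝ k (fun x => β • magField Ω A x) (closure Ω) x‖ ^
          (1 / ((k : ℝ) + 2)) := by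
    intro k hk
    have hk' : k ≤ κ := by simpa [Nat.lt_succ_iff] using hk
    rw [iteratedFDerivWithin_smul_field hs hB β (by omega) hx, norm_smul, Real.norm_of_nonneg hβ,
      Real.mul_rpow hβ (norm_nonneg _)]
    have h2 : ∀ α ∈ Finset.piAntidiag (Finset.univ : Finset (Fin d)) k,
        β ^ (1 / ((k : ℝ) + 2)) *
          ‖partialWithin (closure Ω) α (magField Ω A) x‖ ^ (1 / ((k : ℝ) + 2)) ≤
        β ^ (1 / ((k : ℝ) + 2)) *
          ‖iteratedFDerivWithin ℝ k (magField Ω A) (closure Ω) x‖ ^ (1 / ((k : ℝ) + 2)) := by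
      intro α hα
      gcongr
      exact norm_partialWithin_le _ hα _ _
    refine (Finset.sum_le_sum h2).trans ?_
    rw [Finset.sum_const, nsmul_eq_mul]
    refine mul_le_mul_of_nonneg_right ?_ (by positivity)
    exact_mod_cast Finset.single_le_sum (s := Finset.range (κ + 1))
      (f := fun k => (Finset.piAntidiag (Finset.univ : Finset (Fin d)) k).card)
      (fun _ _ => Nat.zero_le _) hk
  refine (Finset.sum_le_sum h1).trans (le_of_eq ?_)
  rw [Finset.mul_sum]

lemma norm_iteratedFDerivWithin_le_of_CkNorm_le {V : Type*} [NormedAddCommGroup V]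
    [NormedSpace ℝ V] {N : ℕ} {s : Set (E d)} {f : E d → V} {M : ℝ≥0} (h : CkNorm N s f ≤ M)
    {k : ℕ} (hk : k ≤ N) {x : E d} (hx : x ∈ s) : ‖iteratedFDerivWithin ℝ k f s x‖ ≤ M := by
  have h1 : ‖iteratedFDerivWithin ℝ k f s x‖ₑ ≤ M :=
    (le_iSup₂_of_le (f := fun (k : ℕ) (_ : k ≤ N) => ⨆ (x : E d) (_ : x ∈ s),
        ‖iteratedFDerivWithin ℝ k f s x‖ₑ) k hk
      (le_iSup₂ (f := fun (x : E d) (_ : x ∈ s) => ‖iteratedFDerivWithin ℝ k f s x‖ₑ) x hx)).trans h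
  exact_mod_cast (enorm_le_coe.1 h1)

/-- If every full derivative were below its share τ / `multiIndexCount`, the sum over multi-indices
would stay below τ. -/
lemma exists_norm_iteratedFDerivWithin_ge_of_isFiniteType {Ω : Set (E d)} {A : E d → E d} {κ : ℕ}
    {τ : ℝ} (h : IsFiniteType Ω A κ τ) {x : E d} (hx : x ∈ closure Ω) :
    ∃ k ≤ κ, τ / multiIndexCount d κ ≤
      ‖iteratedFDerivWithin ℝ k (magField Ω A) (closure Ω) x‖ := by
  by_contra hcon
  push Not at hcon
  have hpos : (0 : ℝ) < multiIndexCount d κ := by exact_mod_cast multiIndexCount_pos d κ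
  have h1 : ∀ k ∈ Finset.range (κ + 1), ∑ α ∈ Finset.piAntidiag Finset.univ k,
      ‖partialWithin (closure Ω) α (magField Ω A) x‖ ≤
      (Finset.piAntidiag (Finset.univ : Finset (Fin d)) k).card *
        ‖iteratedFDerivWithin ℝ k (magField Ω A) (closure Ω) x‖ := by
    intro k _
    rw [← nsmul_eq_mul]
    exact Finset.sum_le_card_nsmul _ _ _ fun α hα => norm_partialWithin_le _ hα _ _
  have h2 := (h x hx).trans (Finset.sum_le_sum h1)
  have h3 : ∑ k ∈ Finset.range (κ + 1),
      ((Finset.piAntidiag (Finset.univ : Finset (Fin d)) k).card : ℝ) *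
        ‖iteratedFDerivWithin ℝ k (magField Ω A) (closure Ω) x‖ <
      ∑ k ∈ Finset.range (κ + 1),
        ((Finset.piAntidiag (Finset.univ : Finset (Fin d)) k).card : ℝ) *
          (τ / multiIndexCount d κ) := by
    refine Finset.sum_lt_sum (fun k hk => ?_) ⟨0, by simp, ?_⟩
    · exact mul_le_mul_of_nonneg_left
        (hcon k (by simpa [Nat.lt_succ_iff] using hk)).le (by positivity)
    · exact mul_lt_mul_of_pos_left (hcon 0 (Nat.zero_le _)) (by simp)
  rw [← Finset.sum_mul] at h3
  have h4 : ∑ k ∈ Finset.range (κ + 1),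
      ((Finset.piAntidiag (Finset.univ : Finset (Fin d)) k).card : ℝ) = multiIndexCount d κ := by
    unfold multiIndexCount; push_cast; rfl
  rw [h4, mul_div_cancel₀ _ hpos.ne'] at h3
  linarith

/-- For large `β` the scale of the field is large and dominates its derivatives of order `κ + 1`. -/
theorem exists_fieldScale_large {d κ : ℕ} {τ : ℝ} (hτ : 0 < τ) (n₀ M : ℝ) :
    ∃ β₀ : ℝ, 1 < β₀ ∧ ∀ {Ω : Set (E d)} {A : E d → E d}, UniqueDiffOn ℝ (closure Ω) →
      ContDiffOn ℝ (κ + 1 : ℕ) (magField Ω A) (closure Ω) → IsFiniteType Ω A κ τ →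
      ∀ β, β₀ < β → ∀ x ∈ closure Ω,
        n₀ ≤ fieldScale Ω A κ β x ∧ 1 ≤ fieldScale Ω A κ β x ∧
        β * M ≤ fieldScale Ω A κ β x ^ (κ + 3) := by
  have hpos : (0 : ℝ) < multiIndexCount d κ := by exact_mod_cast multiIndexCount_pos d κ
  set a := τ / multiIndexCount d κ with ha
  have ha0 : 0 < a := by positivity
  -- The value to be exceeded by n; since β a ≤ n^{κ+2} will be shown, it is enough that β a ≥
  -- n₁^{κ+2}.
  set n₁ : ℝ := max (max 1 n₀) (M / a) with hn₁
  have h1n : 1 ≤ n₁ := (le_max_left _ _).trans (le_max_left _ _)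
  refine ⟨max 2 (n₁ ^ (κ + 2) / a), lt_max_of_lt_left (by norm_num),
    fun {Ω A} hs hB hft β hβ x hx => ?_⟩
  have hβ2 : 2 < β := (le_max_left _ _).trans_lt hβ
  have hβa : n₁ ^ (κ + 2) ≤ β * a := by
    rw [← div_le_iff₀ ha0]; exact ((le_max_right _ _).trans_lt hβ).le
  obtain ⟨k, hk, hkx⟩ := exists_norm_iteratedFDerivWithin_ge_of_isFiniteType hft hx
  set n := fieldScale Ω A κ β x with hn
  have hn0 : 0 ≤ n := derivScale_nonneg x
  have h2 : β * a ≤ n ^ (k + 2) := by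
    refine le_trans ?_ (norm_iteratedFDerivWithin_le_derivScale_pow hk x)
    rw [iteratedFDerivWithin_smul_field hs hB β (by omega) hx, norm_smul,
      Real.norm_of_nonneg (by linarith)]
    gcongr
  -- Needed first, because the order k of the large derivative varies with x: once n ≥ 1, the power
  -- k+2 may be raised to κ+2.
  have hn1 : 1 ≤ n := by
    by_contra hlt
    push Not at hlt
    have : n ^ (k + 2) < 1 := pow_lt_one₀ hn0 hlt (by omega)
    have : 1 ≤ n₁ ^ (κ + 2) := one_le_pow₀ h1n
    linarith
  have h3 : β * a ≤ n ^ (κ + 2) := h2.trans (pow_le_pow_right₀ hn1 (by omega))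
  have h4 : n₁ ≤ n :=
    (pow_le_pow_iff_left₀ (by linarith) hn0 (by omega : κ + 2 ≠ 0)).1 (hβa.trans h3)
  refine ⟨((le_max_right _ _).trans (le_max_left _ _)).trans h4, hn1, ?_⟩
  have h5 : M / a ≤ n := (le_max_right _ _).trans h4
  -- The domination of the top derivatives uses one power of n beyond κ+2, and this extra factor is
  -- at least M/a.
  calc β * M = β * a * (M / a) := by field_simp
    _ ≤ β * a * n := by gcongr
    _ ≤ n ^ (κ + 2) * n := by gcongr
    _ = n ^ (κ + 3) := by ring

theorem isScaled_field {Ω : Set (E d)} {A : E d → E d} {κ : ℕ} {M : ℝ≥0}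
    (hs : UniqueDiffOn ℝ (closure Ω))
    (hB : ContDiffOn ℝ (κ + 1 : ℕ) (magField Ω A) (closure Ω))
    (hM : CkNorm (κ + 1) (closure Ω) (magField Ω A) ≤ M) {β : ℝ} (hβ : 0 ≤ β)
    (hn : ∀ x ∈ closure Ω, 1 ≤ fieldScale Ω A κ β x ∧
        β * M ≤ fieldScale Ω A κ β x ^ (κ + 3)) :
    IsScaled κ (closure Ω) (fun x => β • magField Ω A x) where
  contDiffOn := hB.const_smul β
  uniqueDiffOn := hs
  scale_pos x hx := zero_lt_one.trans_le (hn x hx).1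
  top_le x hx z hz := by
    refine le_trans ?_ (hn x hx).2
    rw [iteratedFDerivWithin_smul_field hs hB β le_rfl hz, norm_smul, Real.norm_of_nonneg hβ]
    gcongr
    exact norm_iteratedFDerivWithin_le_of_CkNorm_le hM le_rfl hz

lemma iteratedFDerivWithin_univ_eq_of_eqOn {V : Type*} [NormedAddCommGroup V] [NormedSpace ℝ V]
    {Ω : Set (E d)} (hΩ : IsOpen Ω) {x : E d} (hx : x ∈ Ω) (k : ℕ) {f g : E d → V}
    (hfg : EqOn f g Ω) :
    iteratedFDerivWithin ℝ k f univ x = iteratedFDerivWithin ℝ k g (closure Ω) x := by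
  have hset : closure Ω =ᶠ[𝓝 x] Ω := by
    filter_upwards [hΩ.mem_nhds hx] with y hy
    exact propext ⟨fun _ => hy, fun h => subset_closure h⟩
  rw [iteratedFDerivWithin_univ, ← iteratedFDerivWithin_of_isOpen k hΩ hx,
    iteratedFDerivWithin_congr_set hset k]
  exact iteratedFDerivWithin_congr hfg hx k

/-- The radius 1/((κ+2)μ) is admissible in the supremum defining m: on that ball the derivative
bounds at x propagate to |βB'| ≤ (κ+2)μ². The ball may leave Ω, so the derivatives of order κ+1 are
bounded through the extension constant; at x itself the derivatives of B' are those of B since Ω is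
open. -/
theorem mFun_le {Ω : Set (E d)} (hΩ : IsOpen Ω) {A : E d → E d} {κ : ℕ} {M K : ℝ≥0}
    (hM : CkNorm (κ + 1) (closure Ω) (magField Ω A) ≤ M)
    {B' : E d → EuclideanSpace ℝ (Fin d × Fin d)} (hB' : IsFieldExtension Ω A (κ + 1) K B')
    {β : ℝ} (hβ : 0 ≤ β) {x : E d} (hx : x ∈ Ω) (hn1 : 1 ≤ fieldScale Ω A κ β x)
    (hn : β * (K * M) ≤ fieldScale Ω A κ β x ^ (κ + 3)) :
    mFun (fun y => β • B' y) x ≤ ENNReal.ofReal ((κ + 2) * fieldScale Ω A κ β x) := by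
  set μ := fieldScale Ω A κ β x with hμ
  have hμ0 : 0 < μ := by linarith
  have hκ : (0 : ℝ) ≤ κ := by positivity
  have hF : ContDiff ℝ (κ + 1 : ℕ) (fun y => β • B' y) := hB'.contDiff.const_smul β
  have hloc := fun k => iteratedFDerivWithin_univ_eq_of_eqOn hΩ hx k
    (f := fun y => β • B' y) (g := fun y => β • magField Ω A y)
    (fun y hy => by simp only [hB'.eqOn (subset_closure hy)])
  have hM' : CkNorm (κ + 1) univ B' ≤ (K * M : ℝ≥0) := by
    refine hB'.norm_le.trans ?_
    push_cast
    gcongr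
  have hsmul : ∀ z, iteratedFDerivWithin ℝ (κ + 1) (fun y => β • B' y) univ z =
      β • iteratedFDerivWithin ℝ (κ + 1) B' univ z := fun z =>
    iteratedFDerivWithin_const_smul_apply (a := β) hB'.contDiff.contDiffAt.contDiffWithinAt uniqueDiffOn_univ
      (mem_univ z)
  have hbound : ∀ y ∈ Metric.ball x (1 / ((κ + 2) * μ)),
      ‖β • B' y‖ ≤ 1 / (1 / ((κ + 2) * μ)) ^ 2 := by
    intro y hy
    rw [Metric.mem_ball, dist_eq_norm] at hy
    have hlen : ‖y - x‖ * μ ≤ 1 := by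
      calc ‖y - x‖ * μ ≤ 1 / ((κ + 2) * μ) * μ := by gcongr
        _ = 1 / (κ + 2) := by field_simp
        _ ≤ 1 := by rw [div_le_one (by positivity)]; linarith
    have := norm_iteratedFDerivWithin_le_of_segment (κ := κ) (s := univ) (F := fun y => β • B' y)
      hF.contDiffOn uniqueDiffOn_univ (x := x) (y := y) (subset_univ _) hμ0.le hlen
      (fun k hk => by
        rw [hloc]; exact norm_iteratedFDerivWithin_le_derivScale_pow hk x)
      (fun z _ => by
        rw [hsmul, norm_smul, Real.norm_of_nonneg hβ]
        refine le_trans ?_ hn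
        gcongr
        exact_mod_cast norm_iteratedFDerivWithin_le_of_CkNorm_le hM' le_rfl (mem_univ z))
      (k := 0) (by omega) (right_mem_segment ℝ x y)
    rw [norm_iteratedFDerivWithin_zero] at this
    refine this.trans ?_
    rw [one_div_pow, one_div_one_div, mul_pow]
    gcongr
    nlinarith
  have hr : 0 < 1 / ((κ + 2) * μ) := by positivity
  unfold mFun
  rw [ENNReal.inv_le_iff_inv_le, ← ENNReal.ofReal_inv_of_pos (by positivity), ← one_div]
  exact le_iSup₂_of_le _ hr (le_iSup_of_le hbound le_rfl)

end

section

variable {d : ℕ}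

/-! ### Parallel transport along segments -/

lemma ennreal_add_sq_le (a b : ℝ≥0∞) : (a + b) ^ 2 ≤ 2 * a ^ 2 + 2 * b ^ 2 := by
  have := ENNReal.rpow_add_le_mul_rpow_add_rpow a b (p := 2) (by norm_num)
  norm_num at this
  simpa [mul_add] using this

lemma measurable_indicator_of_continuousOn {β : Type*} [TopologicalSpace β] [MeasurableSpace β]
    [BorelSpace β] [Zero β] {f : E d → β} {U : Set (E d)} (hf : ContinuousOn f U)
    (hU : MeasurableSet U) : Measurable (U.indicator f) := by
  classical
  have := hf.measurable_piecewise (g := (0 : E d → β)) continuousOn_const hU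
  rwa [Set.piecewise_eq_indicator] at this

lemma sq_lintegral_le {α : Type*} [MeasurableSpace α] {μ : Measure α} (hμ : μ univ ≤ 1)
    {g : α → ℝ≥0∞} (hg : AEMeasurable g μ) : (∫⁻ t, g t ∂μ) ^ 2 ≤ ∫⁻ t, g t ^ 2 ∂μ := by
  have h := ENNReal.lintegral_mul_le_Lp_mul_Lq μ (p := 2) (q := 2)
    (by constructor <;> norm_num) hg (g := 1) aemeasurable_const
  simp only [Pi.one_apply, mul_one, Pi.mul_apply, ENNReal.one_rpow, lintegral_one] at h
  calc (∫⁻ t, g t ∂μ) ^ 2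
      ≤ ((∫⁻ t, g t ^ (2 : ℝ) ∂μ) ^ (1 / 2 : ℝ) * (μ univ) ^ (1 / 2 : ℝ)) ^ 2 := by gcongr
    _ ≤ ((∫⁻ t, g t ^ (2 : ℝ) ∂μ) ^ (1 / 2 : ℝ) * 1) ^ 2 := by
        gcongr
        exact ENNReal.rpow_le_one hμ (by norm_num)
    _ = ∫⁻ t, g t ^ 2 ∂μ := by
        rw [mul_one, ← ENNReal.rpow_natCast, ← ENNReal.rpow_mul]
        norm_num

/-- The phase picked up along the segment from `x` to `x + h`. -/
def phase (A : E d → E d) (β : ℝ) (x h : E d) : ℝ :=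
  ∫ t in (0 : ℝ)..1, β * ⟪A (x + t • h), h⟫_ℝ

lemma continuousOn_magGrad {A : E d → E d} {U : Set (E d)} (hA : ContinuousOn A U) (β : ℝ)
    {u : E d → ℂ} (hu : ContDiff ℝ 1 u) : ContinuousOn (magGrad A β u (grad u)) U := by
  have h1 : ∀ j, ContinuousOn (fun x => A x j) U := fun j =>
    (EuclideanSpace.proj j : E d →L[ℝ] ℝ).continuous.comp_continuousOn hA
  have h2 : Continuous (fderiv ℝ u) := hu.continuous_fderiv one_ne_zero
  unfold magGrad grad
  refine (PiLp.continuous_toLp 2 _).comp_continuousOn (continuousOn_pi.2 fun j => ?_)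
  refine ContinuousOn.add ?_ ?_
  · exact (continuous_const.mul (h2.clm_apply continuous_const)).continuousOn
  · exact (continuousOn_const.mul (Complex.continuous_ofReal.comp_continuousOn (h1 j))).mul
      hu.continuous.continuousOn

/-- Up to a factor i, the left side is the inner product of h with the magnetic gradient: the
covariant derivative in direction h. Cauchy–Schwarz gives the bound. -/
lemma norm_deriv_transport_le (A : E d → E d) (β : ℝ) (u : E d → ℂ) (z h : E d) :
    ‖Complex.I * ((β * ⟪A z, h⟫_ℝ : ℝ) : ℂ) * u z + fderiv ℝ u z h‖ ≤
      ‖h‖ * ‖magGrad A β u (grad u) z‖ := by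
  have hh : h = ∑ j, h j • (e j : E d) := by
    have := (EuclideanSpace.basisFun (Fin d) ℝ).sum_repr h
    simpa [e] using this.symm
  have e1 : fderiv ℝ u z h = ∑ j, (h j : ℂ) * fderiv ℝ u z (e j) := by
    conv_lhs => rw [hh]
    rw [map_sum]
    simp
  have e2 : ⟪A z, h⟫_ℝ = ∑ j, h j * A z j := by
    simp [PiLp.inner_apply]
  have e3 : Complex.I * ((β * ⟪A z, h⟫_ℝ : ℝ) : ℂ) * u z + fderiv ℝ u z h =
      Complex.I * ⟪(WithLp.toLp 2 fun j => (h j : ℂ) : EuclideanSpace ℂ (Fin d)),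
        magGrad A β u (grad u) z⟫_ℂ := by
    rw [e1, e2, PiLp.inner_apply]
    simp only [magGrad, grad, RCLike.inner_apply, Complex.conj_ofReal, Complex.ofReal_mul,
      Complex.ofReal_sum, Finset.mul_sum, Finset.sum_mul]
    rw [← Finset.sum_add_distrib]
    refine Finset.sum_congr rfl fun j _ => ?_
    linear_combination ((fderiv ℝ u z (e j) * h j)) * Complex.I_mul_I
  have e4 : ‖(WithLp.toLp 2 fun j => (h j : ℂ) : EuclideanSpace ℂ (Fin d))‖ = ‖h‖ := by
    simp [EuclideanSpace.norm_eq]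
  rw [e3, norm_mul, Complex.norm_I, one_mul, ← e4]
  exact norm_inner_le_norm _ _

/-- Parallel transport changes a function by at most the integral of its magnetic gradient. -/
theorem enorm_transport_sub_le {A : E d → E d} {U : Set (E d)} (hA : ContinuousOn A U) (β : ℝ)
    {u : E d → ℂ} (hu : ContDiff ℝ 1 u) {x h : E d} (hx : ∀ t ∈ Icc (0 : ℝ) 1, x + t • h ∈ U) :
    ‖Complex.exp (Complex.I * phase A β x h) * u (x + h) - u x‖ₑ ^ 2 ≤
      ‖h‖ₑ ^ 2 * ∫⁻ t in Icc (0 : ℝ) 1, ‖magGrad A β u (grad u) (x + t • h)‖ₑ ^ 2 := by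
  have hγ : Continuous fun t : ℝ => x + t • h := by fun_prop
  have hac : ContinuousOn (fun t : ℝ => β * ⟪A (x + t • h), h⟫_ℝ) (Icc 0 1) :=
    continuousOn_const.mul ((hA.comp hγ.continuousOn hx).inner continuousOn_const)
  -- A is only known to be continuous on U, so the integrand of the phase is extended by its end
  -- values beyond [0,1]; the phase is then differentiable at every real t.
  set a : ℝ → ℝ := IccExtend (zero_le_one' ℝ)
    ((Icc (0 : ℝ) 1).domRestrict fun t : ℝ => β * ⟪A (x + t • h), h⟫_ℝ) with ha
  have hacont : Continuous a := (continuousOn_iff_continuous_domRestrict.1 hac).Icc_extend'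
  have haeq : ∀ t ∈ Icc (0 : ℝ) 1, a t = β * ⟪A (x + t • h), h⟫_ℝ := fun t ht => by
    rw [ha, IccExtend_of_mem _ _ ht]; rfl
  set ph : ℝ → ℝ := fun t => ∫ r in (0 : ℝ)..t, a r with hph
  have hphd : ∀ t, HasDerivAt ph (a t) t := fun t =>
    intervalIntegral.integral_hasDerivAt_right (hacont.intervalIntegrable _ _)
      (hacont.stronglyMeasurableAtFilter _ _) hacont.continuousAt
  have hphcont : Continuous ph := continuous_iff_continuousAt.2 fun t => (hphd t).continuousAt
  have hph1 : ph 1 = phase A β x h :=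
    intervalIntegral.integral_congr fun t ht => haeq t (by simpa using ht)
  set w : ℝ → ℂ := fun t => Complex.exp (Complex.I * ph t) * u (x + t • h) with hw
  set w' : ℝ → ℂ := fun t => Complex.exp (Complex.I * ph t) *
    (Complex.I * (a t : ℂ) * u (x + t • h) + fderiv ℝ u (x + t • h) h) with hw'
  have hwd : ∀ t, HasDerivAt w (w' t) t := by
    intro t
    have h1 : HasDerivAt (fun t : ℝ => Complex.exp (Complex.I * ph t))
        (Complex.exp (Complex.I * ph t) * (Complex.I * (a t : ℂ))) t :=
      (((hphd t).ofReal_comp).const_mul Complex.I).cexp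
    have h2 : HasDerivAt (fun t : ℝ => x + t • h) h t := by
      simpa using ((hasDerivAt_id t).smul_const h).const_add x
    have h3 : HasDerivAt (fun t : ℝ => u (x + t • h)) (fderiv ℝ u (x + t • h) h) t :=
      ((hu.differentiable one_ne_zero).differentiableAt.hasFDerivAt).comp_hasDerivAt t h2
    refine (h1.mul h3).congr_deriv ?_
    rw [hw']
    ring
  have hw'c : Continuous w' := by
    have h2 : Continuous (fderiv ℝ u) := hu.continuous_fderiv one_ne_zero
    have h3 := hu.continuous
    simp only [hw']
    refine Continuous.mul (by fun_prop) (Continuous.add ?_ ?_)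
    · exact ((continuous_const.mul (Complex.continuous_ofReal.comp hacont))).mul (h3.comp hγ)
    · exact (h2.comp hγ).clm_apply continuous_const
  have hint : w 1 - w 0 = ∫ t in (0 : ℝ)..1, w' t :=
    (intervalIntegral.integral_eq_sub_of_hasDerivAt (fun t _ => hwd t)
      (hw'c.intervalIntegrable _ _)).symm
  have hw0 : w 0 = u x := by simp [hw, hph]
  have hw1 : w 1 = Complex.exp (Complex.I * phase A β x h) * u (x + h) := by
    simp [hw, hph1]
  rw [← hw0, ← hw1, hint, intervalIntegral.integral_of_le zero_le_one]
  have hbd : ∀ t ∈ Icc (0 : ℝ) 1,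
      ‖w' t‖ₑ ≤ ‖h‖ₑ * ‖magGrad A β u (grad u) (x + t • h)‖ₑ := by
    intro t ht
    have h1 : ‖w' t‖ ≤ ‖h‖ * ‖magGrad A β u (grad u) (x + t • h)‖ := by
      simp only [hw']
      rw [norm_mul, mul_comm Complex.I (ph t : ℂ), Complex.norm_exp_ofReal_mul_I, one_mul, haeq t ht]
      exact norm_deriv_transport_le A β u (x + t • h) h
    rw [← ofReal_norm, ← ofReal_norm, ← ofReal_norm, ← ENNReal.ofReal_mul (norm_nonneg _)]
    exact ENNReal.ofReal_le_ofReal h1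
  have hmeas : AEMeasurable (fun t => ‖magGrad A β u (grad u) (x + t • h)‖ₑ)
      (volume.restrict (Icc (0 : ℝ) 1)) :=
    (((continuousOn_magGrad hA β hu).comp hγ.continuousOn hx).aestronglyMeasurable
      measurableSet_Icc).enorm
  calc ‖∫ t in Ioc (0 : ℝ) 1, w' t‖ₑ ^ 2
      ≤ (∫⁻ t in Icc (0 : ℝ) 1, ‖w' t‖ₑ) ^ 2 := by
        gcongr
        refine (enorm_integral_le_lintegral_enorm _).trans ?_
        exact lintegral_mono_set Ioc_subset_Icc_self
    _ ≤ (∫⁻ t in Icc (0 : ℝ) 1, ‖h‖ₑ * ‖magGrad A β u (grad u) (x + t • h)‖ₑ) ^ 2 := by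
        gcongr 1
        exact setLIntegral_mono' measurableSet_Icc hbd
    _ = ‖h‖ₑ ^ 2 * (∫⁻ t in Icc (0 : ℝ) 1, ‖magGrad A β u (grad u) (x + t • h)‖ₑ) ^ 2 := by
        rw [lintegral_const_mul' _ _ enorm_ne_top, mul_pow]
    _ ≤ _ := by
        gcongr
        exact sq_lintegral_le (by simp) hmeas

/-- Fubini and translation invariance: for each t the shift by k + th preserves Lebesgue measure.
The offset k serves for the sides of a square that do not start at the base point. -/
lemma lintegral_segment_shift_le {Q : E d → ℝ≥0∞} (hQ : Measurable Q) (S : Set (E d)) (k h : E d) :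
    ∫⁻ x in S, ∫⁻ t in Icc (0 : ℝ) 1, Q (x + k + t • h) ≤ ∫⁻ x, Q x := by
  have hm : Measurable (Function.uncurry fun (x : E d) (t : ℝ) => Q (x + k + t • h)) :=
    hQ.comp (by fun_prop)
  calc ∫⁻ x in S, ∫⁻ t in Icc (0 : ℝ) 1, Q (x + k + t • h)
      ≤ ∫⁻ x, ∫⁻ t in Icc (0 : ℝ) 1, Q (x + k + t • h) := setLIntegral_le_lintegral _ _
    _ = ∫⁻ t in Icc (0 : ℝ) 1, ∫⁻ x, Q (x + k + t • h) := lintegral_lintegral_swap hm.aemeasurable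
    _ = ∫⁻ t in Icc (0 : ℝ) 1, ∫⁻ x, Q x := by
        congr 1
        ext t
        simp_rw [add_assoc]
        exact lintegral_add_right_eq_self Q (k + t • h)
    _ = ∫⁻ x, Q x := by simp

/-- The sum of squares of the magnetic gradient over segments starting in `S`. -/
lemma lintegral_magGrad_segment_le {A : E d → E d} {U : Set (E d)} (hU : MeasurableSet U)
    (hA : ContinuousOn A U) (β : ℝ) {u : E d → ℂ} (hu : ContDiff ℝ 1 u) {S : Set (E d)}
    (hS : MeasurableSet S) (k h : E d)
    (hx : ∀ x ∈ S, ∀ t ∈ Icc (0 : ℝ) 1, x + k + t • h ∈ U) :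
    ∫⁻ x in S, ∫⁻ t in Icc (0 : ℝ) 1, ‖magGrad A β u (grad u) (x + k + t • h)‖ₑ ^ 2 ≤
      ∫⁻ x in U, ‖magGrad A β u (grad u) x‖ₑ ^ 2 := by
  have hP := continuousOn_magGrad hA β hu
  set Q : E d → ℝ≥0∞ := U.indicator fun x => ‖magGrad A β u (grad u) x‖ₑ ^ 2 with hQ
  have hQm : Measurable Q := by
    have h1 : ContinuousOn (fun x => ‖magGrad A β u (grad u) x‖ₑ ^ 2) U :=
      (ENNReal.continuous_pow 2).comp_continuousOn (continuous_enorm.comp_continuousOn hP)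
    exact measurable_indicator_of_continuousOn h1 hU
  rw [← lintegral_indicator hU, ← hQ]
  refine le_trans (le_of_eq ?_) (lintegral_segment_shift_le hQm S k h)
  refine setLIntegral_congr_fun hS fun x hxS => ?_
  refine setLIntegral_congr_fun measurableSet_Icc fun t ht => ?_
  simp only [hQ]
  rw [Set.indicator_of_mem (hx x hxS t ht)]

/-- The mass of `u` on `S` is controlled by its mass on a translate of `S` and by the magnetic
energy on the region swept by the translation. -/
theorem lintegral_sq_le_shift {A : E d → E d} {U : Set (E d)} (hU : MeasurableSet U)
    (hA : ContinuousOn A U) (β : ℝ) {u : E d → ℂ} (hu : ContDiff ℝ 1 u) {S S' : Set (E d)}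
    (hS : MeasurableSet S) (hS' : MeasurableSet S') (h : E d)
    (hx : ∀ x ∈ S, ∀ t ∈ Icc (0 : ℝ) 1, x + t • h ∈ U) (hSS' : ∀ x ∈ S, x + h ∈ S') :
    ∫⁻ x in S, ‖u x‖ₑ ^ 2 ≤ 2 * (∫⁻ x in S', ‖u x‖ₑ ^ 2) +
      2 * ‖h‖ₑ ^ 2 * ∫⁻ x in U, ‖magGrad A β u (grad u) x‖ₑ ^ 2 := by
  have h1 : ∀ x ∈ S, ‖u x‖ₑ ^ 2 ≤ 2 * ‖u (x + h)‖ₑ ^ 2 +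
      2 * ‖h‖ₑ ^ 2 * ∫⁻ t in Icc (0 : ℝ) 1, ‖magGrad A β u (grad u) (x + 0 + t • h)‖ₑ ^ 2 := by
    intro x hxS
    simp only [add_zero]
    have h2 := enorm_transport_sub_le hA β hu (hx x hxS)
    set c := Complex.exp (Complex.I * phase A β x h) with hc
    have hcn : ‖c‖ₑ = 1 := by
      rw [← ofReal_norm, hc, mul_comm, Complex.norm_exp_ofReal_mul_I]; simp
    have h3 : ‖u x‖ₑ ≤ ‖u (x + h)‖ₑ + ‖c * u (x + h) - u x‖ₑ := by
      calc ‖u x‖ₑ = ‖c * u (x + h) - (c * u (x + h) - u x)‖ₑ := by congr 1; ring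
        _ ≤ ‖c * u (x + h)‖ₑ + ‖c * u (x + h) - u x‖ₑ := enorm_sub_le
        _ = _ := by rw [enorm_mul, hcn, one_mul]
    calc ‖u x‖ₑ ^ 2 ≤ (‖u (x + h)‖ₑ + ‖c * u (x + h) - u x‖ₑ) ^ 2 := by gcongr
      _ ≤ _ := ennreal_add_sq_le _ _
      _ ≤ _ := by rw [mul_assoc 2 (‖h‖ₑ ^ 2)]; gcongr
  have hum : Measurable fun x => ‖u x‖ₑ ^ 2 := (hu.continuous.measurable.enorm).pow_const 2
  have hum' : Measurable fun x => ‖u (x + h)‖ₑ ^ 2 := hum.comp (measurable_add_const h)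
  refine (setLIntegral_mono' hS h1).trans ?_
  rw [lintegral_add_left (hum'.const_mul 2)]
  refine add_le_add ?_ ?_
  · rw [lintegral_const_mul _ hum']
    refine mul_le_mul_right ?_ 2
    rw [← lintegral_indicator hS, ← lintegral_indicator hS']
    refine le_trans (lintegral_mono fun x => ?_)
      (lintegral_add_right_eq_self (S'.indicator fun x => ‖u x‖ₑ ^ 2) h).le
    by_cases hxS : x ∈ S
    · rw [indicator_of_mem hxS, indicator_of_mem (hSS' x hxS)]
    · rw [indicator_of_notMem hxS]; exact zero_le
  · rw [lintegral_const_mul' _ _ (by finiteness)]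
    refine mul_le_mul_right ?_ _
    exact lintegral_magGrad_segment_le hU hA β hu hS 0 h (by simpa using hx)

end

section

variable {d : ℕ}

/-! ### The holonomy around small squares -/

/-- The phase around a square is the flux of the magnetic field through it. -/
lemma phase_square_eq {Ω : Set (E d)} (hΩ : IsOpen Ω) {A : E d → E d}
    (hA : ContDiffOn ℝ 1 A (closure Ω)) (hB : ContinuousOn (magField Ω A) (closure Ω)) (β s : ℝ)
    (i j : Fin d) {x : E d}
    (hsq : ∀ a ∈ Icc (0 : ℝ) 1, ∀ b ∈ Icc (0 : ℝ) 1, x + a • (s • e i) + b • (s • e j) ∈ Ω) :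
    phase A β x (s • e i) + phase A β (x + s • e i) (s • e j) - phase A β x (s • e j) -
        phase A β (x + s • e j) (s • e i) =
      ∫ q in Icc ((0, 0) : ℝ × ℝ) (1, 1),
        s ^ 2 * (β • magField Ω A (x + q.1 • (s • e i) + q.2 • (s • e j))) (i, j) := by
  set h : E d := s • e i with hh
  set k : E d := s • e j with hk
  set z : ℝ × ℝ → E d := fun q => x + q.1 • h + q.2 • k with hz
  have hzc : Continuous z := by fun_prop
  have hzΩ : ∀ q ∈ Icc ((0, 0) : ℝ × ℝ) (1, 1), z q ∈ Ω := fun q hq =>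
    hsq q.1 ⟨hq.1.1, hq.2.1⟩ q.2 ⟨hq.1.2, hq.2.2⟩
  set Lz : ℝ × ℝ →L[ℝ] E d :=
    (ContinuousLinearMap.fst ℝ ℝ ℝ).smulRight h + (ContinuousLinearMap.snd ℝ ℝ ℝ).smulRight k with hLz
  have hzd : ∀ q, HasFDerivAt z Lz q := by
    intro q
    have h1 : z = fun q => x + Lz q := by ext1 q; simp [hz, hLz, add_assoc]
    rw [h1]
    exact Lz.hasFDerivAt.const_add x
  have hAd : ∀ q ∈ Icc ((0, 0) : ℝ × ℝ) (1, 1),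
      HasFDerivAt A (fderivWithin ℝ A (closure Ω) (z q)) (z q) := by
    intro q hq
    have hm := hzΩ q hq
    have h1 := (hA.differentiableOn one_ne_zero (z q) (subset_closure hm)).hasFDerivWithinAt
    exact h1.hasFDerivAt (mem_of_superset (hΩ.mem_nhds hm) subset_closure)
  have hAc : ContinuousOn (fun q => A (z q)) (Icc ((0, 0) : ℝ × ℝ) (1, 1)) :=
    hA.continuousOn.comp hzc.continuousOn fun q hq => subset_closure (hzΩ q hq)
  let f' : E d → ℝ × ℝ → ℝ × ℝ →L[ℝ] ℝ := fun w q =>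
    β • ((innerSL ℝ w) ∘L ((fderivWithin ℝ A (closure Ω) (z q)) ∘L Lz))
  have hfd : ∀ w : E d, ∀ q ∈ Icc ((0, 0) : ℝ × ℝ) (1, 1),
      HasFDerivAt (fun q => β * ⟪w, A (z q)⟫_ℝ) (f' w q) q := by
    intro w q hq
    exact (((innerSL ℝ w).hasFDerivAt).comp q ((hAd q hq).comp q (hzd q))).const_mul β
  have hfc : ∀ w : E d, ContinuousOn (fun q => β * ⟪w, A (z q)⟫_ℝ) (Icc ((0, 0) : ℝ × ℝ) (1, 1)) :=
    fun w => continuousOn_const.mul (continuousOn_const.inner hAc)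
  have hsub : Ioo (0 : ℝ) 1 ×ˢ Ioo (0 : ℝ) 1 ⊆ Icc ((0, 0) : ℝ × ℝ) (1, 1) := fun q hq =>
    ⟨⟨hq.1.1.le, hq.2.1.le⟩, ⟨hq.1.2.le, hq.2.2.le⟩⟩
  have hLz1 : Lz (1, 0) = h := by simp [hLz]
  have hLz2 : Lz (0, 1) = k := by simp [hLz]
  have hdiv : ∀ q, f' k q (1, 0) + (-f' h q) (0, 1) =
      s ^ 2 * (β • magField Ω A (z q)) (i, j) := by
    intro q
    simp only [f', neg_apply, smul_apply,
      ContinuousLinearMap.comp_apply, hLz1, hLz2, innerSL_apply_apply, smul_eq_mul, PiLp.smul_apply,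
      magField]
    rw [hh, hk]
    simp only [map_smul, inner_smul_left, inner_smul_right, e, EuclideanSpace.inner_single_left]
    simp
    ring
  have hint : IntegrableOn (fun q => f' k q (1, 0) + (-f' h q) (0, 1))
      (Icc ((0, 0) : ℝ × ℝ) (1, 1)) := by
    simp_rw [hdiv]
    refine ContinuousOn.integrableOn_compact isCompact_Icc (continuousOn_const.mul ?_)
    have h1 : ContinuousOn (fun q => β • magField Ω A (z q)) (Icc ((0, 0) : ℝ × ℝ) (1, 1)) :=
      (hB.comp hzc.continuousOn fun q hq => subset_closure (hzΩ q hq)).const_smul β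
    exact (EuclideanSpace.proj (i, j) : EuclideanSpace ℝ (Fin d × Fin d) →L[ℝ] ℝ).continuous
      |>.comp_continuousOn h1
  -- Green's theorem on the parameter square for the field (β⟨k, A⟩, -β⟨h, A⟩), whose divergence is
  -- s²βB_ij. Its four boundary terms are the phases of the sides.
  have hgreen := integral_divergence_prod_Icc_of_hasFDerivAt_of_le
    (fun q => β * ⟪k, A (z q)⟫_ℝ) (fun q => -(β * ⟪h, A (z q)⟫_ℝ)) (f' k) (fun q => -f' h q)
    (0, 0) (1, 1) (by simp) (hfc k) (hfc h).neg (fun q hq => hfd k q (hsub hq))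
    (fun q hq => (hfd h q (hsub hq)).neg) hint
  simp_rw [hdiv] at hgreen
  rw [hgreen]
  simp only [phase, hz, intervalIntegral.integral_neg, zero_smul, one_smul, add_zero,
    real_inner_comm k, real_inner_comm h]
  simp only [add_right_comm x k]
  have e1 : ∀ t : ℝ, x + t • h + k = x + k + t • h := fun t => add_right_comm _ _ _
  simp only [e1]
  ring

/-- The left-out factor is Jordan's inequality, with π ≤ 4. The restriction on φ keeps it away from
non-zero multiples of 2π, where the holonomy would be invisible. -/
lemma half_abs_le_norm_exp_sub_one {φ : ℝ} (hφ : |φ| ≤ 1) :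
    |φ| / 2 ≤ ‖Complex.exp (Complex.I * φ) - 1‖ := by
  rw [Complex.norm_exp_I_mul_ofReal_sub_one, norm_mul, Real.norm_two]
  have h1 : ‖Real.sin (φ / 2)‖ = Real.sin (|φ| / 2) := by
    have h0 : |φ / 2| = |φ| / 2 := by rw [abs_div, abs_two]
    rw [Real.norm_eq_abs, Real.abs_sin_eq_sin_abs_of_abs_le_pi, h0]
    rw [h0]
    linarith [Real.pi_gt_three]
  have h2 : 2 / Real.pi * (|φ| / 2) ≤ Real.sin (|φ| / 2) :=
    Real.mul_le_sin (by positivity) (by linarith [Real.pi_gt_three])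
  rw [h1]
  have h3 : 1 / 4 ≤ 1 / Real.pi := one_div_le_one_div_of_le Real.pi_pos Real.pi_le_four
  have h4 : 2 / Real.pi * (|φ| / 2) = 1 / Real.pi * |φ| := by ring
  nlinarith [abs_nonneg φ]

lemma ennreal_four_sq_le (a b c f : ℝ≥0∞) :
    (a + b + (c + f)) ^ 2 ≤ 4 * (a ^ 2 + b ^ 2 + (c ^ 2 + f ^ 2)) := by
  calc (a + b + (c + f)) ^ 2 ≤ 2 * (a + b) ^ 2 + 2 * (c + f) ^ 2 := ennreal_add_sq_le _ _
    _ ≤ 2 * (2 * a ^ 2 + 2 * b ^ 2) + 2 * (2 * c ^ 2 + 2 * f ^ 2) := by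
      gcongr <;> exact ennreal_add_sq_le _ _
    _ = _ := by ring

/-- Here a, b, c, f are the values at the corners of a square. The value f is carried to the corner
of a along the two routes, through b and through c; the results differ by the holonomy factor, and
each route telescopes into transport errors along its sides. -/
lemma enorm_holonomy_le (p₁ p₂ p₃ p₄ : ℝ) (a b c f : ℂ) :
    ‖Complex.exp (Complex.I * ((p₁ + p₂ - p₃ - p₄ : ℝ) : ℂ)) - 1‖ₑ * ‖f‖ₑ ≤
      ‖Complex.exp (Complex.I * p₁) * b - a‖ₑ + ‖Complex.exp (Complex.I * p₂) * f - b‖ₑ +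
      (‖Complex.exp (Complex.I * p₃) * c - a‖ₑ + ‖Complex.exp (Complex.I * p₄) * f - c‖ₑ) := by
  have hn : ∀ p : ℝ, ‖Complex.exp (Complex.I * p)‖ₑ = 1 := fun p => by
    rw [← ofReal_norm, mul_comm, Complex.norm_exp_ofReal_mul_I]; simp
  have h1 : ‖Complex.exp (Complex.I * ((p₁ + p₂ - p₃ - p₄ : ℝ) : ℂ)) - 1‖ₑ * ‖f‖ₑ =
      ‖(Complex.exp (Complex.I * p₁) * Complex.exp (Complex.I * p₂) -
        Complex.exp (Complex.I * p₃) * Complex.exp (Complex.I * p₄)) * f‖ₑ := by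
    have : Complex.exp (Complex.I * p₁) * Complex.exp (Complex.I * p₂) -
        Complex.exp (Complex.I * p₃) * Complex.exp (Complex.I * p₄) =
        Complex.exp (Complex.I * p₃) * (Complex.exp (Complex.I * p₄) *
          (Complex.exp (Complex.I * ((p₁ + p₂ - p₃ - p₄ : ℝ) : ℂ)) - 1)) := by
      have h0 : Complex.exp (Complex.I * p₁) * Complex.exp (Complex.I * p₂) =
          Complex.exp (Complex.I * p₃) * Complex.exp (Complex.I * p₄) *
            Complex.exp (Complex.I * ((p₁ + p₂ - p₃ - p₄ : ℝ) : ℂ)) := by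
        rw [← Complex.exp_add, ← Complex.exp_add, ← Complex.exp_add]
        congr 1
        push_cast
        ring
      linear_combination h0
    rw [this, enorm_mul, enorm_mul, enorm_mul, hn, hn, one_mul, one_mul]
  rw [h1]
  have h2 : (Complex.exp (Complex.I * p₁) * Complex.exp (Complex.I * p₂) -
        Complex.exp (Complex.I * p₃) * Complex.exp (Complex.I * p₄)) * f =
      ((Complex.exp (Complex.I * p₁) * b - a) +
        Complex.exp (Complex.I * p₁) * (Complex.exp (Complex.I * p₂) * f - b)) -
      ((Complex.exp (Complex.I * p₃) * c - a) +
        Complex.exp (Complex.I * p₃) * (Complex.exp (Complex.I * p₄) * f - c)) := by ring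
  rw [h2]
  refine enorm_sub_le.trans (add_le_add ?_ ?_)
  · refine (enorm_add_le _ _).trans ?_
    rw [enorm_mul, hn, one_mul]
  · refine (enorm_add_le _ _).trans ?_
    rw [enorm_mul, hn, one_mul]

lemma aemeasurable_magGrad_segment {A : E d → E d} {U : Set (E d)} (hU : MeasurableSet U)
    (hA : ContinuousOn A U) (β : ℝ) {u : E d → ℂ} (hu : ContDiff ℝ 1 u) {S : Set (E d)}
    (hS : MeasurableSet S) (k h : E d)
    (hx : ∀ x ∈ S, ∀ t ∈ Icc (0 : ℝ) 1, x + k + t • h ∈ U) :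
    AEMeasurable (fun x => ∫⁻ t in Icc (0 : ℝ) 1, ‖magGrad A β u (grad u) (x + k + t • h)‖ₑ ^ 2)
      (volume.restrict S) := by
  have h1 : ContinuousOn (fun x => ‖magGrad A β u (grad u) x‖ₑ ^ 2) U :=
    (ENNReal.continuous_pow 2).comp_continuousOn
      (continuous_enorm.comp_continuousOn (continuousOn_magGrad hA β hu))
  have hQm := measurable_indicator_of_continuousOn h1 hU
  have hm : Measurable fun x : E d => ∫⁻ t in Icc (0 : ℝ) 1,
      U.indicator (fun x => ‖magGrad A β u (grad u) x‖ₑ ^ 2) (x + k + t • h) :=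
    Measurable.lintegral_prod_right' (f := fun q : E d × ℝ =>
      U.indicator (fun x => ‖magGrad A β u (grad u) x‖ₑ ^ 2) (q.1 + k + q.2 • h))
      (hQm.comp (by fun_prop))
  refine hm.aemeasurable.congr ?_
  filter_upwards [self_mem_ae_restrict hS] with x hxS
  refine setLIntegral_congr_fun measurableSet_Icc fun t ht => ?_
  rw [Set.indicator_of_mem (hx x hxS t ht)]

/-- A component of fixed sign admits no cancellation in the flux, which gives the lower bound; the
upper bound keeps the phase in the range of `half_abs_le_norm_exp_sub_one`. -/
lemma abs_phase_square {Ω : Set (E d)} (hΩ : IsOpen Ω) {A : E d → E d}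
    (hA : ContDiffOn ℝ 1 A (closure Ω)) (hB : ContinuousOn (magField Ω A) (closure Ω)) (β s : ℝ)
    (i j : Fin d) {x : E d} {b : ℝ} {U : Set (E d)} (hU : U ⊆ Ω)
    (hsq : ∀ a ∈ Icc (0 : ℝ) 1, ∀ b ∈ Icc (0 : ℝ) 1, x + a • (s • e i) + b • (s • e j) ∈ U)
    (hlow : (∀ z ∈ U, b ≤ (β • magField Ω A z) (i, j)) ∨
      (∀ z ∈ U, (β • magField Ω A z) (i, j) ≤ -b))
    (hup : ∀ z ∈ U, s ^ 2 * |(β • magField Ω A z) (i, j)| ≤ 1) :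
    s ^ 2 * b ≤ |phase A β x (s • e i) + phase A β (x + s • e i) (s • e j) -
        phase A β x (s • e j) - phase A β (x + s • e j) (s • e i)| ∧
      |phase A β x (s • e i) + phase A β (x + s • e i) (s • e j) -
        phase A β x (s • e j) - phase A β (x + s • e j) (s • e i)| ≤ 1 := by
  rw [phase_square_eq hΩ hA hB β s i j fun a ha b hb => hU (hsq a ha b hb)]
  obtain ⟨z, hz⟩ : ∃ z : ℝ × ℝ → E d, z = fun q => x + q.1 • (s • e i) + q.2 • (s • e j) :=
    ⟨_, rfl⟩
  have hzc : Continuous z := by rw [hz]; fun_prop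
  have hzU : ∀ q ∈ Icc ((0, 0) : ℝ × ℝ) (1, 1), z q ∈ U := fun q hq => by
    rw [hz]; exact hsq q.1 ⟨hq.1.1, hq.2.1⟩ q.2 ⟨hq.1.2, hq.2.2⟩
  have hzq : ∀ q : ℝ × ℝ, x + q.1 • (s • e i) + q.2 • (s • e j) = z q := fun q => by rw [hz]
  simp only [hzq]
  obtain ⟨g, hg⟩ : ∃ g : E d → ℝ, g = fun w => (β • magField Ω A w) (i, j) := ⟨_, rfl⟩
  have hgq : ∀ w, (β • magField Ω A w) (i, j) = g w := fun w => by rw [hg]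
  simp only [hgq] at hlow hup ⊢
  have hgc : ContinuousOn g (closure Ω) := by
    rw [hg]
    exact (EuclideanSpace.proj (i, j) : EuclideanSpace ℝ (Fin d × Fin d) →L[ℝ] ℝ).continuous
      |>.comp_continuousOn (hB.const_smul β)
  have hvol : volume.real (Icc ((0, 0) : ℝ × ℝ) (1, 1)) = 1 := by
    rw [Measure.real, ← Icc_prod_Icc, Measure.volume_eq_prod, Measure.prod_prod]
    simp
  have hfin : volume (Icc ((0, 0) : ℝ × ℝ) (1, 1)) < ⊤ := isCompact_Icc.measure_lt_top
  have hcont : ContinuousOn (fun q => s ^ 2 * g (z q)) (Icc ((0, 0) : ℝ × ℝ) (1, 1)) :=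
    continuousOn_const.mul (hgc.comp hzc.continuousOn fun q hq => subset_closure (hU (hzU q hq)))
  have hintg := hcont.integrableOn_compact (μ := volume) isCompact_Icc
  have hconst : ∀ c : ℝ, ∫ _ in Icc ((0, 0) : ℝ × ℝ) (1, 1), c = c := fun c => by
    rw [setIntegral_const, hvol, one_smul]
  have hci : ∀ c : ℝ, IntegrableOn (fun _ => c) (Icc ((0, 0) : ℝ × ℝ) (1, 1)) := fun c =>
    integrableOn_const hfin.ne
  constructor
  · rcases hlow with hl | hl
    · refine le_trans ?_ (le_abs_self _)
      rw [← hconst (s ^ 2 * b)]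
      refine setIntegral_mono_on (hci _) hintg measurableSet_Icc fun q hq => ?_
      exact mul_le_mul_of_nonneg_left (hl _ (hzU q hq)) (by positivity)
    · refine le_trans ?_ (neg_le_abs _)
      rw [le_neg, ← hconst (-(s ^ 2 * b))]
      refine setIntegral_mono_on hintg (hci _) measurableSet_Icc fun q hq => ?_
      rw [← mul_neg]
      exact mul_le_mul_of_nonneg_left (hl _ (hzU q hq)) (by positivity)
  · rw [← Real.norm_eq_abs]
    refine (norm_setIntegral_le_of_norm_le_const (C := 1) hfin fun q hq => ?_).trans
      (by rw [hvol]; norm_num)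
    rw [norm_mul, Real.norm_of_nonneg (by positivity), Real.norm_eq_abs]
    exact hup _ (hzU q hq)

/-- On a ball where one component of the magnetic field is large, the mass of a function is
controlled by its magnetic energy. -/
theorem lintegral_sq_le_of_field_large {Ω : Set (E d)} (hΩ : IsOpen Ω) {A : E d → E d}
    (hA : ContDiffOn ℝ 1 A (closure Ω)) (hB : ContinuousOn (magField Ω A) (closure Ω)) (β : ℝ)
    {u : E d → ℂ} (hu : ContDiff ℝ 1 u) {y : E d} {s b : ℝ} (hs : 0 < s) (hb : 0 < b)
    (p : Fin d × Fin d) (hball : Metric.ball y (3 * s) ⊆ Ω)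
    (hlow : (∀ z ∈ Metric.ball y (3 * s), b ≤ (β • magField Ω A z) p) ∨
      (∀ z ∈ Metric.ball y (3 * s), (β • magField Ω A z) p ≤ -b))
    (hup : ∀ z ∈ Metric.ball y (3 * s), s ^ 2 * |(β • magField Ω A z) p| ≤ 1) :
    ∫⁻ x in Metric.ball y s, ‖u x‖ₑ ^ 2 ≤ ENNReal.ofReal (64 * s ^ 2 / (s ^ 2 * b) ^ 2) *
      ∫⁻ x in Metric.ball y (3 * s), ‖magGrad A β u (grad u) x‖ₑ ^ 2 := by
  obtain ⟨i, j⟩ := p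
  obtain ⟨h, hh⟩ : ∃ h : E d, h = s • e i := ⟨_, rfl⟩
  obtain ⟨k, hk⟩ : ∃ k : E d, k = s • e j := ⟨_, rfl⟩
  have hhn : ‖h‖ = s := by simp [hh, e, norm_smul, abs_of_pos hs]
  have hkn : ‖k‖ = s := by simp [hk, e, norm_smul, abs_of_pos hs]
  -- The square attached to z starts at z - h - k, so that z is its far corner, the one whose value
  -- the holonomy inequality controls. All its points are within 2s of z, hence the radius 3s.
  have hmem : ∀ z ∈ Metric.ball y s, ∀ a ∈ Icc (0 : ℝ) 1, ∀ b ∈ Icc (0 : ℝ) 1,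
      z + (-h - k) + a • h + b • k ∈ Metric.ball y (3 * s) := by
    intro z hz a ha b hb
    rw [Metric.mem_ball, dist_eq_norm] at *
    have e1 : z + (-h - k) + a • h + b • k - y = (z - y) + ((a - 1) • h + (b - 1) • k) := by module
    rw [e1]
    refine (norm_add_le _ _).trans_lt ?_
    have h1 : ‖(a - 1) • h + (b - 1) • k‖ ≤ 1 * s + 1 * s := by
      refine (norm_add_le _ _).trans ?_
      rw [norm_smul, norm_smul, hhn, hkn]
      gcongr
      · rw [Real.norm_eq_abs, abs_le]; constructor <;> linarith [ha.1, ha.2]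
      · rw [Real.norm_eq_abs, abs_le]; constructor <;> linarith [hb.1, hb.2]
    linarith
  have h0 : (0 : ℝ) ∈ Icc (0 : ℝ) 1 := by simp
  have h1 : (1 : ℝ) ∈ Icc (0 : ℝ) 1 := by simp
  set U := Metric.ball y (3 * s) with hU
  have hUm : MeasurableSet U := measurableSet_ball
  have hAU : ContinuousOn A U := hA.continuousOn.mono (hball.trans subset_closure)
  have m1 : ∀ z ∈ Metric.ball y s, ∀ t ∈ Icc (0 : ℝ) 1, z + (-h - k) + t • h ∈ U := by
    intro z hz t ht; simpa using hmem z hz t ht 0 h0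
  have m2 : ∀ z ∈ Metric.ball y s, ∀ t ∈ Icc (0 : ℝ) 1, z + (-k) + t • k ∈ U := by
    intro z hz t ht
    have e1 : z + -k + t • k = z + (-h - k) + (1 : ℝ) • h + t • k := by module
    rw [e1]
    exact hmem z hz 1 h1 t ht
  have m3 : ∀ z ∈ Metric.ball y s, ∀ t ∈ Icc (0 : ℝ) 1, z + (-h - k) + t • k ∈ U := by
    intro z hz t ht; simpa using hmem z hz 0 h0 t ht
  have m4 : ∀ z ∈ Metric.ball y s, ∀ t ∈ Icc (0 : ℝ) 1, z + (-h) + t • h ∈ U := by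
    intro z hz t ht
    have e1 : z + -h + t • h = z + (-h - k) + t • h + (1 : ℝ) • k := by module
    rw [e1]
    exact hmem z hz t ht 1 h1
  let T : E d → E d → E d → ℝ≥0∞ := fun c v z =>
    ∫⁻ t in Icc (0 : ℝ) 1, ‖magGrad A β u (grad u) (z + c + t • v)‖ₑ ^ 2
  have hpt : ∀ z ∈ Metric.ball y s, ENNReal.ofReal (s ^ 2 * b / 2) ^ 2 * ‖u z‖ₑ ^ 2 ≤
      4 * ENNReal.ofReal s ^ 2 *
        (T (-h - k) h z + T (-k) k z + (T (-h - k) k z + T (-h) h z)) := by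
    intro z hz
    obtain ⟨hΦlow, hΦup⟩ := abs_phase_square hΩ hA hB β s i j (x := z + (-h - k)) (b := b) hball
      (by rw [← hh, ← hk]; exact hmem z hz) hlow hup
    rw [← hh, ← hk] at hΦlow hΦup
    set Φ := phase A β (z + (-h - k)) h + phase A β (z + (-h - k) + h) k -
      phase A β (z + (-h - k)) k - phase A β (z + (-h - k) + k) h with hΦ
    have hexp : ENNReal.ofReal (s ^ 2 * b / 2) ≤ ‖Complex.exp (Complex.I * (Φ : ℂ)) - 1‖ₑ := by
      rw [← ofReal_norm]
      refine ENNReal.ofReal_le_ofReal (le_trans ?_ (half_abs_le_norm_exp_sub_one hΦup))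
      gcongr
    have c1 : z + (-h - k) + h = z + -k := by abel
    have c2 : z + (-h - k) + k = z + -h := by abel
    have t1 := enorm_transport_sub_le hAU β hu (m1 z hz)
    have t2 := enorm_transport_sub_le hAU β hu (m2 z hz)
    have t3 := enorm_transport_sub_le hAU β hu (m3 z hz)
    have t4 := enorm_transport_sub_le hAU β hu (m4 z hz)
    have hol := enorm_holonomy_le (phase A β (z + (-h - k)) h) (phase A β (z + -k) k)
      (phase A β (z + (-h - k)) k) (phase A β (z + -h) h) (u (z + (-h - k))) (u (z + -k))
      (u (z + -h)) (u z)
    rw [c1, c2] at hΦ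
    rw [← hΦ] at hol
    rw [c1] at t1
    rw [c2] at t3
    rw [neg_add_cancel_right] at t2 t4
    have hhe : ‖h‖ₑ = ENNReal.ofReal s := by rw [← ofReal_norm, hhn]
    have hke : ‖k‖ₑ = ENNReal.ofReal s := by rw [← ofReal_norm, hkn]
    rw [hhe] at t1 t4
    rw [hke] at t2 t3
    calc ENNReal.ofReal (s ^ 2 * b / 2) ^ 2 * ‖u z‖ₑ ^ 2
        = (ENNReal.ofReal (s ^ 2 * b / 2) * ‖u z‖ₑ) ^ 2 := by ring
      _ ≤ (‖Complex.exp (Complex.I * (Φ : ℂ)) - 1‖ₑ * ‖u z‖ₑ) ^ 2 := by gcongr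
      _ ≤ _ := pow_le_pow_left' hol 2
      _ ≤ _ := ennreal_four_sq_le _ _ _ _
      _ ≤ 4 * (ENNReal.ofReal s ^ 2 * T (-h - k) h z + ENNReal.ofReal s ^ 2 * T (-k) k z +
          (ENNReal.ofReal s ^ 2 * T (-h - k) k z + ENNReal.ofReal s ^ 2 * T (-h) h z)) := by
        gcongr
      _ = _ := by ring
  have hSm : MeasurableSet (Metric.ball y s) := measurableSet_ball
  have hTm : ∀ c v, (∀ z ∈ Metric.ball y s, ∀ t ∈ Icc (0 : ℝ) 1, z + c + t • v ∈ U) →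
      AEMeasurable (T c v) (volume.restrict (Metric.ball y s)) := fun c v hm =>
    aemeasurable_magGrad_segment hUm hAU β hu hSm c v hm
  have hTi : ∀ c v, (∀ z ∈ Metric.ball y s, ∀ t ∈ Icc (0 : ℝ) 1, z + c + t • v ∈ U) →
      ∫⁻ z in Metric.ball y s, T c v z ≤ ∫⁻ x in U, ‖magGrad A β u (grad u) x‖ₑ ^ 2 :=
    fun c v hm => lintegral_magGrad_segment_le hUm hAU β hu hSm c v hm
  set I := ∫⁻ x in U, ‖magGrad A β u (grad u) x‖ₑ ^ 2 with hI
  set c := s ^ 2 * b with hc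
  have hc0 : 0 < c := by positivity
  -- The pointwise inequality is integrated over the ball: four sides, each costing at most the
  -- energy I, times the 4 from squaring a sum of four terms.
  have hmain : ENNReal.ofReal (c / 2) ^ 2 * ∫⁻ x in Metric.ball y s, ‖u x‖ₑ ^ 2 ≤
      16 * ENNReal.ofReal s ^ 2 * I := by
    rw [← lintegral_const_mul' _ _ (by finiteness)]
    refine (setLIntegral_mono' hSm hpt).trans ?_
    rw [lintegral_const_mul' _ _ (by finiteness),
      lintegral_add_left' (f := fun z => T (-h - k) h z + T (-k) k z)
        ((hTm _ _ m1).add (hTm _ _ m2)), lintegral_add_left' (hTm _ _ m1),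
      lintegral_add_left' (hTm _ _ m3)]
    calc _ ≤ 4 * ENNReal.ofReal s ^ 2 * (I + I + (I + I)) := by
          gcongr
          exacts [hTi _ _ m1, hTi _ _ m2, hTi _ _ m3, hTi _ _ m4]
      _ = _ := by ring
  have hone : ENNReal.ofReal ((2 / c) ^ 2) * ENNReal.ofReal (c / 2) ^ 2 = 1 := by
    rw [← ENNReal.ofReal_pow (by positivity), ← ENNReal.ofReal_mul (by positivity)]
    rw [show (2 / c) ^ 2 * (c / 2) ^ 2 = 1 by field_simp]
    simp
  calc ∫⁻ x in Metric.ball y s, ‖u x‖ₑ ^ 2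
      = ENNReal.ofReal ((2 / c) ^ 2) * (ENNReal.ofReal (c / 2) ^ 2 *
          ∫⁻ x in Metric.ball y s, ‖u x‖ₑ ^ 2) := by rw [← mul_assoc, hone, one_mul]
    _ ≤ ENNReal.ofReal ((2 / c) ^ 2) * (16 * ENNReal.ofReal s ^ 2 * I) := by gcongr
    _ = _ := by
        rw [← mul_assoc]
        congr 1
        rw [show (16 : ℝ≥0∞) = ENNReal.ofReal 16 by simp, ← ENNReal.ofReal_pow hs.le,
          ← ENNReal.ofReal_mul (by norm_num), ← ENNReal.ofReal_mul (by positivity)]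
        congr 1
        field_simp
        norm_num

end

section

variable {d : ℕ}

/-! ### The magnetic uncertainty principle -/

/-- The mass near x₀, possibly a boundary point, is moved by parallel transport along the cone axis
to a ball about x₁, then to a ball about y where a field component is large, and there the holonomy
bound applies. Each move costs the energy times the square of its length, which is of order 1/n². -/
theorem exists_local_mass_le {Ω : Set (E d)} (hd : 2 ≤ d) (hΩ : IsOpen Ω) {δ θ : ℝ}
    (hU : UniformConeOn Ω (closure Ω) δ θ) (κ : ℕ) {ρ₀ : ℝ} (hρ₀ : 0 < ρ₀) :
    ∃ σ C : ℝ, 0 < σ ∧ σ ≤ ρ₀ ∧ σ ≤ 1 ∧ 0 < C ∧ ∀ (A : E d → E d) (β : ℝ),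
      ContDiffOn ℝ 1 A (closure Ω) → ContinuousOn (magField Ω A) (closure Ω) →
      IsScaled κ (closure Ω) (fun x => β • magField Ω A x) →
      ∀ x₀ ∈ closure Ω, 1 ≤ δ * fieldScale Ω A κ β x₀ → ∀ u : E d → ℂ, ContDiff ℝ 1 u →
      ∫⁻ x in Ω ∩ Metric.ball x₀ (σ / fieldScale Ω A κ β x₀), ‖u x‖ₑ ^ 2 ≤
        ENNReal.ofReal (C / fieldScale Ω A κ β x₀ ^ 2) *
          ∫⁻ x in Ω ∩ Metric.ball x₀ (ρ₀ / fieldScale Ω A κ β x₀),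
            ‖magGrad A β u (grad u) x‖ₑ ^ 2 := by
  have : Nonempty (Fin d × Fin d) := ⟨(⟨0, by omega⟩, ⟨0, by omega⟩)⟩
  obtain ⟨τ, ρ, η, hτ, hτρ, hτ4, hρ, hρθ, hη, H⟩ :=
    exists_ball_field_large (ι := Fin d × Fin d) hU κ (ρ₀ := ρ₀ / 4) (by positivity)
  have hθ := hU.aperture_pos
  have hθ1 := hU.aperture_le
  have hδ := hU.pos
  have hκ : (0 : ℝ) ≤ κ := by positivity
  -- The first bound puts the ball of radius 3σ/μ inside the one where the component is large; the
  -- second keeps the flux through squares of side σ/μ at most 1.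
  set σ : ℝ := min (ρ / 3) (1 / (κ + 2)) with hσ
  have hσ0 : 0 < σ := by positivity
  have hσρ : 3 * σ ≤ ρ := by linarith [min_le_left (ρ / 3) (1 / ((κ : ℝ) + 2))]
  have hθτ : θ * τ ≤ τ := mul_le_of_le_one_left hτ.le hθ1
  have hσκ : σ * (κ + 2) ≤ 1 := by
    calc σ * (κ + 2) ≤ 1 / (κ + 2) * (κ + 2) := by gcongr; exact min_le_right _ _
      _ = 1 := by field_simp
  have hσ1 : σ ≤ 1 := by linarith
  set C : ℝ := 2 * (2 * (64 * σ ^ 2 / (σ ^ 2 * η) ^ 2) + 2 * τ ^ 2) + 2 * τ ^ 2 with hC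
  refine ⟨σ, C, hσ0, by linarith, hσ1, by positivity, fun A β hA hB hF x₀ hx₀ hδn u hu => ?_⟩
  obtain ⟨ν, y, p, hν, hcone, hy, hlow, hup⟩ := H _ hF x₀ hx₀ hδn
  change 1 ≤ δ * derivScale κ (closure Ω) (fun x => β • magField Ω A x) x₀ at hδn
  have hμ0 : 0 < derivScale κ (closure Ω) (fun x => β • magField Ω A x) x₀ := hF.scale_pos x₀ hx₀
  change _ ≤ ENNReal.ofReal (C / derivScale κ (closure Ω) (fun x => β • magField Ω A x) x₀ ^ 2) * _
  simp only [fieldScale]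
  generalize derivScale κ (closure Ω) (fun x => β • magField Ω A x) x₀ = μ at *
  have htδ : τ / μ ≤ δ := by rw [div_le_iff₀ hμ0]; linarith
  have ht0 : 0 < τ / μ := by positivity
  set x₁ := x₀ + (τ / μ) • ν with hx₁
  have hcone₀ := hcone x₀ hx₀ (by simpa using hδ) (τ / μ) ht0 htδ
  rw [← hx₁] at hcone₀
  have hyx₁ : ‖y - x₁‖ < θ * τ / 2 / μ := by rwa [Metric.mem_ball, dist_eq_norm] at hy
  have hx₁x₀ : dist x₁ x₀ = τ / μ := by
    rw [hx₁, dist_self_add_left, norm_smul, hν, mul_one, Real.norm_of_nonneg ht0.le]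
  set U := Ω ∩ Metric.ball x₀ (ρ₀ / μ) with hUdef
  have hUm : MeasurableSet U := hΩ.measurableSet.inter measurableSet_ball
  have hAU : ContinuousOn A U := hA.continuousOn.mono (inter_subset_left.trans subset_closure)
  have e1 : θ * τ / 2 / μ = θ * (τ / μ) / 2 := by ring
  have hσμ : 6 * (σ / μ) ≤ θ * (τ / μ) := by
    have h6 : 6 * σ ≤ θ * τ := by linarith
    have : 6 * σ / μ ≤ θ * τ / μ := div_le_div_of_nonneg_right h6 hμ0.le
    rw [mul_div_assoc, mul_div_assoc] at this
    exact this
  have hθt : θ * (τ / μ) ≤ τ / μ := mul_le_of_le_one_left ht0.le hθ1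
  have hρμ : 4 * (τ / μ) ≤ ρ₀ / μ := by
    rw [← mul_div_assoc]; gcongr; linarith
  have hσμ0 : 0 < σ / μ := by positivity
  have hballU : Metric.ball x₁ (θ * (τ / μ)) ⊆ U := by
    refine subset_inter hcone₀ (Metric.ball_subset_ball' ?_)
    rw [hx₁x₀]; linarith
  have hnormh : ‖(τ / μ) • ν‖ₑ ^ 2 = ENNReal.ofReal ((τ / μ) ^ 2) := by
    rw [← ofReal_norm, norm_smul, hν, mul_one, Real.norm_of_nonneg ht0.le,
      ENNReal.ofReal_pow ht0.le]
  set I := ∫⁻ x in U, ‖magGrad A β u (grad u) x‖ₑ ^ 2 with hI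
  have s1 : ∫⁻ x in Ω ∩ Metric.ball x₀ (σ / μ), ‖u x‖ₑ ^ 2 ≤
      2 * (∫⁻ x in Metric.ball x₁ (σ / μ), ‖u x‖ₑ ^ 2) + 2 * ENNReal.ofReal ((τ / μ) ^ 2) * I := by
    rw [← hnormh]
    refine lintegral_sq_le_shift hUm hAU β hu (hΩ.measurableSet.inter measurableSet_ball)
      measurableSet_ball _ ?_ ?_
    · rintro x ⟨hxΩ, hx⟩ t ⟨ht0', ht1⟩
      rw [Metric.mem_ball] at hx
      refine ⟨?_, ?_⟩
      · rcases ht0'.eq_or_lt with rfl | htpos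
        · simpa using hxΩ
        · rw [smul_smul]
          refine hcone x (subset_closure hxΩ) (by linarith) (t * (τ / μ)) (by positivity) ?_
            (Metric.mem_ball_self (by positivity))
          exact (mul_le_of_le_one_left ht0.le ht1).trans htδ
      · rw [Metric.mem_ball]
        have h1 : dist (x + t • (τ / μ) • ν) x ≤ τ / μ := by
          rw [dist_self_add_left, norm_smul, norm_smul, hν, mul_one, Real.norm_of_nonneg ht0',
            Real.norm_of_nonneg ht0.le]
          exact mul_le_of_le_one_left ht0.le ht1
        have := dist_triangle (x + t • (τ / μ) • ν) x x₀
        linarith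
    · rintro x ⟨-, hx⟩
      rw [Metric.mem_ball] at hx ⊢
      rwa [hx₁, dist_add_right]
  have s2 : ∫⁻ x in Metric.ball x₁ (σ / μ), ‖u x‖ₑ ^ 2 ≤
      2 * (∫⁻ x in Metric.ball y (σ / μ), ‖u x‖ₑ ^ 2) + 2 * ENNReal.ofReal ((τ / μ) ^ 2) * I := by
    refine (lintegral_sq_le_shift hUm hAU β hu measurableSet_ball
      (measurableSet_ball (x := y) (ε := σ / μ)) (y - x₁) ?_ ?_).trans ?_
    · rintro x hx t ⟨ht0', ht1⟩
      refine hballU ?_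
      rw [Metric.mem_ball, dist_eq_norm] at hx ⊢
      have h1 : x + t • (y - x₁) - x₁ = (x - x₁) + t • (y - x₁) := by abel
      have h2 : ‖t • (y - x₁)‖ ≤ ‖y - x₁‖ := by
        rw [norm_smul, Real.norm_of_nonneg ht0']
        exact mul_le_of_le_one_left (norm_nonneg _) ht1
      rw [h1]
      refine (norm_add_le _ _).trans_lt ?_
      linarith
    · intro x hx
      rw [Metric.mem_ball, dist_eq_norm] at hx ⊢
      rwa [show x + (y - x₁) - y = x - x₁ by abel]
    · gcongr
      rw [← ofReal_norm, ENNReal.ofReal_pow ht0.le]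
      gcongr
      linarith
  have s3 : ∫⁻ x in Metric.ball y (σ / μ), ‖u x‖ₑ ^ 2 ≤
      ENNReal.ofReal (64 * σ ^ 2 / (σ ^ 2 * η) ^ 2 / μ ^ 2) * I := by
    have hsub : Metric.ball y (3 * (σ / μ)) ⊆ Metric.ball y (ρ / μ) := by
      refine Metric.ball_subset_ball ?_
      rw [← mul_div_assoc]; gcongr
    have hsub' : Metric.ball y (3 * (σ / μ)) ⊆ Metric.ball x₁ (θ * (τ / μ)) := by
      refine Metric.ball_subset_ball' ?_
      rw [dist_eq_norm]; linarith
    refine (lintegral_sq_le_of_field_large hΩ hA hB β hu (s := σ / μ) (b := η * μ ^ 2) hσμ0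
      (by positivity) p (hsub'.trans hcone₀) (hlow.imp (fun h z hz => h z (hsub hz))
        (fun h z hz => h z (hsub hz))) (fun z hz => ?_)).trans ?_
    · calc (σ / μ) ^ 2 * |(β • magField Ω A z) p| ≤ (σ / μ) ^ 2 * ((κ + 2) * μ ^ 2) := by
            gcongr; exact hup z (hsub hz)
        _ = σ * (σ * (κ + 2)) := by field_simp
        _ ≤ 1 := mul_le_one₀ hσ1 (by positivity) hσκ
    · have e2 : 64 * (σ / μ) ^ 2 / ((σ / μ) ^ 2 * (η * μ ^ 2)) ^ 2 =
          64 * σ ^ 2 / (σ ^ 2 * η) ^ 2 / μ ^ 2 := by field_simp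
      rw [e2]
      exact mul_le_mul_right (lintegral_mono_set (hsub'.trans hballU)) _
  have htwo : (2 : ℝ≥0∞) = ENNReal.ofReal 2 := by simp
  calc ∫⁻ x in Ω ∩ Metric.ball x₀ (σ / μ), ‖u x‖ₑ ^ 2
      ≤ 2 * (2 * (ENNReal.ofReal (64 * σ ^ 2 / (σ ^ 2 * η) ^ 2 / μ ^ 2) * I) +
          2 * ENNReal.ofReal ((τ / μ) ^ 2) * I) + 2 * ENNReal.ofReal ((τ / μ) ^ 2) * I := by
        refine s1.trans ?_
        gcongr
        refine s2.trans ?_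
        gcongr
    _ = (2 * (2 * ENNReal.ofReal (64 * σ ^ 2 / (σ ^ 2 * η) ^ 2 / μ ^ 2) +
          2 * ENNReal.ofReal ((τ / μ) ^ 2)) + 2 * ENNReal.ofReal ((τ / μ) ^ 2)) * I := by ring
    _ = ENNReal.ofReal (C / μ ^ 2) * I := by
        congr 1
        rw [htwo, ← ENNReal.ofReal_mul (by norm_num), ← ENNReal.ofReal_mul (by norm_num),
          ← ENNReal.ofReal_add (by positivity) (by positivity), ← ENNReal.ofReal_mul (by norm_num),
          ← ENNReal.ofReal_add (by positivity) (by positivity)]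
        congr 1
        rw [hC]; field_simp

/-- Local inequalities at the scale `1 / n` add up to a global one. -/
theorem lintegral_scale_sq_le_of_local {Ω : Set (E d)} (hΩ : IsOpen Ω) {δ θ : ℝ}
    (hU : UniformConeOn Ω (closure Ω) δ θ) {n : E d → ℝ} {c C₀ : ℝ} (hn : IsSlowScale Ω n c C₀)
    (hδn : ∀ x ∈ closure Ω, 1 ≤ δ * n x) {σ ρ C : ℝ} (hσ : 0 < σ) (hσ1 : σ ≤ 1) (hσc : σ ≤ c)
    (hρ : 0 < ρ) (hρc : ρ ≤ c) (hC : 0 < C) {f g : E d → ℝ≥0∞} (hf : Measurable f)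
    (hg : Measurable g)
    (hloc : ∀ x₀ ∈ Ω, ∫⁻ x in Ω ∩ Metric.ball x₀ (σ / n x₀), f x ≤
      ENNReal.ofReal (C / n x₀ ^ 2) * ∫⁻ x in Ω ∩ Metric.ball x₀ (ρ / n x₀), g x) :
    ∫⁻ x in Ω, ENNReal.ofReal (n x ^ 2) * f x ≤
      ENNReal.ofReal (C * (C₀ ^ 2 * ρ) ^ d / ((C₀⁻¹) ^ (d + 2) * (θ * σ / (2 * C₀)) ^ d)) *
        ∫⁻ x in Ω, g x := by
  have hC₀ : 0 < C₀ := zero_lt_one.trans_le hn.one_le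
  have hθ := hU.aperture_pos
  have hΩcl : Ω ⊆ closure Ω := subset_closure
  set N : E d → ℝ := Ω.indicator n with hN
  have hNm : Measurable N :=
    measurable_indicator_of_continuousOn (hn.continuousOn.mono hΩcl) hΩ.measurableSet
  have hNx : ∀ x ∈ Ω, N x = n x := fun x hx => indicator_of_mem hx n
  -- No covering is chosen: the local inequality at x₀ is multiplied by n(x₀)^{d+2}, integrated over
  -- x₀, and the order of integration is exchanged. The set D r describes the pairs (x₀, x) in Ω
  -- with x within r/n(x₀) of x₀.
  let D : ℝ → Set (E d × E d) := fun r => {q | (q.1 ∈ Ω ∧ q.2 ∈ Ω) ∧ dist q.2 q.1 * N q.1 < r}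
  have hDm : ∀ r, MeasurableSet (D r) := by
    intro r
    refine ((measurable_fst hΩ.measurableSet).inter (measurable_snd hΩ.measurableSet)).inter ?_
    exact measurableSet_lt ((measurable_snd.dist measurable_fst).mul (hNm.comp measurable_fst))
      measurable_const
  have hmem : ∀ r, ∀ x₀ ∈ Ω, ∀ x, (x₀, x) ∈ D r ↔ x ∈ Ω ∩ Metric.ball x₀ (r / n x₀) := by
    intro r x₀ hx₀ x
    have hpos := hn.pos x₀ (hΩcl hx₀)
    simp only [D, mem_ofPred_eq, mem_inter_iff, Metric.mem_ball, hNx x₀ hx₀, lt_div_iff₀ hpos, hx₀,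
      true_and]
  let W : ℝ → ℕ → (E d → ℝ≥0∞) → E d × E d → ℝ≥0∞ := fun r k h =>
    (D r).indicator fun q => ENNReal.ofReal (N q.1 ^ k) * h q.2
  have hWm : ∀ r k h, Measurable h → Measurable (W r k h) := fun r k h hh =>
    (((hNm.comp measurable_fst).pow_const k).ennreal_ofReal.mul
      (hh.comp measurable_snd)).indicator (hDm r)
  have hslice : ∀ r k h, ∀ x₀ ∈ Ω, ∫⁻ x, W r k h (x₀, x) =
      ENNReal.ofReal (n x₀ ^ k) * ∫⁻ x in Ω ∩ Metric.ball x₀ (r / n x₀), h x := by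
    intro r k h x₀ hx₀
    rw [← lintegral_indicator (hΩ.measurableSet.inter measurableSet_ball),
      ← lintegral_const_mul' _ _ ENNReal.ofReal_ne_top]
    refine lintegral_congr fun x => ?_
    by_cases hx : x ∈ Ω ∩ Metric.ball x₀ (r / n x₀)
    · simp only [W]
      rw [indicator_of_mem ((hmem r x₀ hx₀ x).2 hx), indicator_of_mem hx, hNx x₀ hx₀]
    · simp only [W]
      rw [indicator_of_notMem (fun h => hx ((hmem r x₀ hx₀ x).1 h)), indicator_of_notMem hx,
        mul_zero]
  have hslice0 : ∀ r k h, ∀ x₀ ∉ Ω, ∫⁻ x, W r k h (x₀, x) = 0 := by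
    intro r k h x₀ hx₀
    have : ∀ x, W r k h (x₀, x) = 0 := fun x => indicator_of_notMem (fun hh => hx₀ hh.1.1) _
    simp [this]
  have step1 : ∫⁻ x₀, ∫⁻ x, W σ (d + 2) f (x₀, x) ≤
      ENNReal.ofReal C * ∫⁻ x₀, ∫⁻ x, W ρ d g (x₀, x) := by
    rw [← lintegral_const_mul' _ _ ENNReal.ofReal_ne_top]
    refine lintegral_mono fun x₀ => ?_
    by_cases hx₀ : x₀ ∈ Ω
    · have hpos := hn.pos x₀ (hΩcl hx₀)
      rw [hslice _ _ _ x₀ hx₀, hslice _ _ _ x₀ hx₀]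
      refine (mul_le_mul_right (hloc x₀ hx₀) _).trans (le_of_eq ?_)
      rw [← mul_assoc, ← mul_assoc, ← ENNReal.ofReal_mul (by positivity),
        ← ENNReal.ofReal_mul hC.le]
      congr 2
      field_simp
      ring
    · simp only [hslice0 _ _ _ x₀ hx₀, mul_zero, le_refl]
  rw [lintegral_lintegral_swap (f := fun x₀ x => W σ (d + 2) f (x₀, x))
      (hWm σ (d + 2) f hf).aemeasurable,
    lintegral_lintegral_swap (f := fun x₀ x => W ρ d g (x₀, x)) (hWm ρ d g hg).aemeasurable] at step1
  set v₁ := volume (Metric.ball (0 : E d) 1) with hv₁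
  have hv0 : v₁ ≠ 0 := (Metric.measure_ball_pos volume _ one_pos).ne'
  have hvt : v₁ ≠ ⊤ := measure_ball_lt_top.ne
  set c₁ : ℝ := (C₀⁻¹) ^ (d + 2) * (θ * σ / (2 * C₀)) ^ d with hc₁
  have hc₁0 : 0 < c₁ := by positivity
  -- For fixed x, the points x₀ of Ω within σ/(C₀ n(x)) all see x, n(x₀) is comparable to n(x), and
  -- the cone property makes their volume at least of order n(x)^{-d}. This cancels n^d from the
  -- weight and leaves n².
  have lower : ENNReal.ofReal c₁ * v₁ * ∫⁻ x in Ω, ENNReal.ofReal (n x ^ 2) * f x ≤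
      ∫⁻ x, ∫⁻ x₀, W σ (d + 2) f (x₀, x) := by
    rw [← lintegral_const_mul' _ _ (by finiteness), ← lintegral_indicator hΩ.measurableSet]
    refine lintegral_mono fun x => ?_
    by_cases hx : x ∈ Ω
    · rw [indicator_of_mem hx]
      have hpos := hn.pos x (hΩcl hx)
      have hr : σ / (C₀ * n x) ≤ δ := by
        rw [div_le_iff₀ (by positivity)]
        have h1 := hδn x (hΩcl hx)
        have h2 := hn.one_le
        nlinarith
      have hvol := hU.volume_inter_ball_ge (hΩcl hx) (r := σ / (C₀ * n x)) (by positivity) hr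
      have hle : ∀ x₀ ∈ Ω ∩ Metric.ball x (σ / (C₀ * n x)),
          ENNReal.ofReal ((n x / C₀) ^ (d + 2)) * f x ≤ W σ (d + 2) f (x₀, x) := by
        rintro x₀ ⟨hx₀, hx₀b⟩
        rw [Metric.mem_ball, lt_div_iff₀ (by positivity)] at hx₀b
        have hdist : dist x x₀ * n x ≤ c := by
          rw [dist_comm]
          refine le_trans ?_ ((hx₀b.le).trans hσc)
          gcongr
          exact le_mul_of_one_le_left hpos.le hn.one_le
        have h1 := hn.le_mul x (hΩcl hx) x₀ (hΩcl hx₀) hdist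
        have h2 := hn.le_mul' x (hΩcl hx) x₀ (hΩcl hx₀) hdist
        have hmemD : (x₀, x) ∈ D σ := by
          refine ⟨⟨hx₀, hx⟩, ?_⟩
          simp only [hNx x₀ hx₀]
          rw [dist_comm]
          exact (mul_le_mul_of_nonneg_left h1 dist_nonneg).trans_lt hx₀b
        simp only [W]
        rw [indicator_of_mem hmemD, hNx x₀ hx₀]
        gcongr
        rwa [div_le_iff₀ hC₀, mul_comm]
      calc ENNReal.ofReal c₁ * v₁ * (ENNReal.ofReal (n x ^ 2) * f x)
          = ENNReal.ofReal ((n x / C₀) ^ (d + 2)) * f x *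
              (ENNReal.ofReal ((θ / 2 * (σ / (C₀ * n x))) ^ d) * v₁) := by
            have e1 : ENNReal.ofReal c₁ * ENNReal.ofReal (n x ^ 2) =
                ENNReal.ofReal ((n x / C₀) ^ (d + 2)) *
                  ENNReal.ofReal ((θ / 2 * (σ / (C₀ * n x))) ^ d) := by
              rw [← ENNReal.ofReal_mul (by positivity), ← ENNReal.ofReal_mul (by positivity)]
              congr 1
              have e2 : θ / 2 * (σ / (C₀ * n x)) = θ * σ / (2 * C₀) / n x := by field_simp
              rw [hc₁, e2, div_eq_mul_inv (n x), mul_pow (n x), div_pow _ (n x), pow_add (n x)]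
              field_simp
            calc _ = (ENNReal.ofReal c₁ * ENNReal.ofReal (n x ^ 2)) * (v₁ * f x) := by ring
              _ = _ := by rw [e1]; ring
        _ ≤ ENNReal.ofReal ((n x / C₀) ^ (d + 2)) * f x *
              volume (Ω ∩ Metric.ball x (σ / (C₀ * n x))) := by gcongr
        _ = ∫⁻ _ in Ω ∩ Metric.ball x (σ / (C₀ * n x)),
              ENNReal.ofReal ((n x / C₀) ^ (d + 2)) * f x := by rw [setLIntegral_const]
        _ ≤ ∫⁻ x₀ in Ω ∩ Metric.ball x (σ / (C₀ * n x)), W σ (d + 2) f (x₀, x) :=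
            setLIntegral_mono' (hΩ.measurableSet.inter measurableSet_ball) hle
        _ ≤ _ := setLIntegral_le_lintegral _ _
    · rw [indicator_of_notMem hx]; exact zero_le
  -- Conversely all x₀ that see x lie in a ball of radius ρC₀/n(x), whose volume cancels the weight
  -- n^d.
  have upper : ∫⁻ x, ∫⁻ x₀, W ρ d g (x₀, x) ≤
      ENNReal.ofReal ((C₀ ^ 2 * ρ) ^ d) * v₁ * ∫⁻ x in Ω, g x := by
    rw [← lintegral_const_mul' _ _ (by finiteness), ← lintegral_indicator hΩ.measurableSet]
    refine lintegral_mono fun x => ?_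
    by_cases hx : x ∈ Ω
    · rw [indicator_of_mem hx]
      have hpos := hn.pos x (hΩcl hx)
      have hle : ∀ x₀, W ρ d g (x₀, x) ≤ (Metric.ball x (ρ * C₀ / n x)).indicator
          (fun _ => ENNReal.ofReal ((C₀ * n x) ^ d) * g x) x₀ := by
        intro x₀
        by_cases hD : (x₀, x) ∈ D ρ
        · have hx₀ : x₀ ∈ Ω := hD.1.1
          have hlt : dist x x₀ * N x₀ < ρ := hD.2
          rw [hNx x₀ hx₀] at hlt
          have hpos₀ := hn.pos x₀ (hΩcl hx₀)
          have hdist : dist x₀ x * n x₀ ≤ c := by rw [dist_comm]; exact hlt.le.trans hρc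
          have h1 := hn.le_mul x₀ (hΩcl hx₀) x (hΩcl hx) hdist
          have h2 := hn.le_mul' x₀ (hΩcl hx₀) x (hΩcl hx) hdist
          have hb : x₀ ∈ Metric.ball x (ρ * C₀ / n x) := by
            rw [Metric.mem_ball, lt_div_iff₀ hpos, dist_comm]
            calc dist x x₀ * n x ≤ dist x x₀ * (C₀ * n x₀) := by gcongr
              _ = dist x x₀ * n x₀ * C₀ := by ring
              _ < ρ * C₀ := by gcongr
          simp only [W]
          rw [indicator_of_mem hD, indicator_of_mem hb, hNx x₀ hx₀]
          gcongr
        · simp only [W]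
          rw [indicator_of_notMem hD]; exact zero_le
      refine (lintegral_mono hle).trans ?_
      rw [lintegral_indicator measurableSet_ball, setLIntegral_const,
        Measure.addHaar_ball_of_pos _ x (by positivity), finrank_euclideanSpace, Fintype.card_fin]
      refine le_of_eq ?_
      have e1 : ENNReal.ofReal ((C₀ ^ 2 * ρ) ^ d) =
          ENNReal.ofReal ((C₀ * n x) ^ d) * ENNReal.ofReal ((ρ * C₀ / n x) ^ d) := by
        rw [← ENNReal.ofReal_mul (by positivity), ← mul_pow]
        congr 2
        field_simp
      rw [e1]
      ring
    · rw [indicator_of_notMem hx]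
      have : ∀ x₀, W ρ d g (x₀, x) = 0 := fun x₀ => indicator_of_notMem (fun hh => hx hh.1.2) _
      simp [this]
  have hfin := lower.trans (step1.trans (mul_le_mul_right upper _))
  have hcanc : ENNReal.ofReal c₁ * (∫⁻ x in Ω, ENNReal.ofReal (n x ^ 2) * f x) ≤
      ENNReal.ofReal C * (ENNReal.ofReal ((C₀ ^ 2 * ρ) ^ d) * ∫⁻ x in Ω, g x) := by
    refine (ENNReal.mul_le_mul_iff_right hv0 hvt).1 ?_
    calc _ = ENNReal.ofReal c₁ * v₁ * ∫⁻ x in Ω, ENNReal.ofReal (n x ^ 2) * f x := by ring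
      _ ≤ _ := hfin
      _ = _ := by ring
  calc ∫⁻ x in Ω, ENNReal.ofReal (n x ^ 2) * f x
      = ENNReal.ofReal (c₁⁻¹) * (ENNReal.ofReal c₁ *
          ∫⁻ x in Ω, ENNReal.ofReal (n x ^ 2) * f x) := by
        rw [← mul_assoc, ← ENNReal.ofReal_mul (by positivity), inv_mul_cancel₀ hc₁0.ne',
          ENNReal.ofReal_one, one_mul]
    _ ≤ ENNReal.ofReal (c₁⁻¹) * (ENNReal.ofReal C * (ENNReal.ofReal ((C₀ ^ 2 * ρ) ^ d) *
          ∫⁻ x in Ω, g x)) := by gcongr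
    _ = _ := by
        rw [← mul_assoc, ← mul_assoc, ← ENNReal.ofReal_mul (by positivity),
          ← ENNReal.ofReal_mul (by positivity)]
        congr 2
        ring

end

section

variable {d : ℕ}

/-! ### The trace inequality -/

lemma lintegral_comp_mul_left_real {a : ℝ} (ha : 0 < a) (Q : ℝ → ℝ≥0∞) :
    ENNReal.ofReal a * ∫⁻ r, Q (a * r) = ∫⁻ r, Q r := by
  have h := Real.smul_map_volume_mul_left ha.ne'
  rw [abs_of_pos ha] at h
  conv_rhs => rw [← h]
  rw [lintegral_smul_measure, smul_eq_mul]
  congr 1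
  exact (lintegral_map_equiv Q (Homeomorph.mulLeft₀ a ha.ne').toMeasurableEquiv).symm

lemma lintegral_Icc_comp_mul_left {a : ℝ} (ha : 0 < a) (Q : ℝ → ℝ≥0∞) :
    ENNReal.ofReal a * ∫⁻ r in Icc (0 : ℝ) 1, Q (a * r) = ∫⁻ r in Icc (0 : ℝ) a, Q r := by
  rw [← lintegral_indicator measurableSet_Icc, ← lintegral_indicator measurableSet_Icc,
    ← lintegral_comp_mul_left_real ha ((Icc 0 a).indicator Q)]
  congr 1
  refine lintegral_congr fun r => ?_
  by_cases hr : r ∈ Icc (0 : ℝ) 1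
  · rw [indicator_of_mem hr, indicator_of_mem]
    exact ⟨mul_nonneg ha.le hr.1, mul_le_of_le_one_right ha.le hr.2⟩
  · rw [indicator_of_notMem hr, indicator_of_notMem]
    rintro ⟨h0, h1⟩
    exact hr ⟨nonneg_of_mul_nonneg_right h0 ha, by nlinarith⟩

/-- Integration over `ℝ^d` along lines in a unit direction. -/
lemma lintegral_eq_lintegral_orthogonal {ν : E d} (hν : ‖ν‖ = 1) {F : E d → ℝ≥0∞}
    (hF : Measurable F) :
    ∫⁻ x, F x = ∫⁻ w : (ℝ ∙ ν)ᗮ, ∫⁻ t : ℝ, F ((w : E d) + t • ν) := by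
  have hmp := (ℝ ∙ ν).measurePreserving_measurableEquivProd (0 : E d)
  rw [InnerProductSpace.euclideanHausdorffMeasure_eq_volume] at hmp
  have h1 : ∫⁻ x, F x = ∫⁻ q : (ℝ ∙ ν) × (ℝ ∙ ν)ᗮ, F ((q.1 : E d) + q.2) := by
    rw [← hmp.symm.lintegral_comp_emb (MeasurableEquiv.measurableEmbedding _)]
    simp
  have hm : Measurable fun q : (ℝ ∙ ν) × (ℝ ∙ ν)ᗮ => F ((q.1 : E d) + q.2) :=
    hF.comp (by fun_prop)
  rw [h1, Measure.volume_eq_prod, lintegral_prod_symm _ hm.aemeasurable]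
  refine lintegral_congr fun w => ?_
  have h2 := (LinearIsometryEquiv.toSpanUnitSingleton (𝕜 := ℝ) ν hν).measurePreserving
  rw [← h2.lintegral_comp (f := fun l : (ℝ ∙ ν) => F ((l : E d) + w)) (hF.comp (by fun_prop))]
  refine lintegral_congr fun t => ?_
  simp [add_comm]

lemma finrank_orthogonal_span_unit {ν : E d} (hν : ‖ν‖ = 1) :
    Module.finrank ℝ (ℝ ∙ ν)ᗮ = d - 1 := by
  have h := (ℝ ∙ ν).finrank_add_finrank_orthogonal
  rw [finrank_span_singleton (by rintro rfl; simp at hν), finrank_euclideanSpace,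
    Fintype.card_fin] at h
  omega

lemma euclideanHausdorffMeasure_image_le {X Y : Type*} [EMetricSpace X] [MeasurableSpace X]
    [BorelSpace X] [EMetricSpace Y] [MeasurableSpace Y] [BorelSpace Y] {K : ℝ≥0} {f : X → Y}
    (hf : LipschitzWith K f) (k : ℕ) (s : Set X) :
    (μHE[k] : Measure Y) (f '' s) ≤ (K : ℝ≥0∞) ^ k * (μHE[k] : Measure X) s := by
  have h := hf.hausdorffMeasure_image_le (d := k) (by positivity) s
  rw [Measure.euclideanHausdorffMeasure_def, Measure.euclideanHausdorffMeasure_def,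
    Measure.smul_apply, Measure.smul_apply]
  rw [ENNReal.rpow_natCast] at h
  simp only [ENNReal.smul_def, smul_eq_mul]
  calc _ ≤ _ * ((K : ℝ≥0∞) ^ k * μH[k] s) := by gcongr
    _ = _ := by ring

/-- The map whose image is the graph of `h` in the direction `ν`. -/
def graphMap {ν : E d} (h : (ℝ ∙ ν)ᗮ → ℝ) (w : (ℝ ∙ ν)ᗮ) : E d := (w : E d) + h w • ν

lemma lipschitzWith_graphMap {ν : E d} (hν : ‖ν‖ = 1) {L : ℝ≥0} {h : (ℝ ∙ ν)ᗮ → ℝ}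
    (hh : LipschitzWith L h) : LipschitzWith (1 + L) (graphMap h) := by
  refine LipschitzWith.of_dist_le_mul fun w w' => ?_
  have e1 : graphMap h w - graphMap h w' = ((w - w' : (ℝ ∙ ν)ᗮ) : E d) + (h w - h w') • ν := by
    simp only [graphMap, Submodule.coe_sub]; module
  have h1 := hh.dist_le_mul w w'
  rw [Real.dist_eq] at h1
  rw [dist_eq_norm, e1]
  refine (norm_add_le _ _).trans ?_
  rw [norm_smul, hν, mul_one, Real.norm_eq_abs, ← Submodule.coe_norm, ← dist_eq_norm]
  push_cast
  linarith

lemma eq_graphMap_of_mem_frontier {Ω : Set (E d)} (hΩ : IsOpen Ω) {x₀ ν : E d} (hν : ‖ν‖ = 1)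
    {r : ℝ} {h : (ℝ ∙ ν)ᗮ → ℝ} (hh : Continuous h)
    (hgr : Ω ∩ Metric.ball x₀ r =
        {y | h ((ℝ ∙ ν)ᗮ.orthogonalProjectionOnto y) < ⟪ν, y⟫_ℝ} ∩ Metric.ball x₀ r)
    {x : E d} (hx : x ∈ frontier Ω) (hxr : x ∈ Metric.ball x₀ r) :
    graphMap h ((ℝ ∙ ν)ᗮ.orthogonalProjectionOnto x) = x := by
  rw [hΩ.frontier_eq] at hx
  have h1 := graph_le_of_mem_closure hh hgr hx.1 hxr
  have h2 : ¬ h ((ℝ ∙ ν)ᗮ.orthogonalProjectionOnto x) < ⟪ν, x⟫_ℝ := fun hlt =>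
    hx.2 (show x ∈ Ω ∩ Metric.ball x₀ r by rw [hgr]; exact ⟨hlt, hxr⟩).1
  have h3 : h ((ℝ ∙ ν)ᗮ.orthogonalProjectionOnto x) = ⟪ν, x⟫_ℝ := le_antisymm h1 (not_lt.1 h2)
  rw [graphMap, h3]
  have h4 := (ℝ ∙ ν).starProjection_add_starProjection_orthogonal x
  rw [Submodule.starProjection_unit_singleton ℝ hν] at h4
  rw [add_comm] at h4
  exact h4

/-- Near a boundary point, integrating first along inward segments of fixed direction and then over
the boundary is controlled by integrating over the domain. -/
theorem exists_boundary_layer {Ω : Set (E d)} (hΩ : IsBoundedLipschitzDomain Ω) {z : E d}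
    (hz : z ∈ frontier Ω) :
    ∃ (δ : ℝ) (C : ℝ≥0) (ν : E d), 0 < δ ∧ ‖ν‖ = 1 ∧
      (∀ x ∈ frontier Ω, x ∈ Metric.ball z δ → ∀ t, 0 < t → t ≤ δ → x + t • ν ∈ Ω) ∧
      ∀ F : E d → ℝ≥0∞, Measurable F →
        ∫⁻ x in frontier Ω ∩ Metric.ball z δ, ∫⁻ t in Ioc 0 δ, F (x + t • ν) ∂volume ∂μHE[d - 1] ≤
          C * ∫⁻ x in Ω, F x := by
  obtain ⟨r, hr, ν, hν, L, h, hh, hgr⟩ := hΩ.lipschitz_boundary z hz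
  have hin : ∀ x ∈ frontier Ω, x ∈ Metric.ball z (r / 2) → ∀ t, 0 < t → t ≤ r / 2 →
      x + t • ν ∈ Ω := by
    intro x hx hxz t ht htr
    have hxr : x ∈ Metric.ball z r := Metric.ball_subset_ball (by linarith) hxz
    have h1 := cone_above_graph hν hh
      (graph_le_of_mem_closure hh.continuous hgr (frontier_subset_closure hx) hxr) ht
      (Metric.mem_ball_self (by positivity))
    have h2 : x + t • ν ∈ Metric.ball z r := by
      rw [Metric.mem_ball] at hxz ⊢
      have h3 : dist (x + t • ν) x = t := by
        rw [dist_self_add_left, norm_smul, hν, mul_one, Real.norm_of_nonneg ht.le]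
      have := dist_triangle (x + t • ν) x z
      linarith
    exact (show x + t • ν ∈ Ω ∩ Metric.ball z r by rw [hgr]; exact ⟨h1, h2⟩).1
  refine ⟨r / 2, (1 + L) ^ (d - 1), ν, by positivity, hν, hin, fun F hF => ?_⟩
  set S := frontier Ω ∩ Metric.ball z (r / 2) with hS
  have hSm : MeasurableSet S := isClosed_frontier.measurableSet.inter measurableSet_ball
  have hg := lipschitzWith_graphMap hν hh
  have hgm : Measurable (graphMap h) := hg.continuous.measurable
  have hvol : (μHE[d - 1] : Measure (ℝ ∙ ν)ᗮ) = volume := by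
    rw [← finrank_orthogonal_span_unit hν]
    exact InnerProductSpace.euclideanHausdorffMeasure_eq_volume
  -- The boundary piece lies in the image of a (1+L)-Lipschitz graph map over a hyperplane, on which
  -- the normalised Hausdorff measure is Lebesgue measure. Only this upper bound on surface measure
  -- is needed.
  have hmeas : (μHE[d - 1] : Measure (E d)).restrict S ≤
      ((1 + L : ℝ≥0) ^ (d - 1) : ℝ≥0) • (Measure.map (graphMap h) volume).restrict S := by
    refine Measure.le_iff.2 fun T hT => ?_
    rw [Measure.restrict_apply hT, Measure.smul_apply, Measure.restrict_apply hT,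
      Measure.map_apply hgm (hT.inter hSm)]
    have hsub : T ∩ S ⊆ graphMap h '' (graphMap h ⁻¹' (T ∩ S)) := by
      intro x hx
      have := eq_graphMap_of_mem_frontier hΩ.isOpen hν hh.continuous hgr hx.2.1
        (Metric.ball_subset_ball (by linarith) hx.2.2)
      exact ⟨_, by rw [mem_preimage, this]; exact hx, this⟩
    refine (measure_mono hsub).trans ((euclideanHausdorffMeasure_image_le hg _ _).trans ?_)
    rw [hvol, ENNReal.smul_def]
    simp
  set F₁ : E d → ℝ≥0∞ := Ω.indicator F with hF₁
  have hF₁m : Measurable F₁ := hF.indicator hΩ.isOpen.measurableSet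
  have hinner : ∀ x ∈ S, ∫⁻ t in Ioc 0 (r / 2), F (x + t • ν) ≤ ∫⁻ t : ℝ, F₁ (x + t • ν) := by
    intro x hx
    refine le_trans (le_of_eq ?_) (setLIntegral_le_lintegral (Ioc 0 (r / 2)) _)
    refine setLIntegral_congr_fun measurableSet_Ioc fun t ht => ?_
    simp only [hF₁]
    rw [indicator_of_mem (hin x hx.1 hx.2 t ht.1 ht.2)]
  have hGm : Measurable fun x : E d => ∫⁻ t : ℝ, F₁ (x + t • ν) :=
    Measurable.lintegral_prod_right' (f := fun q : E d × ℝ => F₁ (q.1 + q.2 • ν))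
      (hF₁m.comp (by fun_prop))
  calc ∫⁻ x in S, ∫⁻ t in Ioc 0 (r / 2), F (x + t • ν) ∂volume ∂μHE[d - 1]
      ≤ ∫⁻ x in S, ∫⁻ t : ℝ, F₁ (x + t • ν) ∂volume ∂μHE[d - 1] :=
        setLIntegral_mono' hSm hinner
    _ ≤ ∫⁻ x, (∫⁻ t : ℝ, F₁ (x + t • ν))
          ∂(((1 + L : ℝ≥0) ^ (d - 1) : ℝ≥0) • (Measure.map (graphMap h) volume).restrict S) :=
        lintegral_mono' hmeas le_rfl
    _ ≤ ((1 + L) ^ (d - 1) : ℝ≥0) * ∫⁻ w : (ℝ ∙ ν)ᗮ, ∫⁻ t : ℝ, F₁ (graphMap h w + t • ν) := by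
        rw [lintegral_smul_measure, ENNReal.smul_def, smul_eq_mul]
        refine mul_le_mul_right ?_ _
        refine (setLIntegral_le_lintegral _ _).trans ?_
        rw [lintegral_map hGm hgm]
    _ = ((1 + L) ^ (d - 1) : ℝ≥0) * ∫⁻ w : (ℝ ∙ ν)ᗮ, ∫⁻ t : ℝ, F₁ ((w : E d) + t • ν) := by
        congr 1
        refine lintegral_congr fun w => ?_
        -- The graph height h w is a translation of the line through w, so it disappears from the
        -- integral over the whole line.
        rw [← lintegral_add_left_eq_self (fun t : ℝ => F₁ ((w : E d) + t • ν)) (h w)]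
        refine lintegral_congr fun t => ?_
        rw [graphMap, add_smul, add_assoc]
    _ = ((1 + L) ^ (d - 1) : ℝ≥0) * ∫⁻ x in Ω, F x := by
        rw [← lintegral_eq_lintegral_orthogonal hν hF₁m, hF₁,
          lintegral_indicator hΩ.isOpen.measurableSet]

end

/-! ### The trace inequality at the scale of the field -/

section

variable {d : ℕ}

/-- The value of `u` at the end of a segment is controlled by its values and its magnetic gradient
along the segment. -/
lemma enorm_sq_le_lintegral_segment {A : E d → E d} {U : Set (E d)} (hA : ContinuousOn A U) (β : ℝ)
    {u : E d → ℂ} (hu : ContDiff ℝ 1 u) {x ν : E d} (hν : ‖ν‖ = 1) {s : ℝ} (hs : 0 < s)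
    (hx : ∀ t ∈ Icc (0 : ℝ) s, x + t • ν ∈ U) :
    ENNReal.ofReal s * ‖u x‖ₑ ^ 2 ≤ 2 * (∫⁻ t in Ioc 0 s, ‖u (x + t • ν)‖ₑ ^ 2) +
      2 * ENNReal.ofReal (s ^ 2) *
        ∫⁻ t in Ioc 0 s, ‖magGrad A β u (grad u) (x + t • ν)‖ₑ ^ 2 := by
  set I := ∫⁻ t in Ioc 0 s, ‖magGrad A β u (grad u) (x + t • ν)‖ₑ ^ 2 with hI
  -- Transport from x to x + tν bounds |u(x)|² for each t; averaging over t in (0, s] then trades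
  -- the unknown endpoint for an integral.
  have hpt : ∀ t ∈ Ioc 0 s, ‖u x‖ₑ ^ 2 ≤ 2 * ‖u (x + t • ν)‖ₑ ^ 2 + 2 * ENNReal.ofReal s * I := by
    rintro t ⟨ht0, hts⟩
    have h2 := enorm_transport_sub_le hA β hu (x := x) (h := t • ν) (fun r hr => by
      rw [smul_smul]
      exact hx _ ⟨mul_nonneg hr.1 ht0.le, (mul_le_of_le_one_left ht0.le hr.2).trans hts⟩)
    set c := Complex.exp (Complex.I * phase A β x (t • ν)) with hc
    have hcn : ‖c‖ₑ = 1 := by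
      rw [← ofReal_norm, hc, mul_comm, Complex.norm_exp_ofReal_mul_I]; simp
    have h3 : ‖u x‖ₑ ≤ ‖u (x + t • ν)‖ₑ + ‖c * u (x + t • ν) - u x‖ₑ := by
      calc ‖u x‖ₑ = ‖c * u (x + t • ν) - (c * u (x + t • ν) - u x)‖ₑ := by congr 1; ring
        _ ≤ ‖c * u (x + t • ν)‖ₑ + ‖c * u (x + t • ν) - u x‖ₑ := enorm_sub_le
        _ = _ := by rw [enorm_mul, hcn, one_mul]
    have h4 : ‖t • ν‖ₑ ^ 2 * (∫⁻ r in Icc (0 : ℝ) 1,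
        ‖magGrad A β u (grad u) (x + r • t • ν)‖ₑ ^ 2) ≤ ENNReal.ofReal s * I := by
      have e1 : ‖t • ν‖ₑ = ENNReal.ofReal t := by
        rw [← ofReal_norm, norm_smul, hν, mul_one, Real.norm_of_nonneg ht0.le]
      have e2 : ∀ r : ℝ, ‖magGrad A β u (grad u) (x + r • t • ν)‖ₑ ^ 2 =
          (fun q : ℝ => ‖magGrad A β u (grad u) (x + q • ν)‖ₑ ^ 2) (t * r) := fun r => by
        simp only [smul_smul, mul_comm r t]
      rw [e1]
      simp only [e2]
      change _ * (∫⁻ r in Icc (0 : ℝ) 1,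
        (fun q : ℝ => ‖magGrad A β u (grad u) (x + q • ν)‖ₑ ^ 2) (t * r)) ≤ _
      rw [pow_two, mul_assoc, lintegral_Icc_comp_mul_left ht0
        (fun q : ℝ => ‖magGrad A β u (grad u) (x + q • ν)‖ₑ ^ 2)]
      refine mul_le_mul' (ENNReal.ofReal_le_ofReal hts) ?_
      rw [← setLIntegral_congr (Ioc_ae_eq_Icc (a := (0 : ℝ)) (b := t))]
      exact lintegral_mono_set (Ioc_subset_Ioc_right hts)
    calc ‖u x‖ₑ ^ 2 ≤ (‖u (x + t • ν)‖ₑ + ‖c * u (x + t • ν) - u x‖ₑ) ^ 2 := by gcongr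
      _ ≤ _ := ennreal_add_sq_le _ _
      _ ≤ 2 * ‖u (x + t • ν)‖ₑ ^ 2 + 2 * (ENNReal.ofReal s * I) := by
        gcongr
        exact h2.trans h4
      _ = _ := by ring
  have hum : Measurable fun t : ℝ => 2 * ‖u (x + t • ν)‖ₑ ^ 2 :=
    ((hu.continuous.measurable.comp (by fun_prop)).enorm.pow_const 2).const_mul 2
  calc ENNReal.ofReal s * ‖u x‖ₑ ^ 2 = ∫⁻ _ in Ioc 0 s, ‖u x‖ₑ ^ 2 := by
        rw [setLIntegral_const, Real.volume_Ioc, sub_zero, mul_comm]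
    _ ≤ ∫⁻ t in Ioc 0 s, 2 * ‖u (x + t • ν)‖ₑ ^ 2 + 2 * ENNReal.ofReal s * I :=
        setLIntegral_mono' measurableSet_Ioc hpt
    _ = 2 * (∫⁻ t in Ioc 0 s, ‖u (x + t • ν)‖ₑ ^ 2) + 2 * ENNReal.ofReal (s ^ 2) * I := by
        rw [lintegral_add_left hum, lintegral_const_mul' _ _ (by finiteness), setLIntegral_const,
          Real.volume_Ioc, sub_zero, pow_two, ENNReal.ofReal_mul hs.le]
        ring

/-- The density of the energy at the scale `n`. -/
def energyDensity (A : E d → E d) (β : ℝ) (n : E d → ℝ) (u : E d → ℂ) (x : E d) : ℝ≥0∞ :=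
  ‖magGrad A β u (grad u) x‖ₑ ^ 2 + ENNReal.ofReal (n x ^ 2) * ‖u x‖ₑ ^ 2

lemma continuousOn_energyDensity {A : E d → E d} {U : Set (E d)} (hA : ContinuousOn A U) (β : ℝ)
    {n : E d → ℝ} (hn : ContinuousOn n U) {u : E d → ℂ} (hu : ContDiff ℝ 1 u) :
    ContinuousOn (energyDensity A β n u) U := by
  change ContinuousOn (fun x => ‖magGrad A β u (grad u) x‖ₑ ^ 2 +
    ENNReal.ofReal (n x ^ 2) * ‖u x‖ₑ ^ 2) U
  refine ContinuousOn.add (f := fun x => ‖magGrad A β u (grad u) x‖ₑ ^ 2) ?_ ?_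
  · exact (ENNReal.continuous_pow 2).comp_continuousOn
      (continuousOn_magGrad hA β hu).enorm
  · have h1 : ContinuousOn (fun x => n x ^ 2 * ‖u x‖ ^ 2) U :=
      (hn.pow 2).mul (hu.continuous.norm.pow 2).continuousOn
    refine (ENNReal.continuous_ofReal.comp_continuousOn h1).congr fun x _ => ?_
    simp only [Function.comp_apply]
    rw [ENNReal.ofReal_mul (by positivity), ENNReal.ofReal_pow (norm_nonneg _), ofReal_norm]

/-- The segment estimate at length s = c/n(x), multiplied by n(x)²/c: on such a segment n is
comparable to n(x). The result is stated on the longer interval (0, δ], whose length does not depend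
on x, so that `exists_boundary_layer` can be applied. -/
lemma trace_pointwise {Ω : Set (E d)} {n : E d → ℝ} {c C₀ : ℝ}
    (hn : IsSlowScale Ω n c C₀) {A : E d → E d} (hA : ContinuousOn A (closure Ω)) (β : ℝ)
    {u : E d → ℂ} (hu : ContDiff ℝ 1 u) {x ν : E d} (hν : ‖ν‖ = 1) (hx : x ∈ closure Ω)
    {δ : ℝ} (hδ : c ≤ δ * n x) (hin : ∀ t, 0 < t → t ≤ δ → x + t • ν ∈ Ω) :
    ENNReal.ofReal (n x) * ‖u x‖ₑ ^ 2 ≤ ENNReal.ofReal (2 * C₀ ^ 2 / c + 2 * c) *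
      ∫⁻ t in Ioc 0 δ, Ω.indicator (energyDensity A β n u) (x + t • ν) := by
  have hpos := hn.pos x hx
  have hc := hn.radius_pos
  have hC₀ : 0 < C₀ := zero_lt_one.trans_le hn.one_le
  set s := c / n x with hs
  have hs0 : 0 < s := by positivity
  have hsδ : s ≤ δ := by rw [hs, div_le_iff₀ hpos]; exact hδ
  have hinΩ : ∀ t ∈ Ioc 0 s, x + t • ν ∈ Ω := fun t ht => hin t ht.1 (ht.2.trans hsδ)
  have hseg : ∀ t ∈ Icc (0 : ℝ) s, x + t • ν ∈ closure Ω := by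
    rintro t ⟨ht0, hts⟩
    rcases ht0.eq_or_lt with rfl | h
    · simpa using hx
    · exact subset_closure (hinΩ t ⟨h, hts⟩)
  have h1 := enorm_sq_le_lintegral_segment hA β hu hν hs0 hseg
  have hslow : ∀ t ∈ Ioc 0 s, n x ^ 2 ≤ C₀ ^ 2 * n (x + t • ν) ^ 2 := by
    intro t ht
    have h2 := hn.le_mul' x hx (x + t • ν) (subset_closure (hinΩ t ht)) (by
      rw [dist_self_add_right, norm_smul, hν, mul_one, Real.norm_of_nonneg ht.1.le]
      calc t * n x ≤ s * n x := by gcongr; exact ht.2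
        _ = c := by rw [hs]; field_simp)
    rw [← mul_pow]
    gcongr
  set J := ∫⁻ t in Ioc 0 s, Ω.indicator (energyDensity A β n u) (x + t • ν) with hJ
  have hJδ : J ≤ ∫⁻ t in Ioc 0 δ, Ω.indicator (energyDensity A β n u) (x + t • ν) :=
    lintegral_mono_set (Ioc_subset_Ioc_right hsδ)
  have hP : ∫⁻ t in Ioc 0 s, ‖magGrad A β u (grad u) (x + t • ν)‖ₑ ^ 2 ≤ J := by
    refine setLIntegral_mono' measurableSet_Ioc fun t ht => ?_
    rw [indicator_of_mem (hinΩ t ht)]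
    exact le_self_add
  have hu' : ENNReal.ofReal (n x ^ 2) * (∫⁻ t in Ioc 0 s, ‖u (x + t • ν)‖ₑ ^ 2) ≤
      ENNReal.ofReal (C₀ ^ 2) * J := by
    rw [← lintegral_const_mul' _ _ (by finiteness), ← lintegral_const_mul' _ _ (by finiteness)]
    refine setLIntegral_mono' measurableSet_Ioc fun t ht => ?_
    rw [indicator_of_mem (hinΩ t ht)]
    calc ENNReal.ofReal (n x ^ 2) * ‖u (x + t • ν)‖ₑ ^ 2
        ≤ ENNReal.ofReal (C₀ ^ 2 * n (x + t • ν) ^ 2) * ‖u (x + t • ν)‖ₑ ^ 2 := by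
          gcongr; exact hslow t ht
      _ = ENNReal.ofReal (C₀ ^ 2) *
          (ENNReal.ofReal (n (x + t • ν) ^ 2) * ‖u (x + t • ν)‖ₑ ^ 2) := by
          rw [ENNReal.ofReal_mul (by positivity), mul_assoc]
      _ ≤ _ := by
          gcongr
          exact le_add_self
  have htwo : (2 : ℝ≥0∞) = ENNReal.ofReal 2 := by simp
  have key : ENNReal.ofReal (n x) * ‖u x‖ₑ ^ 2 ≤ ENNReal.ofReal (2 * C₀ ^ 2 / c + 2 * c) * J := by
    calc ENNReal.ofReal (n x) * ‖u x‖ₑ ^ 2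
        = ENNReal.ofReal (n x ^ 2 / c) * (ENNReal.ofReal s * ‖u x‖ₑ ^ 2) := by
          rw [← mul_assoc, ← ENNReal.ofReal_mul (by positivity)]
          congr 2
          rw [hs]; field_simp
      _ ≤ ENNReal.ofReal (n x ^ 2 / c) * (2 * (∫⁻ t in Ioc 0 s, ‖u (x + t • ν)‖ₑ ^ 2) +
            2 * ENNReal.ofReal (s ^ 2) * J) := by
          gcongr
          refine h1.trans ?_
          gcongr
      _ = ENNReal.ofReal (2 / c) *
            (ENNReal.ofReal (n x ^ 2) * (∫⁻ t in Ioc 0 s, ‖u (x + t • ν)‖ₑ ^ 2)) +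
            ENNReal.ofReal (2 * c) * J := by
          have e1 : ENNReal.ofReal (n x ^ 2 / c) * 2 =
              ENNReal.ofReal (2 / c) * ENNReal.ofReal (n x ^ 2) := by
            rw [htwo, ← ENNReal.ofReal_mul (by positivity), ← ENNReal.ofReal_mul (by positivity)]
            congr 1; ring
          have e2 : ENNReal.ofReal (n x ^ 2 / c) * 2 * ENNReal.ofReal (s ^ 2) =
              ENNReal.ofReal (2 * c) := by
            rw [htwo, ← ENNReal.ofReal_mul (by positivity), ← ENNReal.ofReal_mul (by positivity)]
            congr 1; rw [hs]; field_simp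
          rw [mul_add, ← mul_assoc, ← mul_assoc, ← mul_assoc, ← mul_assoc, e2, e1]
      _ ≤ ENNReal.ofReal (2 / c) * (ENNReal.ofReal (C₀ ^ 2) * J) + ENNReal.ofReal (2 * c) * J := by
          gcongr
      _ = _ := by
          rw [← mul_assoc, ← ENNReal.ofReal_mul (by positivity), ← add_mul,
            ← ENNReal.ofReal_add (by positivity) (by positivity)]
          congr 2
          ring
  exact key.trans (mul_le_mul_right hJδ _)

/-- The trace inequality at the scale `n`. -/
theorem exists_trace_le {Ω : Set (E d)} (hΩ : IsBoundedLipschitzDomain Ω) {c C₀ : ℝ} (hc : 0 < c) :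
    ∃ δ C : ℝ, 0 < δ ∧ 0 < C ∧ ∀ n : E d → ℝ, IsSlowScale Ω n c C₀ →
      (∀ x ∈ closure Ω, c ≤ δ * n x) → ∀ (A : E d → E d) (β : ℝ) (u : E d → ℂ),
      ContinuousOn A (closure Ω) → ContDiff ℝ 1 u →
      ∫⁻ x, ENNReal.ofReal (n x) * ‖u x‖ₑ ^ 2 ∂(surfaceMeasure Ω) ≤
        ENNReal.ofReal C * ∫⁻ x in Ω, energyDensity A β n u x := by
  have hcomp : IsCompact (frontier Ω) :=
    hΩ.isCompact_closure.of_isClosed_subset isClosed_frontier frontier_subset_closure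
  have key : ∃ δ C : ℝ, 0 < δ ∧ 0 < C ∧ ∀ n : E d → ℝ, IsSlowScale Ω n c C₀ →
      (∀ x ∈ closure Ω, c ≤ δ * n x) → ∀ (A : E d → E d) (β : ℝ) (u : E d → ℂ),
      ContinuousOn A (closure Ω) → ContDiff ℝ 1 u →
      ∫⁻ x in frontier Ω ∩ frontier Ω, ENNReal.ofReal (n x) * ‖u x‖ₑ ^ 2 ∂μHE[d - 1] ≤
        ENNReal.ofReal C * ∫⁻ x in Ω, energyDensity A β n u x := by
    -- Compactness of the boundary: under unions the widths take minima and the constants add.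
    refine hcomp.induction_on (p := fun S => ∃ δ C : ℝ, 0 < δ ∧ 0 < C ∧ ∀ n : E d → ℝ,
      IsSlowScale Ω n c C₀ → (∀ x ∈ closure Ω, c ≤ δ * n x) →
      ∀ (A : E d → E d) (β : ℝ) (u : E d → ℂ), ContinuousOn A (closure Ω) → ContDiff ℝ 1 u →
      ∫⁻ x in frontier Ω ∩ S, ENNReal.ofReal (n x) * ‖u x‖ₑ ^ 2 ∂μHE[d - 1] ≤
        ENNReal.ofReal C * ∫⁻ x in Ω, energyDensity A β n u x) ?_ ?_ ?_ ?_
    · exact ⟨1, 1, one_pos, one_pos, by simp⟩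
    · rintro S T hST ⟨δ, C, hδ, hC, H⟩
      exact ⟨δ, C, hδ, hC, fun n hn hδn A β u hA hu =>
        (lintegral_mono_set (inter_subset_inter_right _ hST)).trans (H n hn hδn A β u hA hu)⟩
    · rintro S T ⟨δ, C, hδ, hC, H⟩ ⟨δ', C', hδ', hC', H'⟩
      refine ⟨min δ δ', C + C', by positivity, by positivity, fun n hn hδn A β u hA hu => ?_⟩
      have h1 := H n hn (fun x hx => (hδn x hx).trans
        (mul_le_mul_of_nonneg_right (min_le_left _ _) (hn.pos x hx).le)) A β u hA hu
      have h2 := H' n hn (fun x hx => (hδn x hx).trans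
        (mul_le_mul_of_nonneg_right (min_le_right _ _) (hn.pos x hx).le)) A β u hA hu
      rw [inter_union_distrib_left, ENNReal.ofReal_add hC.le hC'.le, add_mul]
      exact (lintegral_union_le _ _ _).trans (add_le_add h1 h2)
    · intro z hz
      obtain ⟨δ, C, ν, hδ, hν, hin, H⟩ := exists_boundary_layer hΩ hz
      refine ⟨Metric.ball z δ, mem_nhdsWithin_of_mem_nhds (Metric.ball_mem_nhds z hδ), δ,
        (|2 * C₀ ^ 2 / c + 2 * c| + 1) * (C + 1), hδ, by positivity,
        fun n hn hδn A β u hA hu => ?_⟩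
      have hFm : Measurable (Ω.indicator (energyDensity A β n u)) :=
        measurable_indicator_of_continuousOn (continuousOn_energyDensity (hA.mono subset_closure) β
          (hn.continuousOn.mono subset_closure) hu) hΩ.isOpen.measurableSet
      have hSm : MeasurableSet (frontier Ω ∩ Metric.ball z δ) :=
        isClosed_frontier.measurableSet.inter measurableSet_ball
      calc ∫⁻ x in frontier Ω ∩ Metric.ball z δ, ENNReal.ofReal (n x) * ‖u x‖ₑ ^ 2 ∂μHE[d - 1]
          ≤ ∫⁻ x in frontier Ω ∩ Metric.ball z δ, ENNReal.ofReal (2 * C₀ ^ 2 / c + 2 * c) *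
              ∫⁻ t in Ioc 0 δ, Ω.indicator (energyDensity A β n u) (x + t • ν)
                ∂volume ∂μHE[d - 1] := by
            refine setLIntegral_mono' hSm fun x hx => ?_
            have hxc := frontier_subset_closure hx.1
            exact trace_pointwise hn hA β hu hν hxc (hδn x hxc) (hin x hx.1 hx.2)
        _ ≤ ENNReal.ofReal (2 * C₀ ^ 2 / c + 2 * c) *
              (C * ∫⁻ x in Ω, Ω.indicator (energyDensity A β n u) x) := by
            rw [lintegral_const_mul' _ _ (by finiteness)]
            gcongr
            exact H _ hFm
        _ = ENNReal.ofReal (2 * C₀ ^ 2 / c + 2 * c) * (C * ∫⁻ x in Ω, energyDensity A β n u x) := by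
            congr 2
            exact setLIntegral_congr_fun hΩ.isOpen.measurableSet fun x hx => indicator_of_mem hx _
        _ ≤ _ := by
            rw [← mul_assoc]
            refine mul_le_mul_left ?_ _
            rw [ENNReal.ofReal_mul (by positivity)]
            refine mul_le_mul' (ENNReal.ofReal_le_ofReal ?_) ?_
            · linarith [le_abs_self (2 * C₀ ^ 2 / c + 2 * c)]
            · rw [← ENNReal.ofReal_coe_nnreal]
              exact ENNReal.ofReal_le_ofReal (by linarith)
  simpa only [inter_self, surfaceMeasure] using key

end

/-! ### Regularity of the Agmon distance to the well -/

section

variable {d : ℕ}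

/-- The segment from `x` to `γ 0`, followed by the curve `γ`. -/
def prependSegment (x : E d) (γ : ℝ → E d) (t : ℝ) : E d :=
  if t ≤ 1 / 2 then x + (2 * t) • (γ 0 - x) else γ (2 * t - 1)

lemma prependSegment_of_le (x : E d) (γ : ℝ → E d) {t : ℝ} (ht : t ≤ 1 / 2) :
    prependSegment x γ t = x + (2 * t) • (γ 0 - x) := if_pos ht

lemma prependSegment_of_ge (x : E d) (γ : ℝ → E d) {t : ℝ} (ht : 1 / 2 ≤ t) :
    prependSegment x γ t = γ (2 * t - 1) := by
  rcases ht.eq_or_lt with rfl | h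
  · rw [prependSegment_of_le x γ le_rfl]; norm_num
  · exact if_neg h.not_ge

lemma isPiecewiseC1_prependSegment (x : E d) {γ : ℝ → E d} (hγ : IsPiecewiseC1 γ) :
    IsPiecewiseC1 (prependSegment x γ) := by
  obtain ⟨n, t, ht, h0, h1, hC⟩ := hγ
  have hpos : ∀ i, 0 ≤ t i := fun i => h0 ▸ ht (Fin.zero_le i)
  refine ⟨n + 1, Fin.cons 0 fun i => (1 + t i) / 2, ?_, rfl, ?_, fun i => ?_⟩
  · intro i j hij
    induction i using Fin.cases with
    | zero =>
      induction j using Fin.cases with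
      | zero => exact le_rfl
      | succ j => simp only [Fin.cons_zero, Fin.cons_succ]; linarith [hpos j]
    | succ i =>
      induction j using Fin.cases with
      | zero => exact absurd hij (by simp)
      | succ j =>
        simp only [Fin.cons_succ]
        linarith [ht (Fin.succ_le_succ_iff.1 hij)]
  · rw [← Fin.succ_last, Fin.cons_succ, h1]; norm_num
  · induction i using Fin.cases with
    | zero =>
      have : ContDiffOn ℝ 1 (fun t : ℝ => x + (2 * t) • (γ 0 - x)) (Icc 0 (1 / 2)) := by fun_prop
      refine (this.congr fun s hs => prependSegment_of_le x γ hs.2).mono ?_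
      simp [h0]
    | succ i =>
      rw [← Fin.succ_castSucc, Fin.cons_succ, Fin.cons_succ]
      have h2 : ContDiffOn ℝ 1 (fun s : ℝ => γ (2 * s - 1))
          (Icc ((1 + t i.castSucc) / 2) ((1 + t i.succ) / 2)) := by
        refine (hC i).comp (g := γ) (f := fun s : ℝ => 2 * s - 1) (by fun_prop) fun s hs => ?_
        constructor <;> linarith [hs.1, hs.2]
      exact h2.congr fun s hs => prependSegment_of_ge x γ (by linarith [hs.1, hpos i.castSucc])

lemma lintegral_Ioo_comp_affine (Q : ℝ → ℝ≥0∞) :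
    2 * ∫⁻ t in Ioo (1 / 2 : ℝ) 1, Q (2 * t - 1) = ∫⁻ t in Ioo (0 : ℝ) 1, Q t := by
  rw [← lintegral_indicator measurableSet_Ioo, ← lintegral_indicator measurableSet_Ioo,
    ← lintegral_sub_right_eq_self ((Ioo (0 : ℝ) 1).indicator Q) (1 : ℝ),
    ← lintegral_comp_mul_left_real two_pos (fun t => (Ioo (0 : ℝ) 1).indicator Q (t - 1))]
  simp only [ENNReal.ofReal_ofNat]
  refine congrArg (2 * ·) (lintegral_congr fun t => ?_)
  have : t ∈ Ioo (1 / 2 : ℝ) 1 ↔ 2 * t - 1 ∈ Ioo (0 : ℝ) 1 := by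
    constructor <;> rintro ⟨h, h'⟩ <;> constructor <;> linarith
  by_cases h : 2 * t - 1 ∈ Ioo (0 : ℝ) 1
  · rw [indicator_of_mem h, indicator_of_mem (this.2 h)]
  · rw [indicator_of_notMem h, indicator_of_notMem (this.not.2 h)]

/-- Prepending a segment raises the Agmon length by at most the length of the segment times the
supremum of `m̃` on it. -/
lemma agmonDist_le_of_segment {Ω : Set (E d)} {A : E d → E d} {κ : ℕ} {β : ℝ} {x y : E d} (z : E d)
    (hseg : segment ℝ x y ⊆ closure Ω) {S : ℝ} (hS : ∀ w ∈ segment ℝ x y, mTilde Ω A κ β w ≤ S) :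
    agmonDist Ω A κ β x z ≤ ENNReal.ofReal (S * dist x y) + agmonDist Ω A κ β y z := by
  unfold agmonDist
  simp only [ENNReal.add_iInf, le_iInf_iff]
  rintro γ hγ hmaps rfl rfl
  have hmem : ∀ t : ℝ, 0 ≤ t → t ≤ 1 / 2 → x + (2 * t) • (γ 0 - x) ∈ segment ℝ x (γ 0) :=
    fun t h0 h1 => by
      rw [segment_eq_image']
      exact ⟨2 * t, ⟨by linarith, by linarith⟩, rfl⟩
  refine iInf_le_of_le (prependSegment x γ) <|
    iInf_le_of_le (isPiecewiseC1_prependSegment x hγ) <| iInf_le_of_le ?_ <|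
    iInf_le_of_le ?_ <| iInf_le_of_le ?_ ?_
  · rintro t ⟨h0, h1⟩
    rcases le_total t (1 / 2) with h | h
    · rw [prependSegment_of_le x γ h]
      exact hseg (hmem t h0 h)
    · rw [prependSegment_of_ge x γ h]
      exact hmaps ⟨by linarith, by linarith⟩
  · rw [prependSegment_of_le x γ (by norm_num)]; simp
  · rw [prependSegment_of_ge x γ (by norm_num)]; norm_num
  set Q : ℝ → ℝ≥0∞ := fun t => ENNReal.ofReal (mTilde Ω A κ β (γ t)) * ‖deriv γ t‖ₑ with hQ
  -- Endpoints are dropped so that `deriv` is computed only inside each of the two pieces; at the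
  -- junction the concatenated curve need not be differentiable.
  rw [← setLIntegral_congr (Ioo_ae_eq_Icc (a := (0 : ℝ)) (b := 1)),
    ← setLIntegral_congr (Ioo_ae_eq_Icc (a := (0 : ℝ)) (b := 1))]
  nth_rw 1 [← Ioc_union_Ioo_eq_Ioo (a := (0 : ℝ)) (b := 1 / 2) (c := 1) (by norm_num) (by norm_num)]
  refine (lintegral_union_le _ _ _).trans (add_le_add ?_ ?_)
  · rw [← setLIntegral_congr (Ioo_ae_eq_Ioc (a := (0 : ℝ)) (b := 1 / 2))]
    calc _ ≤ ∫⁻ _ in Ioo (0 : ℝ) (1 / 2), ENNReal.ofReal S * (2 * ENNReal.ofReal (dist x (γ 0))) := by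
          refine setLIntegral_mono' measurableSet_Ioo fun t ht => ?_
          have hd : HasDerivAt (prependSegment x γ) ((2 : ℝ) • (γ 0 - x)) t := by
            have h1 : HasDerivAt (fun t : ℝ => x + (2 * t) • (γ 0 - x)) ((2 : ℝ) • (γ 0 - x)) t := by
              have := (((hasDerivAt_id t).const_mul 2).smul_const (γ 0 - x)).const_add x
              simpa using this
            refine h1.congr_of_eventuallyEq ?_
            filter_upwards [Iio_mem_nhds ht.2] with s hs
            exact prependSegment_of_le x γ hs.le
          rw [hd.deriv, prependSegment_of_le x γ ht.2.le]
          refine mul_le_mul' (ENNReal.ofReal_le_ofReal (hS _ (hmem t ht.1.le ht.2.le))) ?_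
          rw [enorm_smul, dist_comm, dist_eq_norm, ofReal_norm]
          refine le_of_eq ?_
          congr 1
          rw [← ofReal_norm]; norm_num
      _ = _ := by
          have h2 : (2 : ℝ≥0∞) = ENNReal.ofReal 2 := by simp
          have h3 : 2 * ENNReal.ofReal (1 / 2 - 0) = 1 := by
            rw [h2, ← ENNReal.ofReal_mul (by norm_num)]; norm_num
          rw [setLIntegral_const, Real.volume_Ioo, mul_comm S, ENNReal.ofReal_mul dist_nonneg]
          calc _ = ENNReal.ofReal (dist x (γ 0)) * ENNReal.ofReal S *
                (2 * ENNReal.ofReal (1 / 2 - 0)) := by ring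
            _ = _ := by rw [h3, mul_one]
  · change _ ≤ ∫⁻ t in Ioo (0 : ℝ) 1, Q t
    rw [← lintegral_Ioo_comp_affine, ← lintegral_const_mul' _ _ (by finiteness)]
    refine setLIntegral_mono' measurableSet_Ioo fun t ht => ?_
    have hd : deriv (prependSegment x γ) t = (2 : ℝ) • deriv γ (2 * t - 1) := by
      have h1 : prependSegment x γ =ᶠ[𝓝 t] fun t => γ (2 * t - 1) := by
        filter_upwards [Ioi_mem_nhds ht.1] with s hs
        exact prependSegment_of_ge x γ (le_of_lt hs)
      rw [h1.deriv_eq, deriv_comp_mul_left (2 : ℝ) (fun s => γ (s - 1)), deriv_comp_sub_const]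
    rw [hd, prependSegment_of_ge x γ ht.1.le, enorm_smul]
    have : ‖(2 : ℝ)‖ₑ = 2 := by rw [← ofReal_norm]; norm_num
    rw [this]
    refine le_of_eq ?_
    ring

lemma agmonDist_self {Ω : Set (E d)} (A : E d → E d) (κ : ℕ) (β : ℝ) {x : E d}
    (hx : x ∈ closure Ω) : agmonDist Ω A κ β x x = 0 := by
  refine le_antisymm ?_ zero_le
  refine iInf_le_of_le (fun _ => x) <| iInf_le_of_le ?_ <| iInf_le_of_le (fun _ _ => hx) <|
    iInf_le_of_le rfl <| iInf_le_of_le rfl ?_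
  · exact ⟨1, ![0, 1], by
      intro i j hij
      fin_cases i <;> fin_cases j <;> simp_all, rfl, rfl, fun _ => contDiffOn_const⟩
  · simp

lemma wellDist_eq_zero {Ω : Set (E d)} {A : E d → E d} {κ : ℕ} {β t : ℝ} {x : E d}
    (hx : x ∈ well Ω A κ β t) : wellDist Ω A κ β t x = 0 := by
  refine le_antisymm ?_ zero_le
  exact (iInf₂_le x hx).trans (agmonDist_self A κ β (frontier_subset_closure hx.1)).le

lemma wellDist_le_of_segment {Ω : Set (E d)} {A : E d → E d} {κ : ℕ} {β : ℝ} {x y : E d} (t : ℝ)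
    (hseg : segment ℝ x y ⊆ closure Ω) {S : ℝ} (hS : ∀ w ∈ segment ℝ x y, mTilde Ω A κ β w ≤ S) :
    wellDist Ω A κ β t x ≤ ENNReal.ofReal (S * dist x y) + wellDist Ω A κ β t y := by
  unfold wellDist
  simp only [ENNReal.add_iInf, le_iInf_iff]
  intro z hz
  exact (iInf₂_le z hz).trans (agmonDist_le_of_segment z hseg hS)

lemma wellDist_le_of_path {Ω : Set (E d)} {A : E d → E d} {κ : ℕ} {β : ℝ} {x x' y' y : E d} (t : ℝ)
    (h1 : segment ℝ x x' ⊆ closure Ω) (h2 : segment ℝ x' y' ⊆ closure Ω)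
    (h3 : segment ℝ y' y ⊆ closure Ω) {S : ℝ} (hS0 : 0 ≤ S)
    (hS : ∀ w ∈ segment ℝ x x' ∪ segment ℝ x' y' ∪ segment ℝ y' y, mTilde Ω A κ β w ≤ S) :
    wellDist Ω A κ β t x ≤
      ENNReal.ofReal (S * (dist x x' + dist x' y' + dist y' y)) + wellDist Ω A κ β t y := by
  have k1 := wellDist_le_of_segment t h1 fun w hw => hS w (Or.inl (Or.inl hw))
  have k2 := wellDist_le_of_segment t h2 fun w hw => hS w (Or.inl (Or.inr hw))
  have k3 := wellDist_le_of_segment t h3 fun w hw => hS w (Or.inr hw)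
  rw [mul_add, mul_add, ENNReal.ofReal_add (by positivity) (by positivity),
    ENNReal.ofReal_add (by positivity) (by positivity), add_assoc, add_assoc]
  exact k1.trans (add_le_add le_rfl (k2.trans (add_le_add le_rfl k3)))

/-- The Agmon distance to the well is Lipschitz at the scale `n`. -/
theorem wellDist_le_add {Ω : Set (E d)} {δ θ : ℝ} (hU : UniformConeOn Ω (closure Ω) δ θ)
    {n : E d → ℝ} {c C₀ : ℝ} (hn : IsSlowScale Ω n c C₀) (hδn : ∀ x ∈ closure Ω, 1 ≤ δ * n x)
    {A : E d → E d} {κ : ℕ} {β Cm : ℝ} (hCm : 0 ≤ Cm)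
    (hm : ∀ x ∈ closure Ω, mTilde Ω A κ β x ≤ Cm * n x) (t : ℝ) {x y : E d}
    (hx : x ∈ closure Ω) (hy : y ∈ closure Ω)
    (hxy : dist x y * n x ≤ min (θ / 2) (c / (4 / θ + 1))) :
    wellDist Ω A κ β t x ≤
        ENNReal.ofReal (Cm * C₀ * (4 / θ + 1) * n x * dist x y) + wellDist Ω A κ β t y ∧
      wellDist Ω A κ β t y ≤
        ENNReal.ofReal (Cm * C₀ * (4 / θ + 1) * n x * dist x y) + wellDist Ω A κ β t x := by
  have hθ := hU.aperture_pos
  have hpos := hn.pos x hx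
  have hC₀ := hn.one_le
  have hclose : 2 * dist x y ≤ θ * δ := by
    have h1 : dist x y ≤ dist x y * (δ * n x) := le_mul_of_one_le_right dist_nonneg (hδn x hx)
    have h2 := hxy.trans (min_le_left _ _)
    have hδ := hU.pos
    nlinarith
  obtain ⟨x', y', s1, s2, s3, d1, d2, d3⟩ := hU.exists_path hx hy hclose
  have hsum : dist x x' + dist x' y' + dist y' y = (4 / θ + 1) * dist x y := by
    rw [d1, d2, d3]; ring
  have hfar : ∀ w ∈ segment ℝ x x' ∪ segment ℝ x' y' ∪ segment ℝ y' y,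
      w ∈ closure Ω ∧ dist x w ≤ (4 / θ + 1) * dist x y := by
    have hseg : ∀ {a b w : E d}, w ∈ segment ℝ a b → dist a w ≤ dist a b := fun {a b w} hw => by
      have := dist_add_dist_of_mem_segment hw
      linarith [dist_nonneg (x := w) (y := b)]
    have p1 := dist_nonneg (x := x) (y := x')
    have p2 := dist_nonneg (x := x') (y := y')
    have p3 := dist_nonneg (x := y') (y := y)
    rw [← hsum]
    rintro w ((hw | hw) | hw)
    · exact ⟨s1 hw, by linarith [hseg hw]⟩
    · exact ⟨s2 hw, by linarith [hseg hw, dist_triangle x x' w]⟩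
    · exact ⟨s3 hw, by linarith [hseg hw, dist_triangle x x' w, dist_triangle x' y' w]⟩
  -- Every point of the path is within (4/θ+1) dist x y of x, which the assumption makes at most
  -- c/n(x); slow variation then bounds m̃ along the whole path.
  have hS : ∀ w ∈ segment ℝ x x' ∪ segment ℝ x' y' ∪ segment ℝ y' y,
      mTilde Ω A κ β w ≤ Cm * (C₀ * n x) := by
    intro w hw
    obtain ⟨hwc, hwd⟩ := hfar w hw
    refine (hm w hwc).trans (mul_le_mul_of_nonneg_left (hn.le_mul x hx w hwc ?_) hCm)
    calc dist x w * n x ≤ (4 / θ + 1) * dist x y * n x := by gcongr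
      _ = (4 / θ + 1) * (dist x y * n x) := by ring
      _ ≤ (4 / θ + 1) * (c / (4 / θ + 1)) := by
        gcongr; exact hxy.trans (min_le_right _ _)
      _ = c := by field_simp
  have hS0 : 0 ≤ Cm * (C₀ * n x) := by positivity
  have e1 : Cm * C₀ * (4 / θ + 1) * n x * dist x y =
      Cm * (C₀ * n x) * (dist x x' + dist x' y' + dist y' y) := by rw [hsum]; ring
  have e2 : dist x x' + dist x' y' + dist y' y = dist y y' + dist y' x' + dist x' x := by
    rw [dist_comm x x', dist_comm x' y', dist_comm y' y]; ring
  refine ⟨e1 ▸ wellDist_le_of_path t s1 s2 s3 hS0 hS, ?_⟩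
  rw [e1, e2]
  refine wellDist_le_of_path t (segment_symm ℝ y' y ▸ s3) (segment_symm ℝ x' y' ▸ s2)
    (segment_symm ℝ x x' ▸ s1) hS0 fun w hw => hS w ?_
  rw [segment_symm ℝ y y', segment_symm ℝ y' x', segment_symm ℝ x' x] at hw
  rcases hw with (hw | hw) | hw
  exacts [Or.inr hw, Or.inl (Or.inr hw), Or.inl (Or.inl hw)]

/-- The Agmon distance to the well, truncated at height `N`. -/
def truncDist (Ω : Set (E d)) (A : E d → E d) (κ : ℕ) (β t : ℝ) (N : ℕ) (x : E d) : ℝ :=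
  (min (wellDist Ω A κ β t x) N).toReal

/-- Truncation turns the extended Lipschitz bound into one for real numbers, including the case of
an empty well, where both distances are infinite. -/
lemma toReal_min_sub_le {a b : ℝ≥0∞} {r : ℝ} (hr : 0 ≤ r) (h : a ≤ ENNReal.ofReal r + b) (N : ℕ) :
    (min a N).toReal - (min b N).toReal ≤ r := by
  have hb : min b (N : ℝ≥0∞) ≠ ⊤ := ((min_le_right _ _).trans_lt (ENNReal.natCast_lt_top N)).ne
  have h1 : min a (N : ℝ≥0∞) ≤ ENNReal.ofReal r + min b N := by
    rw [← min_add_add_left]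
    exact min_le_min h le_add_self
  have h2 := ENNReal.toReal_mono (by finiteness) h1
  rw [ENNReal.toReal_add (by finiteness) hb, ENNReal.toReal_ofReal hr] at h2
  linarith

lemma abs_truncDist_sub_le {Ω : Set (E d)} {δ θ : ℝ} (hU : UniformConeOn Ω (closure Ω) δ θ)
    {n : E d → ℝ} {c C₀ : ℝ} (hn : IsSlowScale Ω n c C₀) (hδn : ∀ x ∈ closure Ω, 1 ≤ δ * n x)
    {A : E d → E d} {κ : ℕ} {β Cm : ℝ} (hCm : 0 ≤ Cm)
    (hm : ∀ x ∈ closure Ω, mTilde Ω A κ β x ≤ Cm * n x) (t : ℝ) (N : ℕ) {x y : E d}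
    (hx : x ∈ closure Ω) (hy : y ∈ closure Ω)
    (hxy : dist x y * n x ≤ min (θ / 2) (c / (4 / θ + 1))) :
    |truncDist Ω A κ β t N y - truncDist Ω A κ β t N x| ≤
      Cm * C₀ * (4 / θ + 1) * n x * dist x y := by
  obtain ⟨h1, h2⟩ := wellDist_le_add hU hn hδn hCm hm t hx hy hxy
  have hpos := hn.pos x hx
  have hC₀ := hn.one_le
  have hθ := hU.aperture_pos
  have hr : 0 ≤ Cm * C₀ * (4 / θ + 1) * n x * dist x y := by positivity
  rw [abs_sub_le_iff]
  exact ⟨toReal_min_sub_le hr h2 N, toReal_min_sub_le hr h1 N⟩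

lemma continuousOn_of_scale_lipschitz {s : Set (E d)} {n φ : E d → ℝ} {c L : ℝ} (hc : 0 < c)
    (h : ∀ x ∈ s, ∀ y ∈ s, dist x y * n x ≤ c → |φ y - φ x| ≤ L * n x * dist x y) :
    ContinuousOn φ s := by
  intro x hx
  have h1 : Tendsto (fun y => dist x y * n x) (𝓝[s] x) (𝓝 0) := by
    have : Continuous fun y => dist x y * n x := by fun_prop
    simpa using (this.tendsto x).mono_left nhdsWithin_le_nhds
  have h2 : Tendsto (fun y => L * n x * dist x y) (𝓝[s] x) (𝓝 0) := by
    have : Continuous fun y => L * n x * dist x y := by fun_prop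
    simpa using (this.tendsto x).mono_left nhdsWithin_le_nhds
  refine tendsto_iff_dist_tendsto_zero.2 (squeeze_zero' (Eventually.of_forall fun _ => dist_nonneg)
    ?_ h2)
  filter_upwards [h1.eventually_le_const hc, self_mem_nhdsWithin] with y hy hys
  rw [Real.dist_eq]
  exact h x hx y hys hy

end

/-! ### Smoothing functions that are Lipschitz at a variable scale -/

section

variable {d : ℕ}

/-- `χ` is a smooth mollifying profile of width `h`, with Lipschitz constant `K / h`. -/
structure IsMollifier (χ : E d → ℝ) (h K : ℝ) : Prop where
  width_pos : 0 < h
  contDiff : ContDiff ℝ ∞ χ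
  hasCompactSupport : HasCompactSupport χ
  nonneg : ∀ y, 0 ≤ χ y
  le_one : ∀ y, χ y ≤ 1
  eq_one : ∀ y, ‖y‖ ≤ h → χ y = 1
  eq_zero : ∀ y, 2 * h ≤ ‖y‖ → χ y = 0
  lipschitz : ∀ y y', |χ y - χ y'| ≤ K / h * ‖y - y'‖

lemma exists_isMollifier (d : ℕ) : ∃ K : ℝ, 0 ≤ K ∧ ∀ h : ℝ, 0 < h →
    ∃ χ : E d → ℝ, IsMollifier χ h K := by
  let f : ContDiffBump (0 : E d) := ⟨1, 2, one_pos, one_lt_two⟩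
  have hf : ContDiff ℝ ∞ f := f.contDiff
  obtain ⟨K, hK⟩ := ContDiff.lipschitzWith_of_hasCompactSupport f.hasCompactSupport hf (by simp)
  refine ⟨K, K.2, fun h hh => ⟨fun y => f (h⁻¹ • y), hh, hf.comp (contDiff_const_smul _),
    f.hasCompactSupport.comp_smul (inv_ne_zero hh.ne'), fun y => f.nonneg, fun y => f.le_one,
    fun y hy => f.one_of_mem_closedBall ?_, fun y hy => f.zero_of_le_dist ?_, fun y y' => ?_⟩⟩
  · rw [mem_closedBall_zero_iff, norm_smul, norm_inv, Real.norm_of_nonneg hh.le,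
      inv_mul_le_iff₀ hh]
    change _ ≤ h * 1
    linarith
  · rw [dist_zero_right, norm_smul, norm_inv, Real.norm_of_nonneg hh.le, le_inv_mul_iff₀ hh]
    change h * 2 ≤ _
    linarith
  · have := hK.dist_le_mul (h⁻¹ • y) (h⁻¹ • y')
    rw [Real.dist_eq, dist_eq_norm, ← smul_sub, norm_smul, norm_inv,
      Real.norm_of_nonneg hh.le] at this
    rw [div_eq_mul_inv, mul_assoc]
    exact this

/-- Extending g by zero outside Ω makes this a convolution with a smooth compactly supported
function, which is smooth on the whole space. -/
lemma IsMollifier.contDiff_integral {χ : E d → ℝ} {h K : ℝ} (hχ : IsMollifier χ h K)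
    {Ω : Set (E d)} (hΩ : MeasurableSet Ω) {g : E d → ℝ} (hg : IntegrableOn g Ω) :
    ContDiff ℝ ∞ fun x => ∫ y in Ω, g y * χ (x - y) := by
  have h1 := HasCompactSupport.contDiff_convolution_right (n := ⊤) (μ := volume)
    (ContinuousLinearMap.lsmul ℝ ℝ) hχ.hasCompactSupport
    ((integrable_indicator_iff hΩ).2 hg).locallyIntegrable hχ.contDiff
  convert h1 using 1
  ext x
  rw [convolution_def, ← integral_indicator hΩ]
  refine integral_congr_ae (Eventually.of_forall fun y => ?_)
  by_cases hy : y ∈ Ω <;> simp [hy]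

lemma IsMollifier.integrable {χ : E d → ℝ} {h K : ℝ} (hχ : IsMollifier χ h K)
    {Ω : Set (E d)} {g : E d → ℝ} (hg : IntegrableOn g Ω) (x : E d) :
    IntegrableOn (fun y => g y * χ (x - y)) Ω := by
  refine Integrable.mono' hg.norm (hg.aestronglyMeasurable.mul ?_) (Eventually.of_forall fun y => ?_)
  · exact (hχ.contDiff.continuous.comp (by fun_prop : Continuous fun y => x - y)).aestronglyMeasurable
  · rw [norm_mul, Real.norm_of_nonneg (hχ.nonneg _)]
    exact mul_le_of_le_one_right (norm_nonneg _) (hχ.le_one _)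

/-- The integral of `g` against a mollifier is Lipschitz, with the local supremum of `g`. -/
lemma IsMollifier.abs_integral_sub_le {χ : E d → ℝ} {h K : ℝ} (hχ : IsMollifier χ h K) (hK : 0 ≤ K)
    {Ω : Set (E d)} (hΩ : MeasurableSet Ω) {g : E d → ℝ} (hg : IntegrableOn g Ω) {x x' : E d}
    (hxx : ‖x' - x‖ ≤ h) {H : ℝ} (hH : 0 ≤ H) (hgH : ∀ y ∈ Ω, dist x y < 3 * h → |g y| ≤ H) :
    |(∫ y in Ω, g y * χ (x' - y)) - ∫ y in Ω, g y * χ (x - y)| ≤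
      H * (K / h * ‖x' - x‖) * volume.real (Metric.ball x (3 * h)) := by
  have hh := hχ.width_pos
  rw [← integral_sub (hχ.integrable hg x') (hχ.integrable hg x), ← Real.norm_eq_abs]
  set b : ℝ := H * (K / h * ‖x' - x‖) with hb
  have hb0 : 0 ≤ b := by positivity
  have hfin : volume (Metric.ball x (3 * h)) ≠ ⊤ := measure_ball_lt_top.ne
  have hint : Integrable ((Metric.ball x (3 * h)).indicator fun _ => b) :=
    (integrable_indicator_iff measurableSet_ball).2 (integrableOn_const hfin)
  calc _ ≤ ∫ y in Ω, (Metric.ball x (3 * h)).indicator (fun _ => b) y := by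
        refine norm_integral_le_of_norm_le hint.integrableOn
          ((ae_restrict_iff' hΩ).2 (Eventually.of_forall fun y hy => ?_))
        rw [← mul_sub, norm_mul]
        by_cases hyb : dist x y < 3 * h
        · rw [indicator_of_mem (by rwa [Metric.mem_ball, dist_comm])]
          refine mul_le_mul (hgH y hy hyb) ?_ (norm_nonneg _) hH
          have := hχ.lipschitz (x' - y) (x - y)
          rwa [sub_sub_sub_cancel_right] at this
        · have h1 : 3 * h ≤ ‖x - y‖ := by rw [← dist_eq_norm]; exact not_lt.1 hyb
          have h2 : 2 * h ≤ ‖x' - y‖ := by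
            have := norm_sub_norm_le (x - y) (x - x')
            rw [sub_sub_sub_cancel_left, norm_sub_rev x x'] at this
            linarith
          rw [hχ.eq_zero _ h2, hχ.eq_zero _ (by linarith), sub_zero, norm_zero, mul_zero]
          exact indicator_nonneg (fun _ _ => hb0) _
    _ ≤ ∫ y, (Metric.ball x (3 * h)).indicator (fun _ => b) y :=
        setIntegral_le_integral hint (Eventually.of_forall fun y =>
          indicator_nonneg (fun _ _ => hb0) _)
    _ = _ := by
        rw [integral_indicator measurableSet_ball, setIntegral_const, smul_eq_mul, mul_comm]

lemma IsMollifier.abs_integral_le {χ : E d → ℝ} {h K : ℝ} (hχ : IsMollifier χ h K)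
    {Ω : Set (E d)} (hΩ : MeasurableSet Ω) (hfin : volume Ω ≠ ⊤) {g : E d → ℝ} {x : E d} {H : ℝ}
    (hgH : ∀ y ∈ Ω, dist x y < 2 * h → |g y| ≤ H) :
    |∫ y in Ω, g y * χ (x - y)| ≤ H * ∫ y in Ω, χ (x - y) := by
  rw [← integral_const_mul, ← Real.norm_eq_abs]
  have h1 : IntegrableOn (fun _ : E d => (1 : ℝ)) Ω := integrableOn_const hfin
  have h2 := hχ.integrable h1 x
  simp only [one_mul] at h2
  refine norm_integral_le_of_norm_le (h2.const_mul H)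
    ((ae_restrict_iff' hΩ).2 (Eventually.of_forall fun y hy => ?_))
  rw [norm_mul, Real.norm_of_nonneg (hχ.nonneg _)]
  by_cases hyb : dist x y < 2 * h
  · exact mul_le_mul_of_nonneg_right (hgH y hy hyb) (hχ.nonneg _)
  · rw [hχ.eq_zero (x - y) (by rw [← dist_eq_norm]; exact not_lt.1 hyb)]; simp

lemma IsMollifier.le_integral {χ : E d → ℝ} {h K : ℝ} (hχ : IsMollifier χ h K)
    {Ω : Set (E d)} (hfin : volume Ω ≠ ⊤) (x : E d) :
    volume.real (Ω ∩ Metric.ball x h) ≤ ∫ y in Ω, χ (x - y) := by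
  have h1 : IntegrableOn (fun _ : E d => (1 : ℝ)) Ω := integrableOn_const hfin
  have h2 := hχ.integrable h1 x
  simp only [one_mul] at h2
  calc volume.real (Ω ∩ Metric.ball x h)
      = ∫ y in Ω, (Metric.ball x h).indicator (fun _ => (1 : ℝ)) y := by
        rw [setIntegral_indicator measurableSet_ball, setIntegral_const]; simp
    _ ≤ _ := by
        refine integral_mono_of_nonneg (Eventually.of_forall fun y =>
          indicator_nonneg (fun _ _ => zero_le_one) _) h2 (Eventually.of_forall fun y => ?_)
        by_cases hy : y ∈ Metric.ball x h
        · rw [indicator_of_mem hy]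
          refine (hχ.eq_one _ ?_).ge
          rw [← dist_eq_norm, dist_comm]
          exact (Metric.mem_ball.1 hy).le
        · rw [indicator_of_notMem hy]
          exact hχ.nonneg _

lemma volume_real_ball (x : E d) {r : ℝ} (hr : 0 < r) :
    volume.real (Metric.ball x r) = r ^ d * volume.real (Metric.ball (0 : E d) 1) := by
  rw [measureReal_def, Measure.addHaar_ball_of_pos _ _ hr, ENNReal.toReal_mul, finrank_euclideanSpace_fin,
    ENNReal.toReal_ofReal (by positivity), ← measureReal_def]

lemma UniformConeOn.volume_real_inter_ball_ge {Ω : Set (E d)} {δ θ : ℝ}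
    (h : UniformConeOn Ω (closure Ω) δ θ) {x : E d} (hx : x ∈ closure Ω) {r : ℝ} (hr : 0 < r)
    (hrδ : r ≤ δ) :
    (θ / 2 * r) ^ d * volume.real (Metric.ball (0 : E d) 1) ≤
      volume.real (Ω ∩ Metric.ball x r) := by
  have hθ := h.aperture_pos
  have h1 := ENNReal.toReal_mono ((measure_mono inter_subset_right).trans_lt measure_ball_lt_top).ne
    (h.volume_inter_ball_ge hx hr hrδ)
  rwa [ENNReal.toReal_mul, ENNReal.toReal_ofReal (by positivity)] at h1

/-- A function that is Lipschitz at the scale `n` is at bounded distance from a smooth function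
with gradient controlled by `n`. -/
theorem exists_smoothing {Ω : Set (E d)} (hΩ : IsBoundedLipschitzDomain Ω) {δ θ : ℝ}
    (hU : UniformConeOn Ω (closure Ω) δ θ) : ∃ C : ℝ, 0 < C ∧ ∀ (n φ : E d → ℝ) (c L : ℝ),
      0 < c → 0 ≤ L → ContinuousOn n (closure Ω) → (∀ x ∈ closure Ω, 0 < n x) →
      (∀ x ∈ closure Ω, ∀ y ∈ closure Ω, dist x y * n x ≤ c → |φ y - φ x| ≤ L * n x * dist x y) →
      ∃ D : E d → ℝ, ContDiff ℝ ∞ D ∧ (∀ x ∈ closure Ω, |D x - φ x| ≤ L * c) ∧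
        ∀ x ∈ Ω, ‖fderiv ℝ D x‖ ≤ C * L * n x := by
  obtain ⟨K, hK, hmoll⟩ := exists_isMollifier d
  have hθ := hU.aperture_pos
  have hδ := hU.pos
  set V := volume.real (Metric.ball (0 : E d) 1) with hV
  have hV0 : 0 < V := ENNReal.toReal_pos (Metric.measure_ball_pos _ _ one_pos).ne'
    measure_ball_lt_top.ne
  refine ⟨6 * K * (6 / θ) ^ d + 1, by positivity, fun n φ c L hc hL hncont hnpos hφ => ?_⟩
  have hΩm := hΩ.isOpen.measurableSet
  have hcomp := hΩ.isCompact_closure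
  have hfin : volume Ω ≠ ⊤ := ((measure_mono subset_closure).trans_lt hcomp.measure_lt_top).ne
  obtain ⟨S, hS⟩ := hcomp.bddAbove_image hncont
  have hS' : ∀ x ∈ closure Ω, n x ≤ |S| + 1 := fun x hx => by
    linarith [hS (mem_image_of_mem n hx), le_abs_self S]
  -- One width for all points: as n is bounded on the compact closure, 3h n ≤ c everywhere. The
  -- bounds to be proved do not involve h, so it may be as small as required.
  set h := min δ (c / (3 * (|S| + 1))) with hh
  have hh0 : 0 < h := by positivity
  have hsmall : ∀ x ∈ closure Ω, 3 * h * n x ≤ c := fun x hx => by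
    have h1 : h ≤ c / (3 * (|S| + 1)) := min_le_right _ _
    rw [le_div_iff₀ (by positivity)] at h1
    nlinarith [hS' x hx, hnpos x hx]
  obtain ⟨χ, hχ⟩ := hmoll h hh0
  have hφint : IntegrableOn φ Ω :=
    ((continuousOn_of_scale_lipschitz hc hφ).integrableOn_compact hcomp).mono_set subset_closure
  have hone : IntegrableOn (fun _ : E d => (1 : ℝ)) Ω := integrableOn_const hfin
  set num : E d → ℝ := fun x => ∫ y in Ω, φ y * χ (x - y) with hnum
  set den : E d → ℝ := fun x => ∫ y in Ω, χ (x - y) with hden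
  have hnum_smooth : ContDiff ℝ ∞ num := hχ.contDiff_integral hΩm hφint
  have hden_smooth : ContDiff ℝ ∞ den := by
    simpa only [one_mul] using hχ.contDiff_integral hΩm hone
  set m₀ := (θ / 2 * h) ^ d * V with hm₀
  have hm₀pos : 0 < m₀ := by positivity
  have hden_ge : ∀ x ∈ closure Ω, m₀ ≤ den x := fun x hx =>
    (hU.volume_real_inter_ball_ge hx hh0 (min_le_left _ _)).trans (hχ.le_integral hfin x)
  have hden_nonneg : ∀ x, 0 ≤ den x := fun x => integral_nonneg fun y => hχ.nonneg _
  -- D is the average of φ over Ω against the mollifier, so no values of φ outside Ω are used. The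
  -- normalisation den is at least m₀ on the closure but can vanish elsewhere; the added term is
  -- zero where den ≥ m₀ and makes the quotient smooth everywhere.
  set den' : E d → ℝ := fun x => den x + Real.smoothTransition (1 - den x / m₀) with hden'
  have hden'_smooth : ContDiff ℝ ∞ den' :=
    hden_smooth.add (Real.smoothTransition.contDiff.comp
      (contDiff_const.sub (hden_smooth.div_const m₀)))
  have hden'_ne : ∀ x, den' x ≠ 0 := fun x => by
    rcases (hden_nonneg x).eq_or_lt with h0 | h0
    · simp [hden', ← h0, Real.smoothTransition.one]
    · exact (add_pos_of_pos_of_nonneg h0 (Real.smoothTransition.nonneg _)).ne'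
  have hden'_eq : ∀ x ∈ closure Ω, den' x = den x := fun x hx => by
    have : 1 - den x / m₀ ≤ 0 := by
      rw [sub_nonpos, one_le_div hm₀pos]; exact hden_ge x hx
    simp only [hden', Real.smoothTransition.zero_of_nonpos this, add_zero]
  have hloc : ∀ x ∈ closure Ω, ∀ y ∈ Ω, dist x y < 3 * h → |φ y - φ x| ≤ L * n x * (3 * h) := by
    intro x hx y hy hxy
    have hp := hnpos x hx
    refine (hφ x hx y (subset_closure hy) ?_).trans (by gcongr)
    exact (mul_le_mul_of_nonneg_right hxy.le hp.le).trans (hsmall x hx)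
  have hsub : ∀ a x, (∫ y in Ω, (φ y - a) * χ (x - y)) = num x - a * den x := by
    intro a x
    have h2 := hχ.integrable hone x
    simp only [one_mul] at h2
    rw [hnum, hden]
    simp only [sub_mul]
    rw [integral_sub (hχ.integrable hφint x) (h2.const_mul a), integral_const_mul]
  refine ⟨fun x => num x / den' x, hnum_smooth.div hden'_smooth hden'_ne, fun x hx => ?_,
    fun x hx => ?_⟩
  · have hd0 := hm₀pos.trans_le (hden_ge x hx)
    have h1 := hχ.abs_integral_le hΩm hfin (g := fun y => φ y - φ x) (x := x)
      (H := L * n x * (3 * h)) fun y hy hxy => hloc x hx y hy (by linarith)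
    rw [hsub] at h1
    simp only
    rw [hden'_eq x hx, div_sub' hd0.ne', abs_div, abs_of_pos hd0, div_le_iff₀ hd0, mul_comm (den x)]
    refine h1.trans (mul_le_mul_of_nonneg_right ?_ hd0.le)
    rw [mul_assoc]
    refine mul_le_mul_of_nonneg_left ?_ hL
    linarith [hsmall x hx]
  · have hxc := subset_closure hx
    have hp := hnpos x hxc
    have hd0 := hm₀pos.trans_le (hden_ge x hxc)
    refine norm_fderiv_le_of_lip' ℝ (by positivity) ?_
    filter_upwards [hΩ.isOpen.mem_nhds hx, Metric.closedBall_mem_nhds x hh0] with x' hx' hxx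
    rw [Metric.mem_closedBall, dist_eq_norm] at hxx
    have hxc' := subset_closure hx'
    have hd0' := hm₀pos.trans_le (hden_ge x' hxc')
    set H := L * n x * (3 * h) with hH
    have hH0 : 0 ≤ H := by positivity
    set g : E d → ℝ := fun y => φ y - φ x with hg
    have hgint : IntegrableOn g Ω := hφint.sub (integrableOn_const hfin)
    have k1 := hχ.abs_integral_sub_le hK hΩm hgint hxx hH0 (hloc x hxc)
    have k2 := hχ.abs_integral_sub_le hK hΩm hone hxx zero_le_one (fun y _ _ => by simp)
    have k3 := hχ.abs_integral_le hΩm hfin (g := g) (x := x') (H := H) fun y hy hxy =>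
      hloc x hxc y hy (by
        have := dist_triangle x x' y
        rw [dist_eq_norm x x', norm_sub_rev] at this
        linarith)
    simp only [one_mul] at k2
    rw [hg, hsub, hsub] at k1
    rw [hg, hsub] at k3
    set Z := K / h * ‖x' - x‖ * volume.real (Metric.ball x (3 * h)) with hZ
    change |den x' - den x| ≤ Z at k2
    change |num x' - φ x * den x'| ≤ H * den x' at k3
    have k1' : |(num x' - φ x * den x') - (num x - φ x * den x)| ≤ H * Z := by
      rw [hZ, ← mul_assoc]; exact k1
    rw [hden'_eq x hxc, hden'_eq x' hxc', Real.norm_eq_abs]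
    -- Subtracting the constant φ x from φ leaves an integrand of size H = 3hLn(x) near x. This h
    -- cancels the 1/h from the Lipschitz constant of the mollifier, and the ratio of the ball
    -- volume to m₀ is (6/θ)^d.
    have e1 : num x' / den x' - num x / den x =
        (((num x' - φ x * den x') - (num x - φ x * den x)) -
          (num x' - φ x * den x') / den x' * (den x' - den x)) / den x := by
      field_simp
      ring
    have k4 : |(num x' - φ x * den x') / den x' * (den x' - den x)| ≤ H * Z := by
      rw [abs_mul]
      refine mul_le_mul ?_ k2 (abs_nonneg _) hH0
      rw [abs_div, abs_of_pos hd0', div_le_iff₀ hd0']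
      exact k3
    rw [e1, abs_div, abs_of_pos hd0, div_le_iff₀ hd0]
    have hZm : H * Z + H * Z = 6 * K * (6 / θ) ^ d * L * n x * ‖x' - x‖ * m₀ := by
      rw [hZ, hH, hm₀, volume_real_ball x (by positivity), ← hV]
      have : (3 * h) ^ d = (6 / θ) ^ d * (θ / 2 * h) ^ d := by
        rw [← mul_pow]; congr 1; field_simp; ring
      rw [this]
      field_simp
      ring
    calc _ ≤ H * Z + H * Z := (abs_sub _ _).trans (add_le_add k1' k4)
      _ = 6 * K * (6 / θ) ^ d * L * n x * ‖x' - x‖ * m₀ := hZm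
      _ ≤ (6 * K * (6 / θ) ^ d + 1) * L * n x * ‖x' - x‖ * den x := by
        gcongr
        · linarith
        · exact hden_ge x hxc

end

/-! ### Energy estimates and their extension to H¹ -/

section

variable {d : ℕ}

/-- For smooth functions and a strong field, the magnetic energy controls both the mass at the
scale of the field and the boundary values. -/
theorem exists_energy_estimates (hd : 2 ≤ d) {Ω : Set (E d)} (hΩ : IsBoundedLipschitzDomain Ω)
    {δ θ : ℝ} (hU : UniformConeOn Ω (closure Ω) δ θ) (κ : ℕ) :
    ∃ c C₀ n₀ C : ℝ, 0 < c ∧ 1 ≤ C₀ ∧ 0 < C ∧ ∀ (A : E d → E d) (β : ℝ),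
      ContDiffOn ℝ 1 A (closure Ω) → ContinuousOn (magField Ω A) (closure Ω) →
      IsScaled κ (closure Ω) (fun x => β • magField Ω A x) →
      (∀ x ∈ closure Ω, n₀ ≤ fieldScale Ω A κ β x) →
      IsSlowScale Ω (fieldScale Ω A κ β) c C₀ ∧
      (∀ x ∈ closure Ω, 1 ≤ δ * fieldScale Ω A κ β x) ∧
      ∀ u : E d → ℂ, ContDiff ℝ 1 u →
        ∫⁻ x in Ω, ENNReal.ofReal (fieldScale Ω A κ β x ^ 2) * ‖u x‖ₑ ^ 2 ≤
          ENNReal.ofReal C * ∫⁻ x in Ω, ‖magGrad A β u (grad u) x‖ₑ ^ 2 ∧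
        ∫⁻ x, ENNReal.ofReal (fieldScale Ω A κ β x) * ‖u x‖ₑ ^ 2 ∂(surfaceMeasure Ω) ≤
          ENNReal.ofReal C * ∫⁻ x in Ω, ‖magGrad A β u (grad u) x‖ₑ ^ 2 := by
  obtain ⟨c, C₀, hc, hC₀, hslow⟩ := exists_isSlowScale hU κ
  obtain ⟨σ, C₁, hσ, hσc, hσ1, hC₁, hloc⟩ := exists_local_mass_le hd hΩ.isOpen hU κ hc
  obtain ⟨δ', C₂, hδ', hC₂, htr⟩ := exists_trace_le hΩ (C₀ := C₀) hc
  have hδ := hU.pos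
  have hθ := hU.aperture_pos
  set C₃ := C₁ * (C₀ ^ 2 * c) ^ d / ((C₀⁻¹) ^ (d + 2) * (θ * σ / (2 * C₀)) ^ d) with hC₃
  have hC₀pos : 0 < C₀ := zero_lt_one.trans_le hC₀
  have hC₃pos : 0 < C₃ := by positivity
  -- The lower bound on n puts the inverse scale below the cone height and below the width of the
  -- boundary layers. The factor 1 + C₃ arises because the energy density in the trace inequality
  -- contains the mass term, itself bounded by C₃ times the energy.
  refine ⟨c, C₀, max (1 / δ) (c / δ'), max C₃ (C₂ * (1 + C₃)), hc, hC₀, by positivity,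
    fun A β hA hB hsc hn₀ => ?_⟩
  have hδn : ∀ x ∈ closure Ω, 1 ≤ δ * fieldScale Ω A κ β x := fun x hx => by
    have := (le_max_left _ _).trans (hn₀ x hx)
    rwa [div_le_iff₀' hδ] at this
  have hδn' : ∀ x ∈ closure Ω, c ≤ δ' * fieldScale Ω A κ β x := fun x hx => by
    have := (le_max_right _ _).trans (hn₀ x hx)
    rwa [div_le_iff₀' hδ'] at this
  have hn : IsSlowScale Ω (fieldScale Ω A κ β) c C₀ := hslow hsc hδn
  refine ⟨hn, hδn, fun u hu => ?_⟩
  have hPc : ContinuousOn (fun x => ‖magGrad A β u (grad u) x‖ₑ ^ 2) Ω :=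
    (ENNReal.continuous_pow 2).comp_continuousOn
      (continuousOn_magGrad (hA.continuousOn.mono subset_closure) β hu).enorm
  have hΩm := hΩ.isOpen.measurableSet
  have hind : ∀ x ∈ Ω, Ω.indicator (fun x => ‖magGrad A β u (grad u) x‖ₑ ^ 2) x =
      ‖magGrad A β u (grad u) x‖ₑ ^ 2 := fun x hx => indicator_of_mem hx _
  have h1 : ∫⁻ x in Ω, ENNReal.ofReal (fieldScale Ω A κ β x ^ 2) * ‖u x‖ₑ ^ 2 ≤
      ENNReal.ofReal C₃ * ∫⁻ x in Ω, ‖magGrad A β u (grad u) x‖ₑ ^ 2 := by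
    have := lintegral_scale_sq_le_of_local hΩ.isOpen hU hn hδn hσ hσ1 hσc hc le_rfl hC₁
      (hu.continuous.measurable.enorm.pow_const 2) (measurable_indicator_of_continuousOn hPc hΩm)
      fun x₀ hx₀ => by
        refine (hloc A β hA hB hsc x₀ (subset_closure hx₀) (hδn x₀ (subset_closure hx₀))
          u hu).trans (mul_le_mul_right (le_of_eq ?_) _)
        exact setLIntegral_congr_fun (hΩm.inter measurableSet_ball) fun x hx => (hind x hx.1).symm
    refine this.trans (mul_le_mul_right (le_of_eq ?_) _)
    exact setLIntegral_congr_fun hΩm hind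
  refine ⟨h1.trans (mul_le_mul_left (ENNReal.ofReal_le_ofReal (le_max_left _ _)) _), ?_⟩
  refine (htr _ hn hδn' A β u hA.continuousOn hu).trans ?_
  have h2 : ∫⁻ x in Ω, energyDensity A β (fieldScale Ω A κ β) u x ≤
      ENNReal.ofReal (1 + C₃) * ∫⁻ x in Ω, ‖magGrad A β u (grad u) x‖ₑ ^ 2 := by
    unfold energyDensity
    rw [lintegral_add_left' (hPc.aemeasurable hΩm), ENNReal.ofReal_add zero_le_one hC₃pos.le,
      ENNReal.ofReal_one, add_mul, one_mul]
    exact add_le_add le_rfl h1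
  refine (mul_le_mul_right h2 _).trans ?_
  rw [← mul_assoc, ← ENNReal.ofReal_mul hC₂.le]
  exact mul_le_mul_left (ENNReal.ofReal_le_ofReal (le_max_right _ _)) _

/-! ### Passage to the limit in quadratic estimates -/

section Limits

variable {α : Type*} [MeasurableSpace α] {F : Type*} [NormedAddCommGroup F]

lemma lintegral_enorm_sq_eq_eLpNorm_sq (f : α → F) (μ : Measure α) :
    ∫⁻ x, ‖f x‖ₑ ^ 2 ∂μ = eLpNorm f 2 μ ^ 2 := by
  have := eLpNorm_nnreal_pow_eq_lintegral (f := f) (μ := μ) (p := 2) two_ne_zero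
  simpa using this.symm

lemma tendsto_lintegral_enorm_sq {f : ℕ → α → F} {μ : Measure α}
    (h : Tendsto (fun k => eLpNorm (f k) 2 μ) atTop (𝓝 0)) :
    Tendsto (fun k => ∫⁻ x, ‖f k x‖ₑ ^ 2 ∂μ) atTop (𝓝 0) := by
  simp only [lintegral_enorm_sq_eq_eLpNorm_sq]
  simpa [Function.comp_def] using ((ENNReal.continuous_pow 2).tendsto 0).comp h

lemma lintegral_mul_enorm_sq_le {μ : Measure α} {W : α → ℝ≥0∞} {f g : α → F}
    (hm : AEMeasurable (fun x => W x * ‖f x‖ₑ ^ 2) μ) :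
    ∫⁻ x, W x * ‖g x‖ₑ ^ 2 ∂μ ≤
      2 * (∫⁻ x, W x * ‖f x‖ₑ ^ 2 ∂μ) + 2 * ∫⁻ x, W x * ‖f x - g x‖ₑ ^ 2 ∂μ := by
  rw [← lintegral_const_mul' _ _ (by finiteness), ← lintegral_const_mul' _ _ (by finiteness),
    ← lintegral_add_left' (hm.const_mul 2)]
  refine lintegral_mono fun x => ?_
  have h1 : ‖g x‖ₑ ≤ ‖f x‖ₑ + ‖f x - g x‖ₑ := by
    calc ‖g x‖ₑ = ‖f x - (f x - g x)‖ₑ := by rw [sub_sub_cancel]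
      _ ≤ _ := enorm_sub_le
  calc W x * ‖g x‖ₑ ^ 2 ≤ W x * (2 * ‖f x‖ₑ ^ 2 + 2 * ‖f x - g x‖ₑ ^ 2) := by
        gcongr
        exact (pow_le_pow_left' h1 2).trans (ennreal_add_sq_le _ _)
    _ = _ := by ring

/-- A quadratic estimate passes to limits in `L²`. -/
lemma lintegral_mul_sq_le_of_tendsto {α' : Type*} [MeasurableSpace α'] {F' : Type*}
    [NormedAddCommGroup F'] {μ : Measure α} {ν : Measure α'} {W : α → ℝ≥0∞} {S C : ℝ≥0∞}
    (hS : S ≠ ⊤) (hC : C ≠ ⊤) (hW : ∀ᵐ x ∂μ, W x ≤ S) {f : ℕ → α → F} {g : α → F}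
    {p : ℕ → α' → F'} {q : α' → F'} (hWf : ∀ k, AEMeasurable (fun x => W x * ‖f k x‖ₑ ^ 2) μ)
    (hq : AEMeasurable (fun x => ‖q x‖ₑ ^ 2) ν)
    (hle : ∀ k, ∫⁻ x, W x * ‖f k x‖ₑ ^ 2 ∂μ ≤ C * ∫⁻ x, ‖p k x‖ₑ ^ 2 ∂ν)
    (hf : Tendsto (fun k => ∫⁻ x, ‖f k x - g x‖ₑ ^ 2 ∂μ) atTop (𝓝 0))
    (hp : Tendsto (fun k => ∫⁻ x, ‖q x - p k x‖ₑ ^ 2 ∂ν) atTop (𝓝 0)) :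
    ∫⁻ x, W x * ‖g x‖ₑ ^ 2 ∂μ ≤ 4 * C * ∫⁻ x, ‖q x‖ₑ ^ 2 ∂ν := by
  -- The factor 4 comes from squaring a sum twice, once on each side of the estimate; the error
  -- terms tend to zero since W is bounded.
  have key : ∀ k, ∫⁻ x, W x * ‖g x‖ₑ ^ 2 ∂μ ≤ 4 * C * (∫⁻ x, ‖q x‖ₑ ^ 2 ∂ν) +
      (4 * C * (∫⁻ x, ‖q x - p k x‖ₑ ^ 2 ∂ν) + 2 * S * ∫⁻ x, ‖f k x - g x‖ₑ ^ 2 ∂μ) := by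
    intro k
    have h1 : ∫⁻ x, W x * ‖f k x - g x‖ₑ ^ 2 ∂μ ≤ S * ∫⁻ x, ‖f k x - g x‖ₑ ^ 2 ∂μ := by
      rw [← lintegral_const_mul' _ _ hS]
      refine lintegral_mono_ae ?_
      filter_upwards [hW] with x hx
      gcongr
    have h2 : ∫⁻ x, ‖p k x‖ₑ ^ 2 ∂ν ≤
        2 * (∫⁻ x, ‖q x‖ₑ ^ 2 ∂ν) + 2 * ∫⁻ x, ‖q x - p k x‖ₑ ^ 2 ∂ν := by
      simpa only [one_mul] using lintegral_mul_enorm_sq_le (W := fun _ => 1) (f := q) (g := p k)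
        (by simpa only [one_mul] using hq)
    calc ∫⁻ x, W x * ‖g x‖ₑ ^ 2 ∂μ
        ≤ 2 * (C * (2 * (∫⁻ x, ‖q x‖ₑ ^ 2 ∂ν) + 2 * ∫⁻ x, ‖q x - p k x‖ₑ ^ 2 ∂ν)) +
          2 * (S * ∫⁻ x, ‖f k x - g x‖ₑ ^ 2 ∂μ) :=
        (lintegral_mul_enorm_sq_le (hWf k)).trans (add_le_add
          (mul_le_mul_right ((hle k).trans (mul_le_mul_right h2 _)) _) (mul_le_mul_right h1 _))
      _ = _ := by ring
  have h1 : Tendsto (fun k => 4 * C * (∫⁻ x, ‖q x - p k x‖ₑ ^ 2 ∂ν) +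
      2 * S * ∫⁻ x, ‖f k x - g x‖ₑ ^ 2 ∂μ) atTop (𝓝 0) := by
    have a := ENNReal.Tendsto.const_mul (a := 4 * C) hp (Or.inr (by finiteness))
    have b := ENNReal.Tendsto.const_mul (a := 2 * S) hf (Or.inr (by finiteness))
    simpa using a.add b
  have h2 := h1.const_add (4 * C * ∫⁻ x, ‖q x‖ₑ ^ 2 ∂ν)
  rw [add_zero] at h2
  exact ge_of_tendsto' h2 key

end Limits

/-- A real vector, seen as a complex one. -/
def complexify (a : E d) : EuclideanSpace ℂ (Fin d) := WithLp.toLp 2 fun j => (a j : ℂ)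

lemma norm_complexify (a : E d) : ‖complexify a‖ = ‖a‖ := by
  simp [complexify, EuclideanSpace.norm_eq]

lemma continuous_complexify : Continuous (complexify : E d → EuclideanSpace ℂ (Fin d)) := by
  unfold complexify
  refine (PiLp.continuous_toLp 2 _).comp (continuous_pi fun j => ?_)
  exact Complex.continuous_ofReal.comp (EuclideanSpace.proj j : E d →L[ℝ] ℝ).continuous

lemma magGrad_eq (A : E d → E d) (β : ℝ) (u : E d → ℂ) (G : E d → EuclideanSpace ℂ (Fin d))
    (x : E d) : magGrad A β u G x = (-Complex.I) • G x + (β * u x) • complexify (A x) := by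
  ext j
  simp [magGrad, complexify]
  ring

lemma magGrad_sub (A : E d → E d) (β : ℝ) (u v : E d → ℂ) (G H : E d → EuclideanSpace ℂ (Fin d))
    (x : E d) : magGrad A β (u - v) (G - H) x = magGrad A β u G x - magGrad A β v H x := by
  simp only [magGrad_eq, Pi.sub_apply, smul_sub, mul_sub, sub_smul]
  abel

lemma enorm_magGrad_le (A : E d → E d) (β : ℝ) (u : E d → ℂ) (G : E d → EuclideanSpace ℂ (Fin d))
    (x : E d) : ‖magGrad A β u G x‖ₑ ≤ ‖G x‖ₑ + ENNReal.ofReal (|β| * ‖A x‖) * ‖u x‖ₑ := by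
  rw [magGrad_eq]
  refine (enorm_add_le _ _).trans (add_le_add (le_of_eq ?_) (le_of_eq ?_))
  · rw [enorm_smul, enorm_neg, ← ofReal_norm Complex.I]; simp
  · rw [← ofReal_norm, ← ofReal_norm, norm_smul, norm_mul, norm_complexify, Complex.norm_real,
      Real.norm_eq_abs, ← ENNReal.ofReal_mul (by positivity)]
    congr 1; ring

lemma exists_norm_le {F : Type*} [NormedAddCommGroup F] {s : Set (E d)} (hs : IsCompact s)
    {f : E d → F} (hf : ContinuousOn f s) : ∃ S : ℝ, 0 ≤ S ∧ ∀ x ∈ s, ‖f x‖ ≤ S := by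
  obtain ⟨S, hS⟩ := hs.exists_bound_of_continuousOn hf
  exact ⟨|S|, abs_nonneg _, fun x hx => (hS x hx).trans (le_abs_self S)⟩

lemma memLp_magGrad {Ω : Set (E d)} (hΩ : IsBoundedLipschitzDomain Ω) {A : E d → E d}
    (hA : ContinuousOn A (closure Ω)) (β : ℝ) {u : E d → ℂ} {G : E d → EuclideanSpace ℂ (Fin d)}
    (hu : MemLp u 2 (volume.restrict Ω)) (hG : MemLp G 2 (volume.restrict Ω)) :
    MemLp (magGrad A β u G) 2 (volume.restrict Ω) := by
  obtain ⟨S, hS0, hS⟩ := exists_norm_le hΩ.isCompact_closure hA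
  have hΩm := hΩ.isOpen.measurableSet
  have : magGrad A β u G = fun x => (-Complex.I) • G x + (β * u x) • complexify (A x) :=
    funext (magGrad_eq A β u G)
  rw [this]
  refine (hG.const_smul (-Complex.I)).add (MemLp.of_le_mul (c := |β| * S) hu ?_ ?_)
  · exact (hu.aestronglyMeasurable.const_mul (β : ℂ)).smul
      ((continuous_complexify.comp_continuousOn (hA.mono subset_closure)).aestronglyMeasurable hΩm)
  · refine (ae_restrict_iff' hΩm).2 (Eventually.of_forall fun x hx => ?_)
    rw [norm_smul, norm_mul, norm_complexify, Complex.norm_real, Real.norm_eq_abs, mul_assoc,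
      mul_assoc, mul_comm S]
    gcongr
    exact hS x (subset_closure hx)

lemma tendsto_lintegral_magGrad_sub {Ω : Set (E d)} (hΩ : IsBoundedLipschitzDomain Ω)
    {A : E d → E d} (hA : ContinuousOn A (closure Ω)) (β : ℝ) {u : E d → ℂ}
    {G : E d → EuclideanSpace ℂ (Fin d)} (hG : MemLp G 2 (volume.restrict Ω)) {φ : ℕ → E d → ℂ}
    (hφ : ∀ k, ContDiff ℝ ∞ (φ k))
    (h1 : Tendsto (fun k => eLpNorm (φ k - u) 2 (volume.restrict Ω)) atTop (𝓝 0))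
    (h2 : Tendsto (fun k => eLpNorm (grad (φ k) - G) 2 (volume.restrict Ω)) atTop (𝓝 0)) :
    Tendsto (fun k => ∫⁻ x in Ω, ‖magGrad A β u G x - magGrad A β (φ k) (grad (φ k)) x‖ₑ ^ 2)
      atTop (𝓝 0) := by
  obtain ⟨S, hS0, hS⟩ := exists_norm_le hΩ.isCompact_closure hA
  have hΩm := hΩ.isOpen.measurableSet
  have k1 := tendsto_lintegral_enorm_sq h1
  have k2 := tendsto_lintegral_enorm_sq h2
  set T : ℝ≥0∞ := ENNReal.ofReal (|β| * S) with hT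
  have k3 : Tendsto (fun k => 2 * (∫⁻ x in Ω, ‖(grad (φ k) - G) x‖ₑ ^ 2) +
      2 * T ^ 2 * ∫⁻ x in Ω, ‖(φ k - u) x‖ₑ ^ 2) atTop (𝓝 0) := by
    have a := ENNReal.Tendsto.const_mul (a := 2) k2 (Or.inr (by finiteness))
    have b := ENNReal.Tendsto.const_mul (a := 2 * T ^ 2) k1 (Or.inr (by finiteness))
    simpa using a.add b
  refine tendsto_of_tendsto_of_tendsto_of_le_of_le tendsto_const_nhds k3 (fun _ => zero_le)
    fun k => ?_
  have hm : AEMeasurable (fun x => 2 * ‖(grad (φ k) - G) x‖ₑ ^ 2) (volume.restrict Ω) := by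
    have hg : Continuous (grad (φ k)) := by
      have : Continuous (fderiv ℝ (φ k)) := (hφ k).continuous_fderiv (by simp)
      exact (PiLp.continuous_toLp 2 _).comp
        (continuous_pi fun j => this.clm_apply continuous_const)
    exact ((hg.aestronglyMeasurable.sub hG.aestronglyMeasurable).enorm.pow_const 2).const_mul 2
  simp only
  rw [← lintegral_const_mul' _ _ (by finiteness), ← lintegral_const_mul' _ _ (by finiteness),
    ← lintegral_add_left' hm]
  refine setLIntegral_mono' hΩm fun x hx => ?_
  rw [← enorm_neg, neg_sub, ← magGrad_sub]
  calc _ ≤ (‖(grad (φ k) - G) x‖ₑ + T * ‖(φ k - u) x‖ₑ) ^ 2 := by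
        refine pow_le_pow_left' ((enorm_magGrad_le A β _ _ x).trans ?_) 2
        gcongr
        exact ENNReal.ofReal_le_ofReal
          (mul_le_mul_of_nonneg_left (hS x (subset_closure hx)) (abs_nonneg β))
    _ ≤ _ := ennreal_add_sq_le _ _
    _ = _ := by rw [mul_pow, mul_assoc]

/-- The energy estimates hold for all functions with a trace. -/
theorem energy_estimates_of_hasTrace {Ω : Set (E d)} (hΩ : IsBoundedLipschitzDomain Ω)
    {A : E d → E d} (hA : ContinuousOn A (closure Ω)) {β : ℝ} {n : E d → ℝ} {C : ℝ}
    (hn : ContinuousOn n (closure Ω))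
    (H : ∀ u : E d → ℂ, ContDiff ℝ 1 u →
        ∫⁻ x in Ω, ENNReal.ofReal (n x ^ 2) * ‖u x‖ₑ ^ 2 ≤
          ENNReal.ofReal C * ∫⁻ x in Ω, ‖magGrad A β u (grad u) x‖ₑ ^ 2 ∧
        ∫⁻ x, ENNReal.ofReal (n x) * ‖u x‖ₑ ^ 2 ∂(surfaceMeasure Ω) ≤
          ENNReal.ofReal C * ∫⁻ x in Ω, ‖magGrad A β u (grad u) x‖ₑ ^ 2)
    {u : E d → ℂ} {G : E d → EuclideanSpace ℂ (Fin d)} {f : E d → ℂ} (hu : MemH1 Ω u G)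
    (hf : HasTrace Ω u G f) :
    ∫⁻ x in Ω, ENNReal.ofReal (n x ^ 2) * ‖u x‖ₑ ^ 2 ≤
        4 * ENNReal.ofReal C * ∫⁻ x in Ω, ‖magGrad A β u G x‖ₑ ^ 2 ∧
      ∫⁻ x, ENNReal.ofReal (n x) * ‖f x‖ₑ ^ 2 ∂(surfaceMeasure Ω) ≤
        4 * ENNReal.ofReal C * ∫⁻ x in Ω, ‖magGrad A β u G x‖ₑ ^ 2 := by
  obtain ⟨-, φ, hφ, h1, h2, h3⟩ := hf
  obtain ⟨S, hS0, hS⟩ := exists_norm_le hΩ.isCompact_closure hn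
  have hΩm := hΩ.isOpen.measurableSet
  have hP := tendsto_lintegral_magGrad_sub hΩ hA β hu.memLp_grad hφ h1 h2
  have hq : AEMeasurable (fun x => ‖magGrad A β u G x‖ₑ ^ 2) (volume.restrict Ω) :=
    (memLp_magGrad hΩ hA β hu.memLp hu.memLp_grad).aestronglyMeasurable.enorm.pow_const 2
  have hφ1 : ∀ k, ContDiff ℝ 1 (φ k) := fun k => (hφ k).of_le (by simp)
  have hφm : ∀ k, Measurable fun x => ‖φ k x‖ₑ ^ 2 := fun k =>
    (hφ k).continuous.measurable.enorm.pow_const 2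
  constructor
  · refine lintegral_mul_sq_le_of_tendsto (S := ENNReal.ofReal (S ^ 2)) (by finiteness)
      (by finiteness) ?_ (fun k => ?_) hq (fun k => (H (φ k) (hφ1 k)).1)
      (tendsto_lintegral_enorm_sq h1) hP
    · refine (ae_restrict_iff' hΩm).2 (Eventually.of_forall fun x hx => ?_)
      refine ENNReal.ofReal_le_ofReal (sq_le_sq' ?_ ?_)
      · linarith [neg_abs_le (n x), hS x (subset_closure hx), Real.norm_eq_abs (n x)]
      · exact (le_abs_self _).trans (hS x (subset_closure hx))
    · exact (ENNReal.measurable_ofReal.comp_aemeasurable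
        (((hn.mono subset_closure).pow 2).aemeasurable hΩm)).mul (hφm k).aemeasurable
  · have hFm : MeasurableSet (frontier Ω) := isClosed_frontier.measurableSet
    refine lintegral_mul_sq_le_of_tendsto (S := ENNReal.ofReal S) (by finiteness)
      (by finiteness) ?_ (fun k => ?_) hq (fun k => (H (φ k) (hφ1 k)).2)
      (tendsto_lintegral_enorm_sq h3) hP
    · refine (ae_restrict_iff' hFm).2 (Eventually.of_forall fun x hx => ?_)
      exact ENNReal.ofReal_le_ofReal ((le_abs_self _).trans (hS x (frontier_subset_closure hx)))
    · exact (ENNReal.measurable_ofReal.comp_aemeasurable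
        ((hn.mono frontier_subset_closure).aemeasurable hFm)).mul (hφm k).aemeasurable

end

/-! ### Multiplication by smooth functions and the weighted energy identity -/

section

variable {d : ℕ}

lemma gradient_apply (ψ : E d → ℝ) (x : E d) (j : Fin d) :
    gradient ψ x j = fderiv ℝ ψ x (e j) := by
  have h := InnerProductSpace.toDual_symm_apply (𝕜 := ℝ) (x := e j) (y := fderiv ℝ ψ x)
  rw [← h, e, real_inner_comm, EuclideanSpace.inner_single_left]
  simp [gradient]

lemma norm_gradient (ψ : E d → ℝ) (x : E d) : ‖gradient ψ x‖ = ‖fderiv ℝ ψ x‖ :=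
  LinearIsometryEquiv.norm_map _ _

lemma continuous_gradient {ψ : E d → ℝ} (hψ : ContDiff ℝ ∞ ψ) : Continuous (gradient ψ) :=
  (LinearIsometryEquiv.continuous _).comp (hψ.continuous_fderiv (by simp))

/-- The weak gradient of `ψ u`, where `G` is the weak gradient of `u`. -/
def mulGrad (ψ : E d → ℝ) (u : E d → ℂ) (G : E d → EuclideanSpace ℂ (Fin d)) (x : E d) :
    EuclideanSpace ℂ (Fin d) :=
  (ψ x : ℂ) • G x + u x • complexify (gradient ψ x)

lemma mulGrad_apply (ψ : E d → ℝ) (u : E d → ℂ) (G : E d → EuclideanSpace ℂ (Fin d)) (x : E d)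
    (j : Fin d) : mulGrad ψ u G x j = ψ x * G x j + u x * (fderiv ℝ ψ x (e j) : ℂ) := by
  simp [mulGrad, complexify, gradient_apply]

lemma grad_ofReal_mul {ψ : E d → ℝ} (hψ : ContDiff ℝ ∞ ψ) {φ : E d → ℂ} (hφ : ContDiff ℝ ∞ φ) :
    grad (fun x => (ψ x : ℂ) * φ x) = mulGrad ψ φ (grad φ) := by
  ext x j
  have h1 : HasFDerivAt (fun x => (ψ x : ℂ)) (Complex.ofRealCLM.comp (fderiv ℝ ψ x)) x :=
    Complex.ofRealCLM.hasFDerivAt.comp x (hψ.differentiable (by simp) x).hasFDerivAt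
  have h2 : HasFDerivAt (fun x => (ψ x : ℂ) * φ x) _ x := h1.mul (hφ.differentiable (by simp) x).hasFDerivAt
  rw [mulGrad_apply]
  simp only [grad]
  rw [h2.fderiv]
  simp

section Multiplication

variable {Ω : Set (E d)} {ψ : E d → ℝ} {u : E d → ℂ} {G : E d → EuclideanSpace ℂ (Fin d)}

lemma contDiff_ofReal_mul (hψ : ContDiff ℝ ∞ ψ) {φ : E d → ℂ} (hφ : ContDiff ℝ ∞ φ) :
    ContDiff ℝ ∞ fun x => (ψ x : ℂ) * φ x :=
  (Complex.ofRealCLM.contDiff.comp hψ).mul hφ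

lemma memLp_ofReal_mul {μ : Measure (E d)} {s : Set (E d)} (hs : IsCompact s)
    (hμ : ∀ᵐ x ∂μ, x ∈ s) (hψ : Continuous ψ) {F : Type*} [NormedAddCommGroup F] [NormedSpace ℂ F]
    {g : E d → F} (hg : MemLp g 2 μ) : MemLp (fun x => (ψ x : ℂ) • g x) 2 μ := by
  obtain ⟨S, -, hS⟩ := exists_norm_le hs hψ.continuousOn
  refine MemLp.of_le_mul (c := S) hg ?_ ?_
  · exact (Complex.continuous_ofReal.comp hψ).aestronglyMeasurable.smul hg.aestronglyMeasurable
  · filter_upwards [hμ] with x hx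
    rw [norm_smul, Complex.norm_real]
    gcongr
    exact hS x hx

lemma memLp_smul_complexify {μ : Measure (E d)} {s : Set (E d)} (hs : IsCompact s)
    (hμ : ∀ᵐ x ∂μ, x ∈ s) {a : E d → E d} (ha : Continuous a)
    (hu : MemLp u 2 μ) : MemLp (fun x => u x • complexify (a x)) 2 μ := by
  obtain ⟨S, -, hS⟩ := exists_norm_le hs ha.continuousOn
  refine MemLp.of_le_mul (c := S) hu ?_ ?_
  · exact hu.aestronglyMeasurable.smul (continuous_complexify.comp ha).aestronglyMeasurable
  · filter_upwards [hμ] with x hx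
    rw [norm_smul, norm_complexify, mul_comm]
    gcongr
    exact hS x hx

lemma ae_mem_closure (hΩ : IsBoundedLipschitzDomain Ω) :
    ∀ᵐ x ∂(volume.restrict Ω), x ∈ closure Ω :=
  (ae_restrict_iff' hΩ.isOpen.measurableSet).2 (Eventually.of_forall fun _ hx => subset_closure hx)

lemma ae_surfaceMeasure_mem_frontier (Ω : Set (E d)) :
    ∀ᵐ x ∂(surfaceMeasure Ω), x ∈ frontier Ω :=
  ae_restrict_mem isClosed_frontier.measurableSet

lemma memLp_mulGrad (hΩ : IsBoundedLipschitzDomain Ω) (hψ : ContDiff ℝ ∞ ψ)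
    (hu : MemLp u 2 (volume.restrict Ω)) (hG : MemLp G 2 (volume.restrict Ω)) :
    MemLp (mulGrad ψ u G) 2 (volume.restrict Ω) :=
  (memLp_ofReal_mul hΩ.isCompact_closure (ae_mem_closure hΩ) hψ.continuous hG).add
    (memLp_smul_complexify hΩ.isCompact_closure (ae_mem_closure hΩ) (continuous_gradient hψ) hu)

/-- The product of an `H¹` function with a smooth function. -/
theorem MemH1.ofReal_mul (hΩ : IsBoundedLipschitzDomain Ω) (hψ : ContDiff ℝ ∞ ψ)
    (h : MemH1 Ω u G) : MemH1 Ω (fun x => (ψ x : ℂ) * u x) (mulGrad ψ u G) where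
  memLp := memLp_ofReal_mul hΩ.isCompact_closure (ae_mem_closure hΩ) hψ.continuous h.memLp
  memLp_grad := memLp_mulGrad hΩ hψ h.memLp h.memLp_grad
  weak_grad φ hφ hφc hφs j := by
    have hΩm := hΩ.isOpen.measurableSet
    have hcomp := hΩ.isCompact_closure
    have : IsFiniteMeasure (volume.restrict Ω) :=
      ⟨by rw [Measure.restrict_apply_univ]
          exact (measure_mono subset_closure).trans_lt hcomp.measure_lt_top⟩
    have hui : IntegrableOn u Ω := h.memLp.integrable one_le_two
    have hGi : IntegrableOn (fun x => G x j) Ω :=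
      (h.memLp_grad.integrable one_le_two).mono
        ((EuclideanSpace.proj j : EuclideanSpace ℂ (Fin d) →L[ℂ] ℂ).continuous.comp_aestronglyMeasurable
          h.memLp_grad.aestronglyMeasurable)
        (Eventually.of_forall fun x => PiLp.norm_apply_le (G x) j)
    have hmul : ∀ {g : E d → ℂ} {w : E d → ℝ}, IntegrableOn g Ω → Continuous w →
        IntegrableOn (fun x => g x * (w x : ℂ)) Ω := fun hg hw =>
      hg.mul_continuousOn_of_subset (Complex.continuous_ofReal.comp hw).continuousOn hΩm hcomp
        subset_closure
    have hψφ := h.weak_grad (fun x => ψ x * φ x) (hψ.mul hφ) hφc.mul_left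
      ((tsupport_mul_subset_right).trans hφs) j
    have hder : ∀ x, fderiv ℝ (fun x => ψ x * φ x) x (e j) =
        ψ x * fderiv ℝ φ x (e j) + φ x * fderiv ℝ ψ x (e j) := fun x => by
      rw [fderiv_fun_mul (hψ.differentiable (by simp) x) (hφ.differentiable (by simp) x)]
      simp
    have hdψ : Continuous fun x => fderiv ℝ ψ x (e j) :=
      (hψ.continuous_fderiv (by simp)).clm_apply continuous_const
    have hdφ : Continuous fun x => fderiv ℝ φ x (e j) :=
      (hφ.continuous_fderiv (by simp)).clm_apply continuous_const
    have i1 : IntegrableOn (fun x => u x * ((ψ x * fderiv ℝ φ x (e j) : ℝ) : ℂ)) Ω :=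
      hmul hui (hψ.continuous.mul hdφ)
    have i2 : IntegrableOn (fun x => u x * ((φ x * fderiv ℝ ψ x (e j) : ℝ) : ℂ)) Ω :=
      hmul hui (hφ.continuous.mul hdψ)
    have i3 : IntegrableOn (fun x => G x j * ((ψ x * φ x : ℝ) : ℂ)) Ω :=
      hmul hGi (hψ.continuous.mul hφ.continuous)
    have e1 : ∫ x in Ω, u x * (fderiv ℝ (fun x => ψ x * φ x) x (e j) : ℂ) =
        (∫ x in Ω, u x * ((ψ x * fderiv ℝ φ x (e j) : ℝ) : ℂ)) +
          ∫ x in Ω, u x * ((φ x * fderiv ℝ ψ x (e j) : ℝ) : ℂ) := by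
      rw [← integral_add i1 i2]
      refine integral_congr_ae (Eventually.of_forall fun x => ?_)
      simp only [hder]
      push_cast
      ring
    have e2 : ∫ x in Ω, mulGrad ψ u G x j * (φ x : ℂ) =
        (∫ x in Ω, G x j * ((ψ x * φ x : ℝ) : ℂ)) +
          ∫ x in Ω, u x * ((φ x * fderiv ℝ ψ x (e j) : ℝ) : ℂ) := by
      rw [← integral_add i3 i2]
      refine integral_congr_ae (Eventually.of_forall fun x => ?_)
      simp only [mulGrad_apply]
      push_cast
      ring
    have e3 : ∫ x in Ω, (ψ x : ℂ) * u x * (fderiv ℝ φ x (e j) : ℂ) =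
        ∫ x in Ω, u x * ((ψ x * fderiv ℝ φ x (e j) : ℝ) : ℂ) := by
      refine integral_congr_ae (Eventually.of_forall fun x => ?_)
      simp only
      push_cast
      ring
    rw [e1] at hψφ
    rw [e2, e3]
    linear_combination hψφ

lemma tendsto_eLpNorm_ofReal_mul {μ : Measure (E d)} {s : Set (E d)} (hs : IsCompact s)
    (hμ : ∀ᵐ x ∂μ, x ∈ s) {F : Type*} [NormedAddCommGroup F] {F' F'' : Type*} [NormedAddCommGroup F']
    [NormedAddCommGroup F''] {w : E d → F''} (hw : Continuous w) {g : ℕ → E d → F} {g' : ℕ → E d → F'}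
    (hg' : ∀ k x, ‖g' k x‖ ≤ ‖w x‖ * ‖g k x‖)
    (hg : Tendsto (fun k => eLpNorm (g k) 2 μ) atTop (𝓝 0)) :
    Tendsto (fun k => eLpNorm (g' k) 2 μ) atTop (𝓝 0) := by
  obtain ⟨S, hS0, hS⟩ := exists_norm_le hs hw.continuousOn
  have h1 := ENNReal.Tendsto.const_mul (a := ENNReal.ofReal S) hg (Or.inr (by finiteness))
  rw [mul_zero] at h1
  refine tendsto_of_tendsto_of_tendsto_of_le_of_le tendsto_const_nhds h1 (fun _ => zero_le)
    fun k => eLpNorm_le_mul_eLpNorm_of_ae_le_mul ?_ 2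
  filter_upwards [hμ] with x hx
  exact (hg' k x).trans (mul_le_mul_of_nonneg_right (hS x hx) (norm_nonneg _))

/-- The trace of the product of an `H¹` function with a smooth function. -/
theorem HasTrace.ofReal_mul (hΩ : IsBoundedLipschitzDomain Ω) (hψ : ContDiff ℝ ∞ ψ)
    (hu : MemH1 Ω u G) {f : E d → ℂ} (h : HasTrace Ω u G f) :
    HasTrace Ω (fun x => (ψ x : ℂ) * u x) (mulGrad ψ u G) (fun x => (ψ x : ℂ) * f x) := by
  obtain ⟨hf, φ, hφ, h1, h2, h3⟩ := h
  have hcomp := hΩ.isCompact_closure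
  have hσ : ∀ᵐ x ∂(surfaceMeasure Ω), x ∈ closure Ω :=
    (ae_surfaceMeasure_mem_frontier Ω).mono fun x hx => frontier_subset_closure hx
  have hvol := ae_mem_closure hΩ
  refine ⟨memLp_ofReal_mul hcomp hσ hψ.continuous hf, fun k x => (ψ x : ℂ) * φ k x,
    fun k => contDiff_ofReal_mul hψ (hφ k), ?_, ?_, ?_⟩
  · refine tendsto_eLpNorm_ofReal_mul hcomp hvol hψ.continuous (fun k x => ?_) h1
    simp only [Pi.sub_apply]
    rw [← mul_sub, norm_mul, Complex.norm_real]
  · have k1 : Tendsto (fun k => eLpNorm (fun x => (ψ x : ℂ) • (grad (φ k) - G) x) 2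
        (volume.restrict Ω)) atTop (𝓝 0) := by
      refine tendsto_eLpNorm_ofReal_mul hcomp hvol hψ.continuous (fun k x => ?_) h2
      rw [norm_smul, Complex.norm_real]
    have k2 : Tendsto (fun k => eLpNorm (fun x => (φ k - u) x • complexify (gradient ψ x)) 2
        (volume.restrict Ω)) atTop (𝓝 0) := by
      refine tendsto_eLpNorm_ofReal_mul hcomp hvol (continuous_gradient hψ) (fun k x => ?_) h1
      rw [norm_smul, norm_complexify, mul_comm]
    have k3 := k1.add k2
    rw [add_zero] at k3
    refine tendsto_of_tendsto_of_tendsto_of_le_of_le tendsto_const_nhds k3 (fun _ => zero_le)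
      fun k => ?_
    have hg : Continuous (grad (φ k)) := by
      have : Continuous (fderiv ℝ (φ k)) := (hφ k).continuous_fderiv (by simp)
      exact (PiLp.continuous_toLp 2 _).comp
        (continuous_pi fun j => this.clm_apply continuous_const)
    have heq : grad (fun x => (ψ x : ℂ) * φ k x) - mulGrad ψ u G =
        (fun x => (ψ x : ℂ) • (grad (φ k) - G) x) +
          fun x => (φ k - u) x • complexify (gradient ψ x) := by
      rw [grad_ofReal_mul hψ (hφ k)]
      ext1 x
      simp only [mulGrad, Pi.sub_apply, Pi.add_apply, smul_sub, sub_smul]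
      abel
    simp only [heq]
    refine eLpNorm_add_le ?_ ?_ one_le_two
    · exact (Complex.continuous_ofReal.comp hψ.continuous).aestronglyMeasurable.smul
        (hg.aestronglyMeasurable.sub hu.memLp_grad.aestronglyMeasurable)
    · exact ((hφ k).continuous.aestronglyMeasurable.sub hu.memLp.aestronglyMeasurable).smul
        (continuous_complexify.comp (continuous_gradient hψ)).aestronglyMeasurable
  · refine tendsto_eLpNorm_ofReal_mul hcomp hσ hψ.continuous (fun k x => ?_) h3
    simp only [Pi.sub_apply]
    rw [← mul_sub, norm_mul, Complex.norm_real]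

lemma magGrad_mulGrad (A : E d → E d) (β : ℝ) (ψ : E d → ℝ) (u : E d → ℂ)
    (G : E d → EuclideanSpace ℂ (Fin d)) (x : E d) :
    magGrad A β (fun x => (ψ x : ℂ) * u x) (mulGrad ψ u G) x =
      (ψ x : ℂ) • magGrad A β u G x + (-Complex.I * u x) • complexify (gradient ψ x) := by
  ext j
  simp only [magGrad_eq, mulGrad, PiLp.add_apply, PiLp.smul_apply, smul_eq_mul]
  ring

lemma gradient_sq (hψ : ContDiff ℝ ∞ ψ) (x : E d) :
    gradient (fun x => ψ x ^ 2) x = (2 * ψ x) • gradient ψ x := by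
  ext j
  rw [PiLp.smul_apply, gradient_apply, gradient_apply]
  have h := ((hψ.differentiable (by simp) x).hasFDerivAt).pow 2
  rw [HasFDerivAt.fderiv (f := fun x => ψ x ^ 2) h]
  simp

/-- The algebra of the Agmon identity. With a = (D+βA)u, w = -iu∇ψ and t = ψ, the magnetic gradients
of ψu and ψ²u are ta + w and t²a + 2tw; as t is real, the cross terms agree and only ‖w‖² is left
over. -/
lemma norm_smul_add_sq {V : Type*} [NormedAddCommGroup V] [InnerProductSpace ℂ V] (t : ℝ)
    (a w : V) : ‖(t : ℂ) • a + w‖ ^ 2 =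
      RCLike.re ⟪((t ^ 2 : ℝ) : ℂ) • a + ((2 * t : ℝ) : ℂ) • w, a⟫_ℂ + ‖w‖ ^ 2 := by
  rw [@norm_add_sq ℂ, inner_add_left, inner_smul_left, inner_smul_left, inner_smul_left,
    inner_self_eq_norm_sq_to_K, norm_smul, Complex.norm_real, ← inner_conj_symm w a]
  simp only [Complex.conj_ofReal, map_add, RCLike.re_to_complex, Complex.re_ofReal_mul,
    Complex.conj_re]
  have : (((‖a‖ : ℂ)) ^ 2).re = ‖a‖ ^ 2 := by rw [← Complex.ofReal_pow, Complex.ofReal_re]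
  simp only [Complex.coe_algebraMap, this]
  rw [mul_pow, Real.norm_eq_abs, sq_abs]
  ring

lemma integrable_inner_of_memLp {α : Type*} [MeasurableSpace α] {μ : Measure α} {V : Type*}
    [NormedAddCommGroup V] [InnerProductSpace ℂ V] {a b : α → V} (ha : MemLp a 2 μ)
    (hb : MemLp b 2 μ) : Integrable (fun x => ⟪a x, b x⟫_ℂ) μ := by
  have h := (ha.integrable_norm_pow two_ne_zero).add (hb.integrable_norm_pow two_ne_zero)
  refine h.mono' (ha.aestronglyMeasurable.inner hb.aestronglyMeasurable)
    (Eventually.of_forall fun x => (norm_inner_le_norm _ _).trans ?_)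
  simp only [Pi.add_apply]
  nlinarith [sq_nonneg (‖a x‖ - ‖b x‖), sq_nonneg (‖a x‖), sq_nonneg (‖b x‖)]

lemma lintegral_enorm_sq_eq_ofReal {α : Type*} [MeasurableSpace α] {μ : Measure α} {V : Type*}
    [NormedAddCommGroup V] {a : α → V} (ha : MemLp a 2 μ) :
    ∫⁻ x, ‖a x‖ₑ ^ 2 ∂μ = ENNReal.ofReal (∫ x, ‖a x‖ ^ 2 ∂μ) := by
  rw [ofReal_integral_eq_lintegral_ofReal (ha.integrable_norm_pow two_ne_zero)
    (Eventually.of_forall fun x => by positivity)]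
  refine lintegral_congr fun x => ?_
  rw [ENNReal.ofReal_pow (norm_nonneg _), ofReal_norm]

/-- The weighted energy identity for a Steklov solution. -/
theorem IsSteklovSolution.weighted_energy (hΩ : IsBoundedLipschitzDomain Ω) {A : E d → E d}
    (hA : ContinuousOn A (closure Ω)) {β lam : ℝ} (hlam : 0 ≤ lam) {f : E d → ℂ}
    (h : IsSteklovSolution Ω A β lam u G f) (hψ : ContDiff ℝ ∞ ψ) :
    ∫⁻ x in Ω, ‖magGrad A β (fun x => (ψ x : ℂ) * u x) (mulGrad ψ u G) x‖ₑ ^ 2 =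
      ENNReal.ofReal lam * (∫⁻ x, ‖(ψ x : ℂ) * f x‖ₑ ^ 2 ∂(surfaceMeasure Ω)) +
        ∫⁻ x in Ω, ‖u x • complexify (gradient ψ x)‖ₑ ^ 2 := by
  have hcomp := hΩ.isCompact_closure
  have hσ : ∀ᵐ x ∂(surfaceMeasure Ω), x ∈ closure Ω :=
    (ae_surfaceMeasure_mem_frontier Ω).mono fun x hx => frontier_subset_closure hx
  have hu := h.memH1
  have hψ2 : ContDiff ℝ ∞ fun x => ψ x ^ 2 := hψ.pow 2
  have m1 : MemLp (magGrad A β (fun x => (ψ x : ℂ) * u x) (mulGrad ψ u G)) 2 (volume.restrict Ω) :=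
    memLp_magGrad hΩ hA β (hu.ofReal_mul hΩ hψ).memLp (hu.ofReal_mul hΩ hψ).memLp_grad
  have m2 : MemLp (fun x => (ψ x : ℂ) * f x) 2 (surfaceMeasure Ω) :=
    memLp_ofReal_mul hcomp hσ hψ.continuous h.hasTrace.1
  have m3 : MemLp (fun x => u x • complexify (gradient ψ x)) 2 (volume.restrict Ω) :=
    memLp_smul_complexify hcomp (ae_mem_closure hΩ) (continuous_gradient hψ) hu.memLp
  have m4 : MemLp (magGrad A β (fun x => ((ψ x ^ 2 : ℝ) : ℂ) * u x)
      (mulGrad (fun x => ψ x ^ 2) u G)) 2 (volume.restrict Ω) :=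
    memLp_magGrad hΩ hA β (hu.ofReal_mul hΩ hψ2).memLp (hu.ofReal_mul hΩ hψ2).memLp_grad
  have m5 := memLp_magGrad hΩ hA β hu.memLp hu.memLp_grad
  have hin := integrable_inner_of_memLp m4 m5
  -- The test function is ψ²u, with trace ψ²f.
  have hw := h.weak_eq _ _ _ (hu.ofReal_mul hΩ hψ2) (h.hasTrace.ofReal_mul hΩ hψ2 hu)
  have hpt : ∀ x, ‖magGrad A β (fun x => (ψ x : ℂ) * u x) (mulGrad ψ u G) x‖ ^ 2 =
      RCLike.re ⟪magGrad A β (fun x => ((ψ x ^ 2 : ℝ) : ℂ) * u x)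
        (mulGrad (fun x => ψ x ^ 2) u G) x, magGrad A β u G x⟫_ℂ +
        ‖u x • complexify (gradient ψ x)‖ ^ 2 := by
    intro x
    have e1 : ‖u x • complexify (gradient ψ x)‖ =
        ‖(-Complex.I * u x) • complexify (gradient ψ x)‖ := by
      rw [norm_smul, norm_smul, norm_mul, norm_neg, Complex.norm_I, one_mul]
    have e2 : (-Complex.I * u x) • complexify (gradient (fun x => ψ x ^ 2) x) =
        ((2 * ψ x : ℝ) : ℂ) • (-Complex.I * u x) • complexify (gradient ψ x) := by
      rw [gradient_sq hψ]
      ext j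
      simp only [complexify, PiLp.smul_apply, smul_eq_mul]
      push_cast
      ring
    rw [e1, magGrad_mulGrad, magGrad_mulGrad, e2]
    exact norm_smul_add_sq _ _ _
  have hbd : ∫ x, f x * (starRingEnd ℂ) (((ψ x ^ 2 : ℝ) : ℂ) * f x) ∂(surfaceMeasure Ω) =
      ((∫ x, ‖(ψ x : ℂ) * f x‖ ^ 2 ∂(surfaceMeasure Ω) : ℝ) : ℂ) := by
    rw [← integral_complex_ofReal]
    refine integral_congr_ae (Eventually.of_forall fun x => ?_)
    simp only
    rw [map_mul, Complex.conj_ofReal, mul_left_comm, Complex.mul_conj, Complex.normSq_eq_norm_sq,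
      norm_mul, Complex.norm_real, mul_pow, Real.norm_eq_abs, sq_abs]
    push_cast
    ring
  rw [hbd, ← Complex.ofReal_mul] at hw
  rw [lintegral_enorm_sq_eq_ofReal m1, lintegral_enorm_sq_eq_ofReal m2,
    lintegral_enorm_sq_eq_ofReal m3, ← ENNReal.ofReal_mul hlam,
    ← ENNReal.ofReal_add (by positivity) (by positivity)]
  congr 1
  rw [integral_congr_ae (Eventually.of_forall hpt), integral_add hin.re
    (m3.integrable_norm_pow two_ne_zero), integral_re hin, hw]
  simp

end Multiplication

end

/-! ### Absorption with an exponential weight -/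

section

variable {d : ℕ}

/-- Absorption. Finiteness of a is essential, and is the reason for working with truncated, hence
bounded, weights. -/
lemma ennreal_le_two_mul_of_le_add_half {a b : ℝ≥0∞} (ha : a ≠ ⊤)
    (h : a ≤ b + ENNReal.ofReal (1 / 2) * a) : a ≤ 2 * b := by
  rcases eq_or_ne b ⊤ with rfl | hb
  · simp
  lift a to ℝ≥0 using ha
  lift b to ℝ≥0 using hb
  have h2 : ENNReal.ofReal (1 / 2) = ((1 / 2 : ℝ≥0) : ℝ≥0∞) := by
    rw [ENNReal.ofReal]; congr 1; ext; simp
  rw [h2] at h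
  norm_cast at h ⊢
  rw [← NNReal.coe_le_coe] at h ⊢
  push_cast at h ⊢
  linarith

/-- The constants and the weight for which the weighted energy estimate closes. -/
structure IsAdmissibleWeight (Ω : Set (E d)) (n φ D : E d → ℝ) (ε b C lam : ℝ) : Prop where
  contDiff : ContDiff ℝ ∞ D
  abs_sub_le : ∀ x ∈ closure Ω, |D x - φ x| ≤ b
  norm_fderiv_le : ∀ x ∈ Ω, (ε * ‖fderiv ℝ D x‖) ^ 2 * C ≤ n x ^ 2 / 2
  large : ∀ x ∈ frontier Ω, φ x = 0 ∨ 4 * C * lam ≤ n x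

section Weight

variable {Ω : Set (E d)} {n φ D : E d → ℝ} {ε b C lam : ℝ} {u : E d → ℂ}
  {G : E d → EuclideanSpace ℂ (Fin d)} {f : E d → ℂ} {A : E d → E d} {β : ℝ}

/-- The gradient of exp(εD) is ε∇D times the weight, and admissibility makes its square at most
n²/(2C) times the squared weight. After the uncertainty inequality with constant C this is half of
the energy. -/
lemma IsAdmissibleWeight.gradient_term_le (hw : IsAdmissibleWeight Ω n φ D ε b C lam) (hC : 0 < C)
    (hε : 0 ≤ ε) (hΩ : IsOpen Ω) :
    ∫⁻ x in Ω, ‖u x • complexify (gradient (fun x => Real.exp (ε * D x)) x)‖ₑ ^ 2 ≤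
      ENNReal.ofReal (1 / (2 * C)) * ∫⁻ x in Ω, ENNReal.ofReal (n x ^ 2) *
        ‖(Real.exp (ε * D x) : ℂ) * u x‖ₑ ^ 2 := by
  rw [← lintegral_const_mul' _ _ (by finiteness)]
  refine setLIntegral_mono' hΩ.measurableSet fun x hx => ?_
  have hder : HasFDerivAt (fun x => Real.exp (ε * D x))
      (Real.exp (ε * D x) • ε • fderiv ℝ D x) x :=
    ((hw.contDiff.differentiable (by simp) x).hasFDerivAt.const_mul ε).exp
  have hnorm : ‖u x • complexify (gradient (fun x => Real.exp (ε * D x)) x)‖ =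
      ε * ‖fderiv ℝ D x‖ * ‖(Real.exp (ε * D x) : ℂ) * u x‖ := by
    rw [norm_smul, norm_complexify, norm_gradient, hder.fderiv, norm_smul, norm_smul, norm_mul,
      Complex.norm_real, Real.norm_of_nonneg hε]
    ring
  rw [← ofReal_norm, hnorm, ← ofReal_norm, ← ENNReal.ofReal_pow (by positivity),
    ← ENNReal.ofReal_pow (by positivity), ← ENNReal.ofReal_mul (by positivity),
    ← ENNReal.ofReal_mul (by positivity)]
  refine ENNReal.ofReal_le_ofReal ?_
  rw [mul_pow, ← mul_assoc]
  refine mul_le_mul_of_nonneg_right ?_ (by positivity)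
  have := hw.norm_fderiv_le x hx
  rw [← le_div_iff₀ hC] at this
  refine this.trans (le_of_eq ?_)
  field_simp

lemma exp_sq_le_of_le {a b : ℝ} (hε : 0 ≤ ε) (h : a ≤ b) :
    Real.exp (ε * a) ^ 2 ≤ Real.exp (2 * ε * b) := by
  rw [← Real.exp_nat_mul]
  refine Real.exp_le_exp.2 ?_
  push_cast
  nlinarith

/-- Where φ = 0, in particular on the well, the weight is bounded since D ≤ b. At the other boundary
points 1 ≤ n/(4Cλ), and the trace inequality will take over. -/
lemma IsAdmissibleWeight.boundary_le (hw : IsAdmissibleWeight Ω n φ D ε b C lam) (hC : 0 < C)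
    (hε : 0 ≤ ε) (hlam : 0 < lam) (hf : AEStronglyMeasurable f (surfaceMeasure Ω)) :
    ∫⁻ x, ‖(Real.exp (ε * D x) : ℂ) * f x‖ₑ ^ 2 ∂(surfaceMeasure Ω) ≤
      ENNReal.ofReal (1 / (4 * C * lam)) * (∫⁻ x, ENNReal.ofReal (n x) *
        ‖(Real.exp (ε * D x) : ℂ) * f x‖ₑ ^ 2 ∂(surfaceMeasure Ω)) +
      ENNReal.ofReal (Real.exp (2 * ε * b)) * ∫⁻ x, ‖f x‖ₑ ^ 2 ∂(surfaceMeasure Ω) := by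
  rw [← lintegral_const_mul' _ _ (by finiteness), ← lintegral_const_mul' _ _ (by finiteness),
    ← lintegral_add_right' _ ((hf.enorm.pow_const 2).const_mul _)]
  refine lintegral_mono_ae ?_
  filter_upwards [ae_surfaceMeasure_mem_frontier Ω] with x hx
  rcases hw.large x hx with h | h
  · refine le_add_of_nonneg_of_le zero_le ?_
    rw [enorm_mul, mul_pow]
    refine mul_le_mul_left ?_ _
    rw [← ofReal_norm, Complex.norm_real, ← ENNReal.ofReal_pow (norm_nonneg _),
      Real.norm_of_nonneg (Real.exp_nonneg _)]
    refine ENNReal.ofReal_le_ofReal (exp_sq_le_of_le hε ?_)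
    have := hw.abs_sub_le x (frontier_subset_closure hx)
    rw [h, sub_zero] at this
    exact (le_abs_self _).trans this
  · refine le_add_of_le_of_nonneg ?_ zero_le
    rw [← mul_assoc, ← ENNReal.ofReal_mul (by positivity)]
    refine le_mul_of_one_le_left' ?_
    rw [ENNReal.one_le_ofReal, div_mul_eq_mul_div, one_mul, one_le_div (by positivity)]
    exact h

/-- The weighted estimates for a Steklov solution and an admissible weight. -/
theorem IsSteklovSolution.weighted_le (h : IsSteklovSolution Ω A β lam u G f)
    (hΩ : IsBoundedLipschitzDomain Ω) (hA : ContinuousOn A (closure Ω)) (hlam : 0 < lam)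
    (hC : 0 < C) (hε : 0 ≤ ε)
    (H : ∀ (u : E d → ℂ) (G : E d → EuclideanSpace ℂ (Fin d)) (f : E d → ℂ), MemH1 Ω u G →
      HasTrace Ω u G f →
      ∫⁻ x in Ω, ENNReal.ofReal (n x ^ 2) * ‖u x‖ₑ ^ 2 ≤
          ENNReal.ofReal C * ∫⁻ x in Ω, ‖magGrad A β u G x‖ₑ ^ 2 ∧
        ∫⁻ x, ENNReal.ofReal (n x) * ‖f x‖ₑ ^ 2 ∂(surfaceMeasure Ω) ≤
          ENNReal.ofReal C * ∫⁻ x in Ω, ‖magGrad A β u G x‖ₑ ^ 2)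
    (hw : IsAdmissibleWeight Ω n φ D ε b C lam) :
    ∫⁻ x, ‖(Real.exp (ε * D x) : ℂ) * f x‖ₑ ^ 2 ∂(surfaceMeasure Ω) ≤
        ENNReal.ofReal (2 * Real.exp (2 * ε * b)) * ∫⁻ x, ‖f x‖ₑ ^ 2 ∂(surfaceMeasure Ω) ∧
      ∫⁻ x in Ω, ENNReal.ofReal (n x ^ 2) * ‖(Real.exp (ε * D x) : ℂ) * u x‖ₑ ^ 2 ≤
        ENNReal.ofReal (4 * C * lam * Real.exp (2 * ε * b)) *
          ∫⁻ x, ‖f x‖ₑ ^ 2 ∂(surfaceMeasure Ω) ∧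
      ∫⁻ x in Ω, ‖(Real.exp (ε * D x) : ℂ) • magGrad A β u G x‖ₑ ^ 2 ≤
        ENNReal.ofReal (12 * lam * Real.exp (2 * ε * b)) *
          ∫⁻ x, ‖f x‖ₑ ^ 2 ∂(surfaceMeasure Ω) := by
  set ψ : E d → ℝ := fun x => Real.exp (ε * D x) with hψdef
  have hψ : ContDiff ℝ ∞ ψ := (contDiff_const.mul hw.contDiff).exp
  have hu := h.memH1
  have hψu := hu.ofReal_mul hΩ hψ
  have hψf := h.hasTrace.ofReal_mul hΩ hψ hu
  have hH := H _ _ _ hψu hψf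
  have hid := h.weighted_energy hΩ hA hlam.le hψ
  have hgrad := hw.gradient_term_le (u := u) hC hε hΩ.isOpen
  have hbd := hw.boundary_le hC hε hlam h.hasTrace.1.aestronglyMeasurable
  have hF : MemLp (magGrad A β (fun x => (ψ x : ℂ) * u x) (mulGrad ψ u G)) 2 (volume.restrict Ω) :=
    memLp_magGrad hΩ hA β hψu.memLp hψu.memLp_grad
  set F := ∫⁻ x in Ω, ‖magGrad A β (fun x => (ψ x : ℂ) * u x) (mulGrad ψ u G) x‖ₑ ^ 2 with hFdef
  set T := ∫⁻ x, ‖(ψ x : ℂ) * f x‖ₑ ^ 2 ∂(surfaceMeasure Ω) with hTdef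
  set Q := ∫⁻ x in Ω, ‖u x • complexify (gradient ψ x)‖ₑ ^ 2 with hQdef
  set J := ∫⁻ x, ‖f x‖ₑ ^ 2 ∂(surfaceMeasure Ω) with hJdef
  have hFfin : F ≠ ⊤ := by
    rw [hFdef, lintegral_enorm_sq_eq_ofReal hF]; finiteness
  have hTfin : T ≠ ⊤ := by
    rw [hTdef, lintegral_enorm_sq_eq_ofReal hψf.1]; finiteness
  have hQF : Q ≤ ENNReal.ofReal (1 / 2) * F := by
    refine hgrad.trans ((mul_le_mul_right hH.1 _).trans (le_of_eq ?_))
    rw [← mul_assoc, ← ENNReal.ofReal_mul (by positivity)]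
    congr 2
    field_simp
  -- First absorption: the gradient term goes into the weighted energy F.
  have hFT : F ≤ 2 * (ENNReal.ofReal lam * T) :=
    ennreal_le_two_mul_of_le_add_half hFfin (hid.le.trans (add_le_add le_rfl hQF))
  -- Second absorption: the first term of `boundary_le` is at most C F/(4Cλ), and F ≤ 2λT turns this
  -- into T/2.
  have hT : T ≤ 2 * (ENNReal.ofReal (Real.exp (2 * ε * b)) * J) := by
    refine ennreal_le_two_mul_of_le_add_half hTfin (hbd.trans ?_)
    rw [add_comm]
    refine add_le_add le_rfl ((mul_le_mul_right (hH.2.trans (mul_le_mul_right hFT _)) _).trans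
      (le_of_eq ?_))
    rw [← ENNReal.ofReal_ofNat 2, ← mul_assoc, ← mul_assoc, ← mul_assoc,
      ← ENNReal.ofReal_mul (by positivity), ← ENNReal.ofReal_mul (by positivity),
      ← ENNReal.ofReal_mul (by positivity)]
    congr 2
    field_simp
    norm_num
  have hFJ : F ≤ ENNReal.ofReal (4 * lam * Real.exp (2 * ε * b)) * J := by
    refine hFT.trans ((mul_le_mul_right (mul_le_mul_right hT _) _).trans (le_of_eq ?_))
    rw [← ENNReal.ofReal_ofNat 2, ← mul_assoc, ← mul_assoc, ← mul_assoc,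
      ← ENNReal.ofReal_mul (by positivity), ← ENNReal.ofReal_mul (by positivity),
      ← ENNReal.ofReal_mul (by positivity)]
    congr 2
    ring
  refine ⟨?_, ?_, ?_⟩
  · rw [ENNReal.ofReal_mul zero_le_two, ENNReal.ofReal_ofNat, mul_assoc]
    exact hT
  · refine hH.1.trans ((mul_le_mul_right hFJ _).trans (le_of_eq ?_))
    rw [← mul_assoc, ← ENNReal.ofReal_mul hC.le]
    congr 2
    ring
  · have hpt : ∀ x, ‖(ψ x : ℂ) • magGrad A β u G x‖ₑ ^ 2 ≤
        2 * ‖magGrad A β (fun x => (ψ x : ℂ) * u x) (mulGrad ψ u G) x‖ₑ ^ 2 +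
          2 * ‖u x • complexify (gradient ψ x)‖ₑ ^ 2 := by
      intro x
      have e1 : ‖u x • complexify (gradient ψ x)‖ₑ =
          ‖(-Complex.I * u x) • complexify (gradient ψ x)‖ₑ := by
        rw [← ofReal_norm, ← ofReal_norm, norm_smul, norm_smul, norm_mul, norm_neg,
          Complex.norm_I, one_mul]
      refine le_trans ?_ (ennreal_add_sq_le _ _)
      refine pow_le_pow_left' ?_ 2
      rw [e1, magGrad_mulGrad]
      calc ‖(ψ x : ℂ) • magGrad A β u G x‖ₑ
          = ‖((ψ x : ℂ) • magGrad A β u G x + (-Complex.I * u x) • complexify (gradient ψ x)) -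
              (-Complex.I * u x) • complexify (gradient ψ x)‖ₑ := by rw [add_sub_cancel_right]
        _ ≤ _ := enorm_sub_le
    calc ∫⁻ x in Ω, ‖(ψ x : ℂ) • magGrad A β u G x‖ₑ ^ 2 ≤ 2 * F + 2 * Q := by
          rw [hFdef, hQdef, ← lintegral_const_mul' _ _ (by finiteness),
            ← lintegral_const_mul' _ _ (by finiteness),
            ← lintegral_add_left' ((hF.aestronglyMeasurable.enorm.pow_const 2).const_mul 2)]
          exact lintegral_mono hpt
      _ ≤ 2 * F + 2 * (ENNReal.ofReal (1 / 2) * F) := add_le_add le_rfl (mul_le_mul_right hQF _)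
      _ = ENNReal.ofReal 3 * F := by
          rw [← mul_assoc, ← add_mul, ← ENNReal.ofReal_ofNat 2,
            ← ENNReal.ofReal_mul (by positivity), ← ENNReal.ofReal_add (by positivity) (by positivity)]
          norm_num
      _ ≤ _ := by
          refine (mul_le_mul_right hFJ _).trans (le_of_eq ?_)
          rw [← mul_assoc, ← ENNReal.ofReal_mul (by positivity)]
          congr 2
          ring

end Weight

/-! ### Removing the truncation of the distance -/

section Truncation

variable {Ω : Set (E d)} {A : E d → E d} {κ : ℕ} {β ε t : ℝ}

lemma truncDist_mono (x : E d) : Monotone fun N => truncDist Ω A κ β t N x := fun N M h =>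
  ENNReal.toReal_mono ((min_le_right _ _).trans_lt (ENNReal.natCast_lt_top M)).ne
    (min_le_min le_rfl (by exact_mod_cast h))

lemma truncDist_eq_zero {x : E d} (hx : x ∈ well Ω A κ β t) (N : ℕ) :
    truncDist Ω A κ β t N x = 0 := by
  simp [truncDist, wellDist_eq_zero hx]

/-- At finite distance the truncation is inactive for large N. At infinite distance the truncated
weights exp(2εN) are unbounded, matching the convention exp ∞ = ∞. -/
lemma expWeight_le_iSup (hε : 0 < ε) (x : E d) : expWeight Ω A κ β ε t x ≤
    ⨆ N : ℕ, ENNReal.ofReal (Real.exp (2 * ε * truncDist Ω A κ β t N x)) := by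
  unfold expWeight truncDist
  generalize wellDist Ω A κ β t x = w
  rcases eq_or_ne w ⊤ with rfl | hw
  · refine le_top.trans (le_of_eq ?_)
    refine (ENNReal.eq_top_of_forall_nnreal_le fun r => ?_).symm
    obtain ⟨N, hN⟩ := exists_nat_ge ((r : ℝ) / (2 * ε))
    refine le_iSup_of_le N ?_
    rw [min_eq_right le_top, ENNReal.toReal_natCast, ← ENNReal.ofReal_coe_nnreal]
    refine ENNReal.ofReal_le_ofReal ?_
    rw [div_le_iff₀' (by positivity)] at hN
    linarith [Real.add_one_le_exp (2 * ε * N)]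
  · obtain ⟨N, hN⟩ := exists_nat_ge w.toReal
    refine le_iSup_of_le N (le_of_eq ?_)
    have hwN : w ≤ N := by
      rw [← ENNReal.ofReal_toReal hw, ← ENNReal.ofReal_natCast]
      exact ENNReal.ofReal_le_ofReal hN
    rw [min_eq_left hwN]
    have : (w : EReal) = ((w.toReal : ℝ) : EReal) := by
      rw [← EReal.toReal_coe_ennreal, EReal.coe_toReal (by simpa using hw) (by simp)]
    rw [this, ← EReal.coe_mul, EReal.exp_coe]

lemma lintegral_expWeight_mul_le (hε : 0 < ε) {μ : Measure (E d)} {g : E d → ℝ≥0∞}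
    (hg : AEMeasurable g μ) (hφ : ∀ N, AEMeasurable (truncDist Ω A κ β t N) μ) {B : ℝ≥0∞}
    (h : ∀ N, ∫⁻ x, ENNReal.ofReal (Real.exp (2 * ε * truncDist Ω A κ β t N x)) * g x ∂μ ≤ B) :
    ∫⁻ x, expWeight Ω A κ β ε t x * g x ∂μ ≤ B := by
  calc ∫⁻ x, expWeight Ω A κ β ε t x * g x ∂μ
      ≤ ∫⁻ x, ⨆ N : ℕ, ENNReal.ofReal (Real.exp (2 * ε * truncDist Ω A κ β t N x)) * g x ∂μ := by
        refine lintegral_mono fun x => ?_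
        rw [← ENNReal.iSup_mul]
        exact mul_le_mul_left (expWeight_le_iSup hε x) _
    _ = ⨆ N : ℕ, ∫⁻ x, ENNReal.ofReal (Real.exp (2 * ε * truncDist Ω A κ β t N x)) * g x ∂μ := by
        refine lintegral_iSup' (fun N => ?_) (Eventually.of_forall fun x N M hNM => ?_)
        · exact (((hφ N).const_mul (2 * ε)).exp.ennreal_ofReal).mul hg
        · refine mul_le_mul_left (ENNReal.ofReal_le_ofReal (Real.exp_le_exp.2 ?_)) _
          exact mul_le_mul_of_nonneg_left (truncDist_mono x hNM) (by positivity)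
    _ ≤ B := iSup_le h

lemma ofReal_exp_le_enorm_sq {a D b : ℝ} (hε : 0 ≤ ε) (h : |D - a| ≤ b) :
    ENNReal.ofReal (Real.exp (2 * ε * a)) ≤
      ENNReal.ofReal (Real.exp (2 * ε * b)) * ‖(Real.exp (ε * D) : ℂ)‖ₑ ^ 2 := by
  rw [← ofReal_norm, Complex.norm_real, Real.norm_of_nonneg (Real.exp_nonneg _),
    ← ENNReal.ofReal_pow (Real.exp_nonneg _), ← ENNReal.ofReal_mul (Real.exp_nonneg _),
    ← Real.exp_nat_mul, ← Real.exp_add]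
  refine ENNReal.ofReal_le_ofReal (Real.exp_le_exp.2 ?_)
  push_cast
  nlinarith [neg_le_of_abs_le h]

/-- If the smooth weights close to the truncated distances have uniformly bounded integrals, so
does the exponential weight. -/
lemma lintegral_expWeight_mul_le_of_weights (hε : 0 < ε) {μ : Measure (E d)}
    (hμ : ∀ᵐ x ∂μ, x ∈ closure Ω) {g : E d → ℝ≥0∞} (hg : AEMeasurable g μ)
    (hφ : ∀ N, AEMeasurable (truncDist Ω A κ β t N) μ) {D : ℕ → E d → ℝ} {b : ℝ}
    (hD : ∀ N, ∀ x ∈ closure Ω, |D N x - truncDist Ω A κ β t N x| ≤ b) {B : ℝ≥0∞}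
    (h : ∀ N, ∫⁻ x, ‖(Real.exp (ε * D N x) : ℂ)‖ₑ ^ 2 * g x ∂μ ≤ B) :
    ∫⁻ x, expWeight Ω A κ β ε t x * g x ∂μ ≤ ENNReal.ofReal (Real.exp (2 * ε * b)) * B := by
  refine lintegral_expWeight_mul_le hε hg hφ fun N => ?_
  refine le_trans ?_ (mul_le_mul_right (h N) _)
  rw [← lintegral_const_mul' _ _ (by finiteness)]
  refine lintegral_mono_ae ?_
  filter_upwards [hμ] with x hx
  rw [← mul_assoc]
  exact mul_le_mul_left (ofReal_exp_le_enorm_sq hε.le (hD N x hx)) _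

end Truncation

end

/-! ### Admissible weights and the decay theorem -/

section

variable {d : ℕ}

/-- The smoothed truncated Agmon distances are admissible weights, uniformly in the field. -/
theorem exists_admissible_weights {Ω : Set (E d)} (hΩ : IsBoundedLipschitzDomain Ω) {δ θ : ℝ}
    (hU : UniformConeOn Ω (closure Ω) δ θ) (κ : ℕ) {c C₀ Cm C : ℝ} (hc : 0 < c) (hC₀ : 1 ≤ C₀)
    (hCm : 0 < Cm) (hC : 0 < C) :
    ∃ ε b : ℝ, 0 < ε ∧ ∀ (A : E d → E d) (β : ℝ) (n : E d → ℝ), IsSlowScale Ω n c C₀ →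
      (∀ x ∈ closure Ω, 1 ≤ δ * n x) → (∀ x ∈ closure Ω, mTilde Ω A κ β x ≤ Cm * n x) →
      ∀ t lam : ℝ, 4 * C * Cm * lam ≤ t →
      (∀ N, ContinuousOn (truncDist Ω A κ β t N) (closure Ω)) ∧
      ∀ N, ∃ D, IsAdmissibleWeight Ω n (truncDist Ω A κ β t N) D ε b C lam := by
  obtain ⟨Cs, hCs, hsm⟩ := exists_smoothing hΩ hU
  have hθ := hU.aperture_pos
  set c' := min (θ / 2) (c / (4 / θ + 1)) with hc'
  have hc'0 : 0 < c' := by positivity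
  set L := Cm * C₀ * (4 / θ + 1) with hL
  have hL0 : 0 < L := by positivity
  -- With |∇D| ≤ Cs L n this gives (ε|∇D|)²C ≤ n²C/(4(C+1)²) ≤ n²/2, the bound that admissibility
  -- asks for.
  set ε := 1 / (2 * (Cs * L) * (C + 1)) with hε
  refine ⟨ε, L * c', by positivity, fun A β n hn hδn hm t lam ht => ?_⟩
  have hlip : ∀ N, ∀ x ∈ closure Ω, ∀ y ∈ closure Ω, dist x y * n x ≤ c' →
      |truncDist Ω A κ β t N y - truncDist Ω A κ β t N x| ≤ L * n x * dist x y :=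
    fun N x hx y hy hxy => abs_truncDist_sub_le hU hn hδn hCm.le hm t N hx hy hxy
  refine ⟨fun N => continuousOn_of_scale_lipschitz hc'0 (hlip N), fun N => ?_⟩
  obtain ⟨D, hD, hDφ, hDgrad⟩ := hsm n _ c' L hc'0 hL0.le hn.continuousOn hn.pos (hlip N)
  refine ⟨D, hD, hDφ, fun x hx => ?_, fun x hx => ?_⟩
  · have hp := hn.pos x (subset_closure hx)
    calc (ε * ‖fderiv ℝ D x‖) ^ 2 * C ≤ (ε * (Cs * L * n x)) ^ 2 * C := by
          gcongr
          exact hDgrad x hx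
      _ = n x ^ 2 / 2 * (C / (2 * (C + 1) ^ 2)) := by
          rw [hε]; field_simp
      _ ≤ n x ^ 2 / 2 * 1 := by
          gcongr
          rw [div_le_one (by positivity)]
          nlinarith
      _ = _ := mul_one _
  · by_cases hw : x ∈ well Ω A κ β t
    · exact Or.inl (truncDist_eq_zero hw N)
    · refine Or.inr ?_
      have h1 : t ≤ mTilde Ω A κ β x := by
        by_contra h
        exact hw ⟨hx, not_le.1 h⟩
      have h2 := (ht.trans h1).trans (hm x (frontier_subset_closure hx))
      have : Cm * (4 * C * lam) ≤ Cm * n x := by linarith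
      exact le_of_mul_le_mul_left this hCm

/-- Exponential decay of Steklov eigenfunctions away from the magnetic well. -/
theorem exists_steklov_decay (hd : 2 ≤ d) (Ω : Set (E d)) (hΩ : IsBoundedLipschitzDomain Ω)
    (κ : ℕ) (τ : ℝ) (hτ : 0 < τ) (M K : ℝ≥0) :
    ∃ ε β₀ C : ℝ, 0 < ε ∧ 1 < β₀ ∧ 0 < C ∧ ∀ A : E d → E d,
      ContDiffOn ℝ (κ + 1 : ℕ) A (closure Ω) →
      ContDiffOn ℝ (κ + 1 : ℕ) (magField Ω A) (closure Ω) →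
      CkNorm (κ + 1) (closure Ω) (magField Ω A) ≤ M → IsFiniteType Ω A κ τ →
      ∀ β lam : ℝ, β₀ < β → 0 < lam →
      ∀ (u : E d → ℂ) (G : E d → EuclideanSpace ℂ (Fin d)) (f : E d → ℂ),
        IsSteklovSolution Ω A β lam u G f →
        (∫⁻ x, expWeight Ω A κ β ε (C * lam) x * ‖f x‖ₑ ^ 2 ∂(surfaceMeasure Ω)
            ≤ ENNReal.ofReal C * ∫⁻ x, ‖f x‖ₑ ^ 2 ∂(surfaceMeasure Ω)) ∧
        (∀ B' : E d → EuclideanSpace ℝ (Fin d × Fin d), IsFieldExtension Ω A (κ + 1) K B' →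
          ∫⁻ x in Ω, expWeight Ω A κ β ε (C * lam) x * mFun (fun y => β • B' y) x ^ 2 *
              ‖u x‖ₑ ^ 2
            ≤ ENNReal.ofReal (C * lam) * ∫⁻ x, ‖f x‖ₑ ^ 2 ∂(surfaceMeasure Ω)) ∧
        (∫⁻ x in Ω, expWeight Ω A κ β ε (C * lam) x * ‖magGrad A β u G x‖ₑ ^ 2
            ≤ ENNReal.ofReal (C * lam) * ∫⁻ x, ‖f x‖ₑ ^ 2 ∂(surfaceMeasure Ω)) := by
  obtain ⟨δ, θ, hU⟩ := exists_uniformConeOn hd hΩ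
  obtain ⟨c, C₀, n₀, C₁, hc, hC₀, hC₁, hen⟩ := exists_energy_estimates hd hΩ hU κ
  set Cm : ℝ := ((multiIndexCount d κ : ℕ) : ℝ) with hCm
  have hCm0 : 0 < Cm := by rw [hCm]; exact_mod_cast multiIndexCount_pos d κ
  -- The energy constant is 4C₁ and not C₁ because passing from smooth functions to H¹ loses a
  -- factor 4.
  obtain ⟨ε, b, hε, hwt⟩ := exists_admissible_weights hΩ hU κ hc hC₀ hCm0
    (C := 4 * C₁) (by positivity)
  -- The bound M controls the field on the closure, as needed for slow variation; K M controls its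
  -- extension, as needed for m.
  obtain ⟨β₀, hβ₀, hlarge⟩ := exists_fieldScale_large (d := d) (κ := κ) hτ n₀ (max (M : ℝ) (K * M))
  set X : ℝ := Real.exp (2 * ε * b) with hX
  have hX0 : 0 < X := Real.exp_pos _
  -- The first term makes the threshold Cλ of the well high enough for admissibility; the other
  -- three serve the three estimates. Each carries X twice: once from the bound of D on the well,
  -- once from replacing the truncated distance by D. The factor (κ+2)² comes from m ≤ (κ+2)n.
  set C : ℝ := 4 * (4 * C₁) * Cm + 2 * X ^ 2 + 4 * (4 * C₁) * X ^ 2 * ((κ : ℝ) + 2) ^ 2 +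
    12 * X ^ 2 with hC
  have hCpos : 0 < C := by positivity
  refine ⟨ε, β₀, C, hε, hβ₀, hCpos, fun A hA hB hM hft β lam hβ hlam u G f hsol => ?_⟩
  have hβ0 : 0 < β := by linarith
  have hs := hU.uniqueDiffOn
  have hl := hlarge hs hB hft β hβ
  have hA1 : ContDiffOn ℝ 1 A (closure Ω) := hA.of_le (by exact_mod_cast Nat.le_add_left 1 κ)
  have hsc : IsScaled κ (closure Ω) (fun x => β • magField Ω A x) :=
    isScaled_field hs hB hM hβ0.le fun x hx =>
      ⟨(hl x hx).2.1, (mul_le_mul_of_nonneg_left (le_max_left _ _) hβ0.le).trans (hl x hx).2.2⟩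
  obtain ⟨hn, hδn, hH⟩ := hen A β hA1 hB.continuousOn hsc fun x hx => (hl x hx).1
  set n := fieldScale Ω A κ β with hndef
  have hm : ∀ x ∈ closure Ω, mTilde Ω A κ β x ≤ Cm * n x := fun x hx => mTilde_le hs hB hβ0.le hx
  have hH' : ∀ (u : E d → ℂ) (G : E d → EuclideanSpace ℂ (Fin d)) (f : E d → ℂ), MemH1 Ω u G →
      HasTrace Ω u G f →
      ∫⁻ x in Ω, ENNReal.ofReal (n x ^ 2) * ‖u x‖ₑ ^ 2 ≤
          ENNReal.ofReal (4 * C₁) * ∫⁻ x in Ω, ‖magGrad A β u G x‖ₑ ^ 2 ∧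
        ∫⁻ x, ENNReal.ofReal (n x) * ‖f x‖ₑ ^ 2 ∂(surfaceMeasure Ω) ≤
          ENNReal.ofReal (4 * C₁) * ∫⁻ x in Ω, ‖magGrad A β u G x‖ₑ ^ 2 := by
    intro u G f hu hf
    rw [ENNReal.ofReal_mul (by norm_num), ENNReal.ofReal_ofNat]
    exact energy_estimates_of_hasTrace hΩ hA1.continuousOn hn.continuousOn hH hu hf
  have ht : 4 * (4 * C₁) * Cm * lam ≤ C * lam := by
    refine mul_le_mul_of_nonneg_right ?_ hlam.le
    rw [hC]
    have : 0 ≤ 2 * X ^ 2 + 4 * (4 * C₁) * X ^ 2 * ((κ : ℝ) + 2) ^ 2 + 12 * X ^ 2 := by positivity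
    linarith
  obtain ⟨hcont, hD⟩ := hwt A β n hn hδn hm (C * lam) lam ht
  choose D hD using hD
  have hW := fun N => hsol.weighted_le hΩ hA1.continuousOn hlam (by positivity : 0 < 4 * C₁)
    hε.le hH' (hD N)
  have hΩm := hΩ.isOpen.measurableSet
  have hFm : MeasurableSet (frontier Ω) := isClosed_frontier.measurableSet
  have hvol := ae_mem_closure hΩ
  have hσ : ∀ᵐ x ∂(surfaceMeasure Ω), x ∈ closure Ω :=
    (ae_surfaceMeasure_mem_frontier Ω).mono fun x hx => frontier_subset_closure hx
  have mvol : ∀ N, AEMeasurable (truncDist Ω A κ β (C * lam) N) (volume.restrict Ω) := fun N =>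
    ((hcont N).mono subset_closure).aemeasurable hΩm
  have mσ : ∀ N, AEMeasurable (truncDist Ω A κ β (C * lam) N) (surfaceMeasure Ω) := fun N =>
    ((hcont N).mono frontier_subset_closure).aemeasurable hFm
  set J := ∫⁻ x, ‖f x‖ₑ ^ 2 ∂(surfaceMeasure Ω) with hJ
  have hconst : ∀ {a a' : ℝ}, 0 ≤ a → X * a ≤ a' →
      ENNReal.ofReal X * (ENNReal.ofReal a * J) ≤ ENNReal.ofReal a' * J := by
    intro a a' ha h
    rw [← mul_assoc, ← ENNReal.ofReal_mul hX0.le]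
    exact mul_le_mul_left (ENNReal.ofReal_le_ofReal h) _
  have hterm : 0 ≤ 4 * (4 * C₁) * Cm ∧ 0 ≤ 2 * X ^ 2 ∧
      0 ≤ 4 * (4 * C₁) * X ^ 2 * ((κ : ℝ) + 2) ^ 2 ∧ 0 ≤ 12 * X ^ 2 :=
    ⟨by positivity, by positivity, by positivity, by positivity⟩
  refine ⟨?_, fun B' hB' => ?_, ?_⟩
  · refine (lintegral_expWeight_mul_le_of_weights hε hσ
      (hsol.hasTrace.1.aestronglyMeasurable.enorm.pow_const 2) mσ (fun N => (hD N).abs_sub_le)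
      fun N => ?_).trans (hconst (a := 2 * X) (by positivity) ?_)
    · refine le_trans (le_of_eq (lintegral_congr fun x => ?_)) (hW N).1
      rw [enorm_mul, mul_pow]
    · rw [hC]; nlinarith
  · have hmF : ∀ x ∈ Ω, mFun (fun y => β • B' y) x ^ 2 ≤
        ENNReal.ofReal (((κ : ℝ) + 2) ^ 2) * ENNReal.ofReal (n x ^ 2) := by
      intro x hx
      have hxc := subset_closure hx
      have hp := hn.pos x hxc
      have h1 := mFun_le hΩ.isOpen hM hB' hβ0.le hx (hl x hxc).2.1
        ((mul_le_mul_of_nonneg_left (le_max_right _ _) hβ0.le).trans (hl x hxc).2.2)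
      refine (pow_le_pow_left' h1 2).trans (le_of_eq ?_)
      rw [← ENNReal.ofReal_pow (by positivity), ← ENNReal.ofReal_mul (by positivity), mul_pow]
    have hg : AEMeasurable (fun x => ENNReal.ofReal (n x ^ 2) * ‖u x‖ₑ ^ 2)
        (volume.restrict Ω) :=
      (((hn.continuousOn.mono subset_closure).pow 2).aemeasurable hΩm).ennreal_ofReal.mul
        (hsol.memH1.memLp.aestronglyMeasurable.enorm.pow_const 2)
    have key := lintegral_expWeight_mul_le_of_weights hε hvol hg mvol
      (fun N => (hD N).abs_sub_le) fun N => by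
        refine le_trans (le_of_eq (lintegral_congr fun x => ?_)) (hW N).2.1
        rw [enorm_mul, mul_pow]
        ring
    calc ∫⁻ x in Ω, expWeight Ω A κ β ε (C * lam) x * mFun (fun y => β • B' y) x ^ 2 * ‖u x‖ₑ ^ 2
        ≤ ∫⁻ x in Ω, ENNReal.ofReal (((κ : ℝ) + 2) ^ 2) * (expWeight Ω A κ β ε (C * lam) x *
            (ENNReal.ofReal (n x ^ 2) * ‖u x‖ₑ ^ 2)) := by
          refine setLIntegral_mono' hΩm fun x hx => ?_
          refine (mul_le_mul_left (mul_le_mul_right (hmF x hx) _) _).trans (le_of_eq ?_)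
          ring
      _ ≤ ENNReal.ofReal (((κ : ℝ) + 2) ^ 2) * (ENNReal.ofReal X *
            (ENNReal.ofReal (4 * (4 * C₁) * lam * X) * J)) := by
          rw [lintegral_const_mul' _ _ (by finiteness)]
          exact mul_le_mul_right key _
      _ ≤ _ := by
          rw [← mul_assoc, ← mul_assoc, ← ENNReal.ofReal_mul (by positivity),
            ← ENNReal.ofReal_mul (by positivity)]
          refine mul_le_mul_left (ENNReal.ofReal_le_ofReal ?_) _
          calc ((κ : ℝ) + 2) ^ 2 * X * (4 * (4 * C₁) * lam * X)
              = 4 * (4 * C₁) * X ^ 2 * ((κ : ℝ) + 2) ^ 2 * lam := by ring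
            _ ≤ C * lam := by
              refine mul_le_mul_of_nonneg_right ?_ hlam.le
              rw [hC]; linarith
  · have hPm : AEMeasurable (fun x => ‖magGrad A β u G x‖ₑ ^ 2) (volume.restrict Ω) :=
      (memLp_magGrad hΩ hA1.continuousOn β hsol.memH1.memLp
        hsol.memH1.memLp_grad).aestronglyMeasurable.enorm.pow_const 2
    refine (lintegral_expWeight_mul_le_of_weights hε hvol hPm mvol (fun N => (hD N).abs_sub_le)
      fun N => ?_).trans (hconst (a := 12 * lam * X) (by positivity) ?_)
    · refine le_trans (le_of_eq (lintegral_congr fun x => ?_)) (hW N).2.2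
      rw [enorm_smul, mul_pow]
    · calc X * (12 * lam * X) = 12 * X ^ 2 * lam := by ring
        _ ≤ C * lam := by
          refine mul_le_mul_of_nonneg_right ?_ hlam.le
          rw [hC]; linarith

end

end MagneticSteklov

end

theorem theorem3 {d : ℕ} (hd : 2 ≤ d)
    (Ω : Set (MagneticSteklov.E d)) (hΩ : MagneticSteklov.IsBoundedLipschitzDomain Ω)
    (κ : ℕ) (τ : ℝ) (hτ : 0 < τ) (M K : ℝ≥0) :
    ∃ ε β₀ C : ℝ, 0 < ε ∧ 1 < β₀ ∧ 0 < C ∧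
      ∀ A : MagneticSteklov.E d → MagneticSteklov.E d,
        ContDiffOn ℝ (κ + 1 : ℕ) A (closure Ω) →
        ContDiffOn ℝ (κ + 1 : ℕ) (MagneticSteklov.magField Ω A) (closure Ω) →
        MagneticSteklov.CkNorm (κ + 1) (closure Ω) (MagneticSteklov.magField Ω A) ≤ M →
        MagneticSteklov.IsFiniteType Ω A κ τ →
        ∀ β lam : ℝ, β₀ < β → 0 < lam →
        ∀ (u : MagneticSteklov.E d → ℂ)
          (G : MagneticSteklov.E d → EuclideanSpace ℂ (Fin d)) (f : MagneticSteklov.E d → ℂ),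
          MagneticSteklov.IsSteklovSolution Ω A β lam u G f →
          (∫⁻ x, MagneticSteklov.expWeight Ω A κ β ε (C * lam) x * ‖f x‖ₑ ^ 2
                ∂(MagneticSteklov.surfaceMeasure Ω)
              ≤ ENNReal.ofReal C * ∫⁻ x, ‖f x‖ₑ ^ 2 ∂(MagneticSteklov.surfaceMeasure Ω)) ∧
          (∀ B' : MagneticSteklov.E d → EuclideanSpace ℝ (Fin d × Fin d),
            MagneticSteklov.IsFieldExtension Ω A (κ + 1) K B' →
            ∫⁻ x in Ω, MagneticSteklov.expWeight Ω A κ β ε (C * lam) x *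
                  MagneticSteklov.mFun (fun y => β • B' y) x ^ 2 * ‖u x‖ₑ ^ 2
              ≤ ENNReal.ofReal (C * lam) *
                  ∫⁻ x, ‖f x‖ₑ ^ 2 ∂(MagneticSteklov.surfaceMeasure Ω)) ∧
          (∫⁻ x in Ω, MagneticSteklov.expWeight Ω A κ β ε (C * lam) x *
                ‖MagneticSteklov.magGrad A β u G x‖ₑ ^ 2
              ≤ ENNReal.ofReal (C * lam) *
                  ∫⁻ x, ‖f x‖ₑ ^ 2 ∂(MagneticSteklov.surfaceMeasure Ω)) :=
  MagneticSteklov.exists_steklov_decay hd Ω hΩ κ τ hτ M K
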